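/- Fix $n\ge 1$ and a (Hausdorff, second countable) smooth manifold $X$. Write $\mathbb{T}^n=(\mathbb{R}/\mathbb{Z})^n$ and $\mathrm{U}(1)=\mathbb{R}/\mathbb{Z}$ additively, let $\mathfrak{so}(n,\mathbb{Z})$ be the additive group of skew-symmetric integral $n\times n$ matrices, and put $\langle v|B|w\rangle_{low}=\sum_{q<p}B_{pq}v_pw_q$. On overlaps, "integral" data are locally constant functions and all other data are smooth functions; scalar products with values in $\mathbb{R}$ are read in $\mathrm{U}(1)$ where necessary. **T-duality correspondences.** A *T-duality correspondence* over $X$ is a cocycle $\mathcal{C}=(a,\hat a,m,\hat m,t)$ for the T-duality 2-group $\mathbb{TD}_n$ with respect to an open cover $(U_i)$: functions $a_{ij},\hat a_{ij}:U_i\cap U_j\to\mathbb{R}^n$, $m_{ijk},\hat m_{ijk}:U_i\cap U_j\cap U_k\to\mathbb{Z}^n$, $t_{ijk}:U_i\cap U_j\cap U_k\to \mathrm{U}(1)$ with $a_{ii}=\hat a_{ii}=0$, $t_{iij}=t_{ijj}=0$ and $$a_{ik}=m_{ijk}+a_{jk}+a_{ij},\qquad \hat a_{ik}=\hat m_{ijk}+\hat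 a_{jk}+\hat a_{ij},\qquad t_{ikl}+t_{ijk}-m_{ijk}\cdot\hat a_{kl}=t_{ijl}+t_{jkl}.$$ Two of them are *isomorphic* if on a common refinement of their covers there are $p_i,\hat p_i$ with values in $\mathbb{R}^n$, $z_{ij},\hat z_{ij}$ with values in $\mathbb{Z}^n$ and $e_{ij}$ with values in $\mathrm{U}(1)$ such that $$a'_{ij}+p_i=z_{ij}+p_j+a_{ij},\quad \hat a'_{ij}+\hat p_i=\hat z_{ij}+\hat p_j+\hat a_{ij},\quad t'_{ijk}+e_{ij}-\hat a'_{jk}\cdot z_{ij}+e_{jk}=e_{ik}+t_{ijk}-\hat p_k\cdot m_{ijk}.$$ **Half-geometric T-duality correspondences.** A *half-geometric T-duality correspondence* is a cocycle $(B,a,\hat a,m,\hat m,t)$ for the semi-direct product 2-group $\mathbb{TD}_n\rtimes\mathfrak{so}(n,\mathbb{Z})$, i.e. $B_{ij}$ takes values in $\mathfrak{so}(n,\mathbb{Z})$, the other data are as before, with $B_{ii}=0$, $a_{ii}=\hat a_{ii}=0$, $t_{iij}=t_{ijj}=0$, and $$B_{ik}=B_{jk}+B_{ij},\quad a_{ik}=m_{ijk}+a_{jk}+a_{ij},\quad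 \hat a_{ik}=\hat m_{ijk}+\hat a_{jk}+\hat a_{ij}+B_{jk}a_{ij},$$ $$t_{ikl}+t_{ijk}=\hat a_{kl}\cdot m_{ijk}+\langle m_{ijk}|B_{kl}|a_{ik}\rangle_{low}+\langle a_{jk}|B_{kl}|a_{ij}\rangle_{low}+t_{ijl}+t_{jkl}.$$ Two of them are *isomorphic* if on a common refinement there are $D_i$ (with values in $\mathfrak{so}(n,\mathbb{Z})$), $p_i,\hat p_i,z_{ij},\hat z_{ij},e_{ij}$ such that $D_j+B_{ij}=B'_{ij}+D_i$, $z_{ij}+p_j+a_{ij}=a'_{ij}+p_i$, $\hat z_{ij}+\hat p_j+D_ja_{ij}+\hat a_{ij}=\hat a'_{ij}+B'_{ij}p_i+\hat p_i$ and $$t'_{ijk}+\langle a'_{ij}|B'_{jk}|p_i\rangle_{low}-\langle z_{ij}|B'_{jk}|p_j+a_{ij}\rangle_{low}+e_{ij}-\hat a'_{jk}\cdot z_{ij}-\langle p_j|B'_{jk}|a_{ij}\rangle_{low}+e_{jk}$$ $$=e_{ik}-\langle m_{ijk}|D_k|a_{ik}\rangle_{low}+t_{ijk}-\hat p_k\cdot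 m_{ijk}-\langle a_{jk}|D_k|a_{ij}\rangle_{low}.$$ A T-duality correspondence becomes a half-geometric one by setting $B_{ij}=0$. **Action of $\mathfrak{so}(n,\mathbb{Z})$.** For $B\in\mathfrak{so}(n,\mathbb{Z})$ the 2-group automorphism $F_{e^B}$ of $\mathbb{TD}_n$ sends a T-duality correspondence $(a,\hat a,m,\hat m,t)$ to $(F_{e^B})_*(\mathcal{C})=(a,\;Ba+\hat a,\;m,\;Bm+\hat m,\;t')$ with $t'_{ijk}=t_{ijk}-\langle m_{ijk}|B|a_{jk}+a_{ij}\rangle_{low}-\langle a_{jk}|B|a_{ij}\rangle_{low}$. **T-backgrounds and left legs.** A *T-background* over $X$ is a principal $\mathbb{T}^n$-bundle $E\to X$ together with a $\mathrm{U}(1)$-bundle gerbe $\mathcal{G}$ over $E$; an isomorphism of T-backgrounds is a bundle isomorphism $f:E\to E'$ over $X$ for which $\mathcal{G}\cong f^*\mathcal{G}'$. The *left leg* $L(\mathcal{C})$ of a T-duality correspondence consists of the bundle $E=\coprod_i U_i\times\mathbb{T}^n/\!\sim$ with $(i,x,b)\sim(j,x,b+a_{ij}(x))$, and of the bundle gerbe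 over $E$ that is given with respect to the open cover $(E|_{U_i})$ by the Čech 2-cocycle (with $y=[i,x,b]$) $$c_{ijk}(y)=-t_{ijk}(x)-\hat m_{ijk}(x)\cdot b+a_{ij}(x)\cdot\hat a_{jk}(x).$$ **Proposition.** Let $\mathcal{C}_1$ and $\mathcal{C}_2$ be T-duality correspondences over $X$. Then the following three statements are equivalent: (a) $\mathcal{C}_1$ and $\mathcal{C}_2$ are isomorphic as half-geometric T-duality correspondences. (b) The left legs $L(\mathcal{C}_1)$ and $L(\mathcal{C}_2)$ are isomorphic as T-backgrounds. (c) For each connected component $Y$ of $X$ there exists a matrix $B\in\mathfrak{so}(n,\mathbb{Z})$ such that the restrictions to $Y$ of $(F_{e^B})_*(\mathcal{C}_1)$ and $\mathcal{C}_2$ are isomorphic as T-duality correspondences. -/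

import Mathlib

open scoped Manifold ContDiff Matrix Topology
open TopologicalSpace

universe u

namespace TDuality

/-! ## Integral data, tori, smooth circle-valued functions -/

/-- The torus `𝕋ⁿ = (ℝ/ℤ)ⁿ`, written additively; `U(1)` is `UnitAddCircle = ℝ/ℤ`. -/
abbrev Torus (n : ℕ) : Type := Fin n → UnitAddCircle

/-- The projection `ℝⁿ → 𝕋ⁿ`. -/
def Torus.mk {n : ℕ} (v : Fin n → ℝ) : Torus n := fun p => (v p : UnitAddCircle)

/-- The inclusion `ℤⁿ → ℝⁿ`. -/
def intVec {n : ℕ} (m : Fin n → ℤ) : Fin n → ℝ := fun p => (m p : ℝ)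

/-- The additive group `𝔰𝔬(n,ℤ)` of skew-symmetric integral matrices. -/
def soZ (n : ℕ) : AddSubgroup (Matrix (Fin n) (Fin n) ℤ) where
  carrier := {B | Bᵀ = -B}
  zero_mem' := by simp
  add_mem' := by
    intro A B hA hB
    simp only [Set.mem_ofPred_eq] at *
    rw [Matrix.transpose_add, hA, hB, neg_add]
  neg_mem' := by
    intro A hA
    simp only [Set.mem_ofPred_eq] at *
    rw [Matrix.transpose_neg, hA]

/-- The linear action of an integral matrix on `ℝⁿ`. -/
def matAct {n : ℕ} (B : Matrix (Fin n) (Fin n) ℤ) (v : Fin n → ℝ) : Fin n → ℝ :=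
  fun p => ∑ q, (B p q : ℝ) * v q

/-- The bilinear form `⟨v | B | w⟩_low = ∑_{q < p} B_{pq} v_p w_q` of the lower triangular
part of `B`. -/
def lowForm {n : ℕ} (B : Matrix (Fin n) (Fin n) ℤ) (v w : Fin n → ℝ) : ℝ :=
  ∑ p, ∑ q, if q < p then (B p q : ℝ) * v p * w q else 0

/-- The class in `U(1) = ℝ/ℤ` of a real number. -/
abbrev toU (r : ℝ) : UnitAddCircle := (r : UnitAddCircle)

/-- `f` is locally constant on `S`. -/
def LocConstOn {X α : Type*} [TopologicalSpace X] (f : X → α) (S : Set X) : Prop :=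
  ∀ x ∈ S, ∀ᶠ y in 𝓝[S] x, f y = f x

section Smooth

/-- Smoothness on `S` of a function with values in `U(1) = ℝ/ℤ`, the latter being identified
with the unit circle in `ℂ`. -/
def SmoothU1On {E H M : Type*} [NormedAddCommGroup E] [NormedSpace ℝ E] [TopologicalSpace H]
    (I : ModelWithCorners ℝ E H) [TopologicalSpace M] [ChartedSpace H M]
    (f : M → UnitAddCircle) (S : Set M) : Prop :=
  ContMDiffOn I 𝓘(ℝ, ℂ) ∞ (fun x => ((AddCircle.toCircle (f x) : Circle) : ℂ)) S

variable {E H M : Type*} [NormedAddCommGroup E] [NormedSpace ℝ E] [TopologicalSpace H]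
    {I : ModelWithCorners ℝ E H} [TopologicalSpace M] [ChartedSpace H M]

theorem SmoothU1On.add {f g : M → UnitAddCircle} {S : Set M} (hf : SmoothU1On I f S)
    (hg : SmoothU1On I g S) : SmoothU1On I (fun x => f x + g x) S := by
  have h : ContDiff ℝ ∞ (fun p : ℂ × ℂ => p.1 * p.2) := contDiff_mul
  have := h.contMDiff.comp_contMDiffOn (hf.prodMk_space hg)
  refine this.congr fun x _ => ?_
  simp [AddCircle.toCircle_add]

theorem SmoothU1On.coe {f : M → ℝ} {S : Set M} (hf : ContMDiffOn I 𝓘(ℝ, ℝ) ∞ f S) :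
    SmoothU1On I (fun x => toU (f x)) S := by
  have h : ContDiff ℝ ∞ (fun r : ℝ => Complex.exp ((2 * Real.pi / 1 * r : ℝ) * Complex.I)) := by
    apply Complex.contDiff_exp.comp
    apply ContDiff.mul _ contDiff_const
    exact Complex.ofRealCLM.contDiff.comp (contDiff_const.mul contDiff_id)
  have := h.contMDiff.comp_contMDiffOn hf
  refine this.congr fun x _ => ?_
  simp [AddCircle.toCircle_apply_mk, Circle.coe_exp]

theorem SmoothU1On.neg {f : M → UnitAddCircle} {S : Set M} (hf : SmoothU1On I f S) :
    SmoothU1On I (fun x => - f x) S := by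
  have h : ContDiff ℝ ∞ (fun p : ℂ => Complex.conjCLE p) := Complex.conjCLE.contDiff
  have := h.contMDiff.comp_contMDiffOn hf
  refine this.congr fun x _ => ?_
  rw [AddCircle.toCircle_neg, Circle.coe_inv_eq_conj]
  simp

theorem SmoothU1On.congr {f g : M → UnitAddCircle} {S : Set M} (hf : SmoothU1On I f S)
    (h : ∀ x ∈ S, g x = f x) : SmoothU1On I g S :=
  ContMDiffOn.congr hf fun x hx => by rw [h x hx]

theorem LocConstOn.smooth {f : M → ℤ} {S : Set M} (hf : LocConstOn f S) :
    ContMDiffOn I 𝓘(ℝ, ℝ) ∞ (fun x => (f x : ℝ)) S := by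
  intro x hx
  refine (contMDiffWithinAt_const (c := (f x : ℝ))).congr_of_eventuallyEq ?_ rfl
  filter_upwards [hf x hx] with y hy
  rw [hy]

theorem LocConstOn.map {α β : Type*} {f : M → α} {S : Set M} (hf : LocConstOn f S) (φ : α → β) :
    LocConstOn (fun x => φ (f x)) S := fun x hx => by
  filter_upwards [hf x hx] with y hy
  rw [hy]

theorem smooth_mul {f g : M → ℝ} {S : Set M} (hf : ContMDiffOn I 𝓘(ℝ, ℝ) ∞ f S)
    (hg : ContMDiffOn I 𝓘(ℝ, ℝ) ∞ g S) : ContMDiffOn I 𝓘(ℝ, ℝ) ∞ (fun x => f x * g x) S := by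
  have h : ContDiff ℝ ∞ (fun p : ℝ × ℝ => p.1 * p.2) := contDiff_mul
  exact h.contMDiff.comp_contMDiffOn (hf.prodMk_space hg)

theorem smooth_add {f g : M → ℝ} {S : Set M} (hf : ContMDiffOn I 𝓘(ℝ, ℝ) ∞ f S)
    (hg : ContMDiffOn I 𝓘(ℝ, ℝ) ∞ g S) : ContMDiffOn I 𝓘(ℝ, ℝ) ∞ (fun x => f x + g x) S := by
  have h : ContDiff ℝ ∞ (fun p : ℝ × ℝ => p.1 + p.2) := contDiff_add
  exact h.contMDiff.comp_contMDiffOn (hf.prodMk_space hg)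

theorem smooth_sum {κ : Type*} (s : Finset κ) {f : κ → M → ℝ} {S : Set M}
    (hf : ∀ k, ContMDiffOn I 𝓘(ℝ, ℝ) ∞ (f k) S) :
    ContMDiffOn I 𝓘(ℝ, ℝ) ∞ (fun x => ∑ k ∈ s, f k x) S := by
  classical
  induction s using Finset.induction_on with
  | empty => simpa using contMDiffOn_const
  | insert a s ha ih =>
    simp only [Finset.sum_insert ha]
    exact smooth_add (hf a) ih

theorem smooth_coord {n : ℕ} {f : M → (Fin n → ℝ)} {S : Set M}
    (hf : ContMDiffOn I 𝓘(ℝ, Fin n → ℝ) ∞ f S) (p : Fin n) :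
    ContMDiffOn I 𝓘(ℝ, ℝ) ∞ (fun x => f x p) S :=
  (contDiff_apply ℝ ℝ p).contMDiff.comp_contMDiffOn hf

end Smooth

/-! ## Linear algebra facts -/

section LinAlg

variable {n : ℕ}

theorem lowForm_add_left (B : Matrix (Fin n) (Fin n) ℤ) (v v' w : Fin n → ℝ) :
    lowForm B (v + v') w = lowForm B v w + lowForm B v' w := by
  simp only [lowForm, ← Finset.sum_add_distrib]
  refine Finset.sum_congr rfl fun p _ => Finset.sum_congr rfl fun q _ => ?_
  split_ifs
  · simp only [Pi.add_apply]; ring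
  · simp

theorem lowForm_add_right (B : Matrix (Fin n) (Fin n) ℤ) (v w w' : Fin n → ℝ) :
    lowForm B v (w + w') = lowForm B v w + lowForm B v w' := by
  simp only [lowForm, ← Finset.sum_add_distrib]
  refine Finset.sum_congr rfl fun p _ => Finset.sum_congr rfl fun q _ => ?_
  split_ifs
  · simp only [Pi.add_apply]; ring
  · simp

theorem lowForm_zero_left (B : Matrix (Fin n) (Fin n) ℤ) (w : Fin n → ℝ) :
    lowForm B 0 w = 0 := by simp [lowForm]

theorem lowForm_zero_right (B : Matrix (Fin n) (Fin n) ℤ) (w : Fin n → ℝ) :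
    lowForm B w 0 = 0 := by simp [lowForm]

theorem lowForm_mat_zero (v w : Fin n → ℝ) : lowForm 0 v w = 0 := by simp [lowForm]

theorem toU_lowForm_int (B : Matrix (Fin n) (Fin n) ℤ) (v w : Fin n → ℤ) :
    toU (lowForm B (intVec v) (intVec w)) = 0 := by
  have : lowForm B (intVec v) (intVec w)
      = ((∑ p, ∑ q, if q < p then B p q * v p * w q else 0 : ℤ) : ℝ) := by
    push_cast [lowForm, intVec]
    rfl
  rw [this]
  rw [AddCircle.coe_eq_zero_iff]
  exact ⟨∑ p, ∑ q, if q < p then B p q * v p * w q else 0, by simp⟩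

theorem dotProduct_matAct {B : Matrix (Fin n) (Fin n) ℤ} (hB : B ∈ soZ n) (v w : Fin n → ℝ) :
    v ⬝ᵥ matAct B w = lowForm B v w - lowForm B w v := by
  have hB' : ∀ p q, (B q p : ℝ) = - (B p q : ℝ) := fun p q => by
    have h : Bᵀ = -B := hB
    have := congrFun (congrFun h p) q
    simp only [Matrix.transpose_apply, Matrix.neg_apply] at this
    exact_mod_cast this
  have h2 : lowForm B w v = ∑ p, ∑ q, if p < q then (B q p : ℝ) * w q * v p else 0 := by
    rw [lowForm, Finset.sum_comm]
  rw [h2, lowForm, ← Finset.sum_sub_distrib]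
  simp only [dotProduct, matAct, Finset.mul_sum, ← Finset.sum_sub_distrib]
  refine Finset.sum_congr rfl fun p _ => Finset.sum_congr rfl fun q _ => ?_
  rcases lt_trichotomy p q with h | h | h
  · rw [if_neg h.not_gt, if_pos h, hB' p q]; ring
  · subst h
    have : (B p p : ℝ) = 0 := by linarith [hB' p p]
    simp [this]
  · rw [if_pos h, if_neg h.not_gt]; ring

theorem matAct_add (B : Matrix (Fin n) (Fin n) ℤ) (v w : Fin n → ℝ) :
    matAct B (v + w) = matAct B v + matAct B w := by
  ext p; simp [matAct, mul_add, Finset.sum_add_distrib]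

theorem matAct_zero (B : Matrix (Fin n) (Fin n) ℤ) : matAct B (0 : Fin n → ℝ) = 0 := by
  ext p; simp [matAct]

theorem matAct_mat_zero (v : Fin n → ℝ) : matAct 0 v = 0 := by
  ext p; simp [matAct]

theorem intVec_add (v w : Fin n → ℤ) : intVec (v + w) = intVec v + intVec w := by
  ext p; simp [intVec]

theorem intVec_mulVec (B : Matrix (Fin n) (Fin n) ℤ) (v : Fin n → ℤ) :
    intVec (B *ᵥ v) = matAct B (intVec v) := by
  ext p; simp [intVec, matAct, Matrix.mulVec, dotProduct]

theorem intVec_injective : Function.Injective (intVec : (Fin n → ℤ) → _) := fun v w h => by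
  ext p
  have := congrFun h p
  simpa [intVec] using this

end LinAlg

/-! ## T-duality correspondences -/

section Correspondences

variable (d n : ℕ) (X : Type u) [TopologicalSpace X] [ChartedSpace (EuclideanSpace ℝ (Fin d)) X]

/-- A T-duality correspondence over `X`, given as a (normalized) cocycle `(a, â, m, m̂, t)` for the
2-group `𝕋𝔻ₙ` with respect to an open cover. All conditions concern the double, triple and
quadruple overlaps only. -/
structure TDCocycle where
  /-- the index set of the open cover -/
  ι : Type u
  U : ι → Opens X
  cover : ∀ x, ∃ i, x ∈ U i
  a : ι → ι → X → (Fin n → ℝ)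
  ahat : ι → ι → X → (Fin n → ℝ)
  m : ι → ι → ι → X → (Fin n → ℤ)
  mhat : ι → ι → ι → X → (Fin n → ℤ)
  t : ι → ι → ι → X → UnitAddCircle
  a_smooth : ∀ i j, ContMDiffOn (𝓡 d) 𝓘(ℝ, Fin n → ℝ) ∞ (a i j) (U i ∩ U j)
  ahat_smooth : ∀ i j, ContMDiffOn (𝓡 d) 𝓘(ℝ, Fin n → ℝ) ∞ (ahat i j) (U i ∩ U j)
  m_const : ∀ i j k, LocConstOn (m i j k) (U i ∩ U j ∩ U k)
  mhat_const : ∀ i j k, LocConstOn (mhat i j k) (U i ∩ U j ∩ U k)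
  t_smooth : ∀ i j k, SmoothU1On (𝓡 d) (t i j k) (U i ∩ U j ∩ U k)
  a_self : ∀ i, ∀ x ∈ U i, a i i x = 0
  ahat_self : ∀ i, ∀ x ∈ U i, ahat i i x = 0
  t_left : ∀ i j x, x ∈ U i → x ∈ U j → t i i j x = 0
  t_right : ∀ i j x, x ∈ U i → x ∈ U j → t i j j x = 0
  a_eq : ∀ i j k x, x ∈ U i → x ∈ U j → x ∈ U k →
    a i k x = intVec (m i j k x) + a j k x + a i j x
  ahat_eq : ∀ i j k x, x ∈ U i → x ∈ U j → x ∈ U k →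
    ahat i k x = intVec (mhat i j k x) + ahat j k x + ahat i j x
  t_eq : ∀ i j k l x, x ∈ U i → x ∈ U j → x ∈ U k → x ∈ U l →
    t i k l x + t i j k x - toU (intVec (m i j k x) ⬝ᵥ ahat k l x) = t i j l x + t j k l x

/-- A half-geometric T-duality correspondence over `X`, given as a (normalized) cocycle
`(B, a, â, m, m̂, t)` for the semi-direct product 2-group `𝕋𝔻ₙ ⋊ 𝔰𝔬(n,ℤ)`. -/
structure HGCocycle where
  /-- the index set of the open cover -/
  ι : Type u
  U : ι → Opens X
  cover : ∀ x, ∃ i, x ∈ U i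
  B : ι → ι → X → soZ n
  a : ι → ι → X → (Fin n → ℝ)
  ahat : ι → ι → X → (Fin n → ℝ)
  m : ι → ι → ι → X → (Fin n → ℤ)
  mhat : ι → ι → ι → X → (Fin n → ℤ)
  t : ι → ι → ι → X → UnitAddCircle
  B_const : ∀ i j, LocConstOn (B i j) (U i ∩ U j)
  a_smooth : ∀ i j, ContMDiffOn (𝓡 d) 𝓘(ℝ, Fin n → ℝ) ∞ (a i j) (U i ∩ U j)
  ahat_smooth : ∀ i j, ContMDiffOn (𝓡 d) 𝓘(ℝ, Fin n → ℝ) ∞ (ahat i j) (U i ∩ U j)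
  m_const : ∀ i j k, LocConstOn (m i j k) (U i ∩ U j ∩ U k)
  mhat_const : ∀ i j k, LocConstOn (mhat i j k) (U i ∩ U j ∩ U k)
  t_smooth : ∀ i j k, SmoothU1On (𝓡 d) (t i j k) (U i ∩ U j ∩ U k)
  B_self : ∀ i, ∀ x ∈ U i, B i i x = 0
  a_self : ∀ i, ∀ x ∈ U i, a i i x = 0
  ahat_self : ∀ i, ∀ x ∈ U i, ahat i i x = 0
  t_left : ∀ i j x, x ∈ U i → x ∈ U j → t i i j x = 0
  t_right : ∀ i j x, x ∈ U i → x ∈ U j → t i j j x = 0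
  B_eq : ∀ i j k x, x ∈ U i → x ∈ U j → x ∈ U k → B i k x = B j k x + B i j x
  a_eq : ∀ i j k x, x ∈ U i → x ∈ U j → x ∈ U k →
    a i k x = intVec (m i j k x) + a j k x + a i j x
  ahat_eq : ∀ i j k x, x ∈ U i → x ∈ U j → x ∈ U k →
    ahat i k x = intVec (mhat i j k x) + ahat j k x + ahat i j x + matAct (B j k x) (a i j x)
  t_eq : ∀ i j k l x, x ∈ U i → x ∈ U j → x ∈ U k → x ∈ U l →
    t i k l x + t i j k x
      = toU (ahat k l x ⬝ᵥ intVec (m i j k x))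
        + toU (lowForm (B k l x) (intVec (m i j k x)) (a i k x))
        + toU (lowForm (B k l x) (a j k x) (a i j x))
        + t i j l x + t j k l x

variable {d n X}

/-- An isomorphism, over the open set `Ω`, between two T-duality correspondences: an equivalence
`(z, ẑ, p, p̂, e)` of cocycles after passing to a common refinement `W` of the two open covers
(restricted to `Ω`). -/
structure TDCocycle.Equiv (C C' : TDCocycle d n X) (Ω : Set X) where
  /-- the index set of the common refinement -/
  κ : Type u
  W : κ → Opens X
  cover : ⋃ k, (W k : Set X) = Ω
  r : κ → C.ι
  r' : κ → C'.ι
  le : ∀ k, W k ≤ C.U (r k)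
  le' : ∀ k, W k ≤ C'.U (r' k)
  p : κ → X → (Fin n → ℝ)
  phat : κ → X → (Fin n → ℝ)
  z : κ → κ → X → (Fin n → ℤ)
  zhat : κ → κ → X → (Fin n → ℤ)
  e : κ → κ → X → UnitAddCircle
  p_smooth : ∀ i, ContMDiffOn (𝓡 d) 𝓘(ℝ, Fin n → ℝ) ∞ (p i) (W i)
  phat_smooth : ∀ i, ContMDiffOn (𝓡 d) 𝓘(ℝ, Fin n → ℝ) ∞ (phat i) (W i)
  z_const : ∀ i j, LocConstOn (z i j) (W i ∩ W j)
  zhat_const : ∀ i j, LocConstOn (zhat i j) (W i ∩ W j)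
  e_smooth : ∀ i j, SmoothU1On (𝓡 d) (e i j) (W i ∩ W j)
  a_eq : ∀ i j x, x ∈ W i → x ∈ W j →
    C'.a (r' i) (r' j) x + p i x = intVec (z i j x) + p j x + C.a (r i) (r j) x
  ahat_eq : ∀ i j x, x ∈ W i → x ∈ W j →
    C'.ahat (r' i) (r' j) x + phat i x = intVec (zhat i j x) + phat j x + C.ahat (r i) (r j) x
  t_eq : ∀ i j k x, x ∈ W i → x ∈ W j → x ∈ W k →
    C'.t (r' i) (r' j) (r' k) x + e i j x
        - toU (C'.ahat (r' j) (r' k) x ⬝ᵥ intVec (z i j x)) + e j k x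
      = e i k x + C.t (r i) (r j) (r k) x
        - toU (phat k x ⬝ᵥ intVec (C.m (r i) (r j) (r k) x))

/-- The restrictions to the open set `Ω` of two T-duality correspondences are isomorphic. -/
def TDCocycle.IsoOn (C C' : TDCocycle d n X) (Ω : Set X) : Prop :=
  Nonempty (TDCocycle.Equiv C C' Ω)

/-- An isomorphism between two half-geometric T-duality correspondences: an equivalence
`(D, z, ẑ, p, p̂, e)` of cocycles after passing to a common refinement `W` of the two
open covers. -/
structure HGCocycle.Equiv (C C' : HGCocycle d n X) where
  /-- the index set of the common refinement -/
  κ : Type u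
  W : κ → Opens X
  cover : ∀ x, ∃ k, x ∈ W k
  r : κ → C.ι
  r' : κ → C'.ι
  le : ∀ k, W k ≤ C.U (r k)
  le' : ∀ k, W k ≤ C'.U (r' k)
  D : κ → X → soZ n
  p : κ → X → (Fin n → ℝ)
  phat : κ → X → (Fin n → ℝ)
  z : κ → κ → X → (Fin n → ℤ)
  zhat : κ → κ → X → (Fin n → ℤ)
  e : κ → κ → X → UnitAddCircle
  D_const : ∀ i, LocConstOn (D i) (W i)
  p_smooth : ∀ i, ContMDiffOn (𝓡 d) 𝓘(ℝ, Fin n → ℝ) ∞ (p i) (W i)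
  phat_smooth : ∀ i, ContMDiffOn (𝓡 d) 𝓘(ℝ, Fin n → ℝ) ∞ (phat i) (W i)
  z_const : ∀ i j, LocConstOn (z i j) (W i ∩ W j)
  zhat_const : ∀ i j, LocConstOn (zhat i j) (W i ∩ W j)
  e_smooth : ∀ i j, SmoothU1On (𝓡 d) (e i j) (W i ∩ W j)
  B_eq : ∀ i j x, x ∈ W i → x ∈ W j →
    D j x + C.B (r i) (r j) x = C'.B (r' i) (r' j) x + D i x
  a_eq : ∀ i j x, x ∈ W i → x ∈ W j →
    intVec (z i j x) + p j x + C.a (r i) (r j) x = C'.a (r' i) (r' j) x + p i x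
  ahat_eq : ∀ i j x, x ∈ W i → x ∈ W j →
    intVec (zhat i j x) + phat j x + matAct (D j x) (C.a (r i) (r j) x) + C.ahat (r i) (r j) x
      = C'.ahat (r' i) (r' j) x + matAct (C'.B (r' i) (r' j) x) (p i x) + phat i x
  t_eq : ∀ i j k x, x ∈ W i → x ∈ W j → x ∈ W k →
    C'.t (r' i) (r' j) (r' k) x
        + toU (lowForm (C'.B (r' j) (r' k) x) (C'.a (r' i) (r' j) x) (p i x))
        - toU (lowForm (C'.B (r' j) (r' k) x) (intVec (z i j x)) (p j x + C.a (r i) (r j) x))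
        + e i j x
        - toU (C'.ahat (r' j) (r' k) x ⬝ᵥ intVec (z i j x))
        - toU (lowForm (C'.B (r' j) (r' k) x) (p j x) (C.a (r i) (r j) x))
        + e j k x
      = e i k x
        - toU (lowForm (D k x) (intVec (C.m (r i) (r j) (r k) x)) (C.a (r i) (r k) x))
        + C.t (r i) (r j) (r k) x
        - toU (phat k x ⬝ᵥ intVec (C.m (r i) (r j) (r k) x))
        - toU (lowForm (D k x) (C.a (r j) (r k) x) (C.a (r i) (r j) x))

/-- Two half-geometric T-duality correspondences are isomorphic. -/
def HGCocycle.Iso (C C' : HGCocycle d n X) : Prop := Nonempty (HGCocycle.Equiv C C')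

/-- The half-geometric T-duality correspondence underlying a T-duality correspondence: induced by
the inclusion `𝕋𝔻ₙ → 𝕋𝔻ₙ ⋊ 𝔰𝔬(n,ℤ)`. -/
def TDCocycle.toHG (C : TDCocycle d n X) : HGCocycle d n X where
  ι := C.ι
  U := C.U
  cover := C.cover
  B := fun _ _ _ => 0
  a := C.a
  ahat := C.ahat
  m := C.m
  mhat := C.mhat
  t := C.t
  B_const := fun _ _ _ _ => Filter.Eventually.of_forall fun _ => rfl
  a_smooth := C.a_smooth
  ahat_smooth := C.ahat_smooth
  m_const := C.m_const
  mhat_const := C.mhat_const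
  t_smooth := C.t_smooth
  B_self := fun _ _ _ => rfl
  a_self := C.a_self
  ahat_self := C.ahat_self
  t_left := C.t_left
  t_right := C.t_right
  B_eq := by intros; simp
  a_eq := C.a_eq
  ahat_eq := by
    intro i j k x hi hj hk
    rw [C.ahat_eq i j k x hi hj hk]
    simp [matAct_mat_zero]
  t_eq := by
    intro i j k l x hi hj hk hl
    have h := C.t_eq i j k l x hi hj hk hl
    simp only [ZeroMemClass.coe_zero, lowForm_mat_zero, toU, AddCircle.coe_zero, add_zero]
    rw [dotProduct_comm, add_assoc, ← h]
    abel

theorem TDCocycle.m_eq (C : TDCocycle d n X) (i j k l : C.ι) (x : X) (hi : x ∈ C.U i)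
    (hj : x ∈ C.U j) (hk : x ∈ C.U k) (hl : x ∈ C.U l) :
    C.m i k l x + C.m i j k x = C.m i j l x + C.m j k l x := by
  apply intVec_injective
  have h1 := C.a_eq i k l x hi hk hl
  have h2 := C.a_eq i j k x hi hj hk
  have h3 := C.a_eq i j l x hi hj hl
  have h4 := C.a_eq j k l x hj hk hl
  rw [h3, h4, h2] at h1
  rw [intVec_add, intVec_add]
  ext p
  have := congrFun h1 p
  simp only [Pi.add_apply] at this ⊢
  linarith

theorem TDCocycle.mhat_eq (C : TDCocycle d n X) (i j k l : C.ι) (x : X) (hi : x ∈ C.U i)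
    (hj : x ∈ C.U j) (hk : x ∈ C.U k) (hl : x ∈ C.U l) :
    C.mhat i k l x + C.mhat i j k x = C.mhat i j l x + C.mhat j k l x := by
  apply intVec_injective
  have h1 := C.ahat_eq i k l x hi hk hl
  have h2 := C.ahat_eq i j k x hi hj hk
  have h3 := C.ahat_eq i j l x hi hj hl
  have h4 := C.ahat_eq j k l x hj hk hl
  rw [h3, h4, h2] at h1
  rw [intVec_add, intVec_add]
  ext p
  have := congrFun h1 p
  simp only [Pi.add_apply] at this ⊢
  linarith

theorem TDCocycle.m_left (C : TDCocycle d n X) (i j : C.ι) (x : X) (hi : x ∈ C.U i)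
    (hj : x ∈ C.U j) : C.m i i j x = 0 := by
  apply intVec_injective
  have h1 := C.a_eq i i j x hi hi hj
  rw [C.a_self i x hi] at h1
  ext p
  have := congrFun h1 p
  simp only [Pi.add_apply, Pi.zero_apply, intVec, Int.cast_zero] at this ⊢
  linarith

theorem TDCocycle.m_right (C : TDCocycle d n X) (i j : C.ι) (x : X) (hi : x ∈ C.U i)
    (hj : x ∈ C.U j) : C.m i j j x = 0 := by
  apply intVec_injective
  have h1 := C.a_eq i j j x hi hj hj
  rw [C.a_self j x hj] at h1
  ext p
  have := congrFun h1 p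
  simp only [Pi.add_apply, Pi.zero_apply, intVec, Int.cast_zero] at this ⊢
  linarith

theorem smooth_lowForm {S : Set X} (B : Matrix (Fin n) (Fin n) ℤ) {v w : X → (Fin n → ℝ)}
    (hv : ∀ p, ContMDiffOn (𝓡 d) 𝓘(ℝ, ℝ) ∞ (fun x => v x p) S)
    (hw : ∀ p, ContMDiffOn (𝓡 d) 𝓘(ℝ, ℝ) ∞ (fun x => w x p) S) :
    ContMDiffOn (𝓡 d) 𝓘(ℝ, ℝ) ∞ (fun x => lowForm B (v x) (w x)) S := by
  refine smooth_sum _ fun p => smooth_sum _ fun q => ?_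
  by_cases h : q < p
  · simp only [if_pos h]
    exact smooth_mul (smooth_mul contMDiffOn_const (hv p)) (hw q)
  · simp only [if_neg h]
    exact contMDiffOn_const

/-- The push-forward `(F_{e^B})_*(C)` of a T-duality correspondence along the 2-group automorphism
`F_{e^B}` of `𝕋𝔻ₙ`, the crossed intertwiner
`φ(a ⊕ â) = a ⊕ (B a + â)`, `f(m ⊕ m̂, t) = (m ⊕ (B m + m̂), t)`,
`η(a ⊕ â, b ⊕ b̂) = ⟨a | B | b⟩_low`. -/
def TDCocycle.push (B : soZ n) (C : TDCocycle d n X) : TDCocycle d n X where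
  ι := C.ι
  U := C.U
  cover := C.cover
  a := C.a
  ahat := fun i j x => matAct B (C.a i j x) + C.ahat i j x
  m := C.m
  mhat := fun i j k x => (B : Matrix (Fin n) (Fin n) ℤ) *ᵥ C.m i j k x + C.mhat i j k x
  t := fun i j k x => C.t i j k x
    - toU (lowForm B (intVec (C.m i j k x)) (C.a j k x + C.a i j x))
    - toU (lowForm B (C.a j k x) (C.a i j x))
  a_smooth := C.a_smooth
  ahat_smooth := by
    intro i j
    refine contMDiffOn_pi_space.2 fun p => ?_
    refine smooth_add (smooth_sum _ fun q => smooth_mul contMDiffOn_const ?_) ?_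
    · exact smooth_coord (C.a_smooth i j) q
    · exact smooth_coord (C.ahat_smooth i j) p
  m_const := C.m_const
  mhat_const := by
    intro i j k x hx
    filter_upwards [C.m_const i j k x hx, C.mhat_const i j k x hx] with y h1 h2
    rw [h1, h2]
  t_smooth := by
    intro i j k
    simp only [sub_eq_add_neg]
    have ha1 : ∀ p, ContMDiffOn (𝓡 d) 𝓘(ℝ, ℝ) ∞ (fun x => C.a j k x p) (C.U i ∩ C.U j ∩ C.U k) :=
      fun p => (smooth_coord (C.a_smooth j k) p).mono fun x hx => ⟨hx.1.2, hx.2⟩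
    have ha2 : ∀ p, ContMDiffOn (𝓡 d) 𝓘(ℝ, ℝ) ∞ (fun x => C.a i j x p) (C.U i ∩ C.U j ∩ C.U k) :=
      fun p => (smooth_coord (C.a_smooth i j) p).mono fun x hx => hx.1
    refine ((C.t_smooth i j k).add (SmoothU1On.neg (SmoothU1On.coe ?_))).add
      (SmoothU1On.neg (SmoothU1On.coe ?_))
    · exact smooth_lowForm _ (fun p => ((C.m_const i j k).map (fun v => v p)).smooth)
        (fun p => smooth_add (ha1 p) (ha2 p))
    · exact smooth_lowForm _ ha1 ha2
  a_self := C.a_self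
  ahat_self := by
    intro i x hx
    rw [C.a_self i x hx, C.ahat_self i x hx, matAct_zero, add_zero]
  t_left := by
    intro i j x hi hj
    rw [C.t_left i j x hi hj, C.m_left i j x hi hj, C.a_self i x hi]
    have h0 : intVec (0 : Fin n → ℤ) = 0 := by ext; simp [intVec]
    simp [h0, lowForm_zero_left, lowForm_zero_right]
  t_right := by
    intro i j x hi hj
    rw [C.t_right i j x hi hj, C.m_right i j x hi hj, C.a_self j x hj]
    have h0 : intVec (0 : Fin n → ℤ) = 0 := by ext; simp [intVec]
    simp [h0, lowForm_zero_left]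
  a_eq := C.a_eq
  ahat_eq := by
    intro i j k x hi hj hk
    rw [C.ahat_eq i j k x hi hj hk, C.a_eq i j k x hi hj hk]
    rw [intVec_add, intVec_mulVec, matAct_add, matAct_add]
    abel
  t_eq := by
    intro i j k l x hi hj hk hl
    have h := C.t_eq i j k l x hi hj hk hl
    have hm : intVec (C.m i k l x) + intVec (C.m i j k x)
        = intVec (C.m i j l x) + intVec (C.m j k l x) := by
      rw [← intVec_add, ← intVec_add, C.m_eq i j k l x hi hj hk hl]
    have hm' : ∀ w, lowForm (B : Matrix (Fin n) (Fin n) ℤ) (intVec (C.m i k l x)) w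
        = lowForm B (intVec (C.m i j l x)) w + lowForm B (intVec (C.m j k l x)) w
          - lowForm B (intVec (C.m i j k x)) w := fun w => by
      rw [← lowForm_add_left, ← hm, lowForm_add_left]; ring
    have z1 := toU_lowForm_int B (C.m i k l x) (C.m i j k x)
    have z2 := toU_lowForm_int B (C.m i j l x) (C.m j k l x)
    rw [dotProduct_add, dotProduct_matAct B.2, C.a_eq i j k x hi hj hk, C.a_eq j k l x hj hk hl]
    simp only [hm', lowForm_add_left, lowForm_add_right, toU, AddCircle.coe_add,
      AddCircle.coe_sub] at h z1 z2 ⊢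
    linear_combination (norm := abel) h - z1 + z2

end Correspondences

/-! ## T-backgrounds -/

section Backgrounds

variable (d n : ℕ) (X : Type u) [TopologicalSpace X] [ChartedSpace (EuclideanSpace ℝ (Fin d)) X]

/-- A (smooth) principal `𝕋ⁿ`-bundle over `X`: a set `E` with a fibrewise free and transitive
action of `𝕋ⁿ`, together with a family of local sections with smooth transition functions. -/
structure TorusBundle where
  E : Type u
  act : AddAction (Torus n) E
  proj : E → X
  proj_vadd : ∀ (b : Torus n) (y : E), proj (b +ᵥ y) = proj y
  torsor : ∀ y y' : E, proj y = proj y' → ∃! b : Torus n, b +ᵥ y = y'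
  /-- the index set of the bundle atlas -/
  ι : Type u
  U : ι → Opens X
  cover : ∀ x, ∃ i, x ∈ U i
  sec : ∀ i, U i → E
  proj_sec : ∀ i (x : U i), proj (sec i x) = x
  sec_smooth : ∀ i j, ∃ g : X → Torus n,
    (∀ p, SmoothU1On (𝓡 d) (fun x => g x p) (U i ∩ U j)) ∧
    ∀ (x : X) (hi : x ∈ U i) (hj : x ∈ U j), sec i ⟨x, hi⟩ = g x +ᵥ sec j ⟨x, hj⟩

attribute [instance] TorusBundle.act

variable {d n X}

/-- The local trivialization `U i × 𝕋ⁿ → E` determined by the `i`-th local section. -/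
def TorusBundle.chart (P : TorusBundle d n X) (i : P.ι) (q : P.U i × Torus n) : P.E :=
  q.2 +ᵥ P.sec i q.1

/-- The topology on the total space of a principal bundle: a subset is open if its preimages in
all `U i × 𝕋ⁿ` are open. -/
instance (P : TorusBundle d n X) : TopologicalSpace P.E :=
  ⨆ i, TopologicalSpace.coinduced (P.chart i) inferInstance

theorem TorusBundle.isOpen_iff (P : TorusBundle d n X) (V : Set P.E) :
    IsOpen V ↔ ∀ i, IsOpen (P.chart i ⁻¹' V) := by
  rw [isOpen_iSup_iff]
  simp only [isOpen_coinduced]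

/-- Smoothness of a `U(1)`-valued function on a subset `V` of the total space of a principal
`𝕋ⁿ`-bundle: it becomes smooth when pulled back along `U i × ℝⁿ → U i × 𝕋ⁿ → E` for all `i`. -/
def TorusBundle.SmoothOn (P : TorusBundle d n X) (f : P.E → UnitAddCircle) (V : Set P.E) : Prop :=
  ∀ i, SmoothU1On ((𝓡 d).prod 𝓘(ℝ, Fin n → ℝ))
    (fun q : P.U i × (Fin n → ℝ) => f (P.chart i (q.1, Torus.mk q.2)))
    {q | P.chart i (q.1, Torus.mk q.2) ∈ V}

variable (d n X)

/-- A T-background over `X`: a principal `𝕋ⁿ`-bundle together with a `U(1)`-bundle gerbe over its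
total space, the latter given by a Čech 2-cocycle with respect to an open cover. -/
structure TBackground where
  bundle : TorusBundle d n X
  /-- the index set of the open cover of the total space -/
  κ : Type u
  V : κ → Set bundle.E
  V_open : ∀ k, IsOpen (V k)
  V_cover : ∀ y, ∃ k, y ∈ V k
  c : κ → κ → κ → bundle.E → UnitAddCircle
  c_smooth : ∀ i j k, bundle.SmoothOn (c i j k) (V i ∩ V j ∩ V k)
  c_eq : ∀ i j k l y, y ∈ V i → y ∈ V j → y ∈ V k → y ∈ V l →
    c i k l y + c i j k y = c i j l y + c j k l y

variable {d n X}

/-- An isomorphism of T-backgrounds: a smooth bundle isomorphism `f : E → E'` together with an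
isomorphism of bundle gerbes between `𝒢` and `f^*𝒢'`, i.e. a Čech 1-cochain on a common
refinement of the two open covers whose coboundary is the difference of the 2-cocycles. -/
structure TBackground.Equiv (P P' : TBackground d n X) where
  f : P.bundle.E → P'.bundle.E
  f_proj : ∀ y, P'.bundle.proj (f y) = P.bundle.proj y
  f_vadd : ∀ (b : Torus n) (y : P.bundle.E), f (b +ᵥ y) = b +ᵥ f y
  f_smooth : ∀ i i', ∃ h : X → Torus n,
    (∀ p, SmoothU1On (𝓡 d) (fun x => h x p) (P.bundle.U i ∩ P'.bundle.U i')) ∧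
    ∀ (x : X) (hi : x ∈ P.bundle.U i) (hi' : x ∈ P'.bundle.U i'),
      f (P.bundle.sec i ⟨x, hi⟩) = h x +ᵥ P'.bundle.sec i' ⟨x, hi'⟩
  /-- the index set of the common refinement -/
  σ : Type u
  W : σ → Set P.bundle.E
  W_open : ∀ s, IsOpen (W s)
  W_cover : ∀ y, ∃ s, y ∈ W s
  r : σ → P.κ
  r' : σ → P'.κ
  le : ∀ s, ∀ y ∈ W s, y ∈ P.V (r s)
  le' : ∀ s, ∀ y ∈ W s, f y ∈ P'.V (r' s)
  e : σ → σ → P.bundle.E → UnitAddCircle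
  e_smooth : ∀ s t, P.bundle.SmoothOn (e s t) (W s ∩ W t)
  c_eq : ∀ s t v y, y ∈ W s → y ∈ W t → y ∈ W v →
    P'.c (r' s) (r' t) (r' v) (f y) + e s t y + e t v y
      = e s v y + P.c (r s) (r t) (r v) y

/-- Two T-backgrounds are isomorphic. -/
def TBackground.Iso (P P' : TBackground d n X) : Prop := Nonempty (TBackground.Equiv P P')

end Backgrounds

/-! ## The left leg of a T-duality correspondence -/

section LeftLeg

variable {d n : ℕ} {X : Type u} [TopologicalSpace X] [ChartedSpace (EuclideanSpace ℝ (Fin d)) X]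

theorem Torus.mk_add (v w : Fin n → ℝ) : Torus.mk (v + w) = Torus.mk v + Torus.mk w := by
  ext p; simp [Torus.mk]

theorem Torus.mk_zero : Torus.mk (0 : Fin n → ℝ) = 0 := by
  ext p; simp [Torus.mk]

theorem Torus.mk_intVec (m : Fin n → ℤ) : Torus.mk (intVec m) = 0 := by
  ext p
  simp only [Torus.mk, intVec, Pi.zero_apply]
  rw [AddCircle.coe_eq_zero_iff]
  exact ⟨m p, by simp⟩

namespace TDCocycle

variable (C : TDCocycle d n X)

theorem mk_a (i j k : C.ι) (x : X) (hi : x ∈ C.U i) (hj : x ∈ C.U j) (hk : x ∈ C.U k) :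
    Torus.mk (C.a i k x) = Torus.mk (C.a j k x) + Torus.mk (C.a i j x) := by
  rw [C.a_eq i j k x hi hj hk, Torus.mk_add, Torus.mk_add, Torus.mk_intVec, zero_add]

theorem mk_a_self (i : C.ι) (x : X) (hi : x ∈ C.U i) : Torus.mk (C.a i i x) = 0 := by
  rw [C.a_self i x hi, Torus.mk_zero]

/-- The equivalence relation on `∐ U i × 𝕋ⁿ` that glues `(i, x, b)` with `(j, x, b + a_ij(x))`. -/
def glueSetoid : Setoid (Σ i : C.ι, C.U i × Torus n) where
  r q q' := (q.2.1 : X) = q'.2.1 ∧ q'.2.2 = q.2.2 + Torus.mk (C.a q.1 q'.1 q.2.1)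
  iseqv := by
    refine ⟨?_, ?_, ?_⟩
    · rintro ⟨i, ⟨x, hx⟩, b⟩
      exact ⟨rfl, by simp [C.mk_a_self i x hx]⟩
    · rintro ⟨i, ⟨x, hx⟩, b⟩ ⟨j, ⟨y, hy⟩, b'⟩ ⟨h1, h2⟩
      dsimp only at h1 h2 ⊢
      subst h1
      refine ⟨rfl, ?_⟩
      rw [h2, add_assoc, add_comm (Torus.mk _), ← C.mk_a i j i x hx hy hx, C.mk_a_self i x hx,
        add_zero]
    · rintro ⟨i, ⟨x, hx⟩, b⟩ ⟨j, ⟨y, hy⟩, b'⟩ ⟨k, ⟨z, hz⟩, b''⟩ ⟨h1, h2⟩ ⟨h3, h4⟩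
      dsimp only at h1 h2 h3 h4 ⊢
      subst h1
      subst h3
      refine ⟨rfl, ?_⟩
      rw [h4, h2, C.mk_a i j k x hx hy hz]
      abel

/-- The total space of the `𝕋ⁿ`-bundle with transition functions `a_ij`. -/
def Total : Type u := Quotient C.glueSetoid

/-- The point of the total space represented by `(i, x, b)`. -/
def pt (i : C.ι) (x : C.U i) (b : Torus n) : C.Total := Quotient.mk C.glueSetoid ⟨i, x, b⟩

theorem pt_eq {i j : C.ι} {x : X} (hi : x ∈ C.U i) (hj : x ∈ C.U j) (b : Torus n) :
    C.pt i ⟨x, hi⟩ b = C.pt j ⟨x, hj⟩ (b + Torus.mk (C.a i j x)) :=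
  Quotient.sound ⟨rfl, rfl⟩

theorem exists_pt (y : C.Total) : ∃ i x b, y = C.pt i x b := by
  induction y using Quotient.inductionOn with
  | h q => exact ⟨q.1, q.2.1, q.2.2, rfl⟩

/-- The bundle projection. -/
def totalProj : C.Total → X :=
  Quotient.lift (fun q => (q.2.1 : X)) fun _ _ h => h.1

instance : AddAction (Torus n) C.Total where
  vadd b := Quotient.map (fun q => ⟨q.1, q.2.1, b + q.2.2⟩) fun q q' h => by
    refine ⟨h.1, ?_⟩
    dsimp only
    rw [h.2, add_assoc]
  zero_vadd y := by
    induction y using Quotient.inductionOn with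
    | h q => exact congrArg (Quotient.mk _) (by simp)
  add_vadd b b' y := by
    induction y using Quotient.inductionOn with
    | h q => exact congrArg (Quotient.mk C.glueSetoid) (by simp [add_assoc])

theorem vadd_pt (b b' : Torus n) (i : C.ι) (x : C.U i) :
    b +ᵥ C.pt i x b' = C.pt i x (b + b') := rfl

theorem totalProj_pt (i : C.ι) (x : C.U i) (b : Torus n) : C.totalProj (C.pt i x b) = x := rfl

/-- The `𝕋ⁿ`-bundle with transition functions `a_ij`. -/
def bundle : TorusBundle d n X where
  E := C.Total
  act := inferInstance
  proj := C.totalProj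
  proj_vadd := by
    intro b y
    obtain ⟨i, x, b', rfl⟩ := C.exists_pt y
    rfl
  torsor := by
    intro y y' h
    obtain ⟨i, ⟨x, hx⟩, b, rfl⟩ := C.exists_pt y
    obtain ⟨j, ⟨x', hx'⟩, b', rfl⟩ := C.exists_pt y'
    have h' : x = x' := h
    subst h'
    refine ⟨b' - b - Torus.mk (C.a i j x), ?_, ?_⟩
    · change _ +ᵥ _ = _
      rw [vadd_pt, C.pt_eq hx hx']
      congr 1
      abel
    · intro v hv
      have hv' : v +ᵥ C.pt i ⟨x, hx⟩ b = C.pt j ⟨x, hx'⟩ b' := hv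
      rw [vadd_pt] at hv'
      have := (Quotient.exact hv').2
      dsimp only at this
      rw [this]
      abel
  ι := C.ι
  U := C.U
  cover := C.cover
  sec := fun i x => C.pt i x 0
  proj_sec := fun i x => rfl
  sec_smooth := by
    intro i j
    refine ⟨fun x => Torus.mk (C.a i j x), fun p => ?_, fun x hi hj => ?_⟩
    · exact SmoothU1On.coe (smooth_coord (C.a_smooth i j) p)
    · rw [vadd_pt, C.pt_eq hi hj, zero_add, add_zero]

open Classical in
/-- The `𝕋ⁿ`-coordinate over `U i` of a point of the total space (and `0` outside of `U i`). -/
noncomputable def coord (i : C.ι) : C.Total → Torus n :=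
  Quotient.lift
    (fun q => if (q.2.1 : X) ∈ C.U i then q.2.2 + Torus.mk (C.a q.1 i q.2.1) else 0) <| by
    rintro ⟨j, ⟨x, hx⟩, b⟩ ⟨k, ⟨x', hx'⟩, b'⟩ ⟨h1, h2⟩
    dsimp only at h1 h2 ⊢
    subst h1
    split_ifs with h
    · rw [h2, C.mk_a j k i x hx hx' h]
      abel
    · rfl

theorem coord_pt (i j : C.ι) (x : C.U j) (b : Torus n) (h : (x : X) ∈ C.U i) :
    C.coord i (C.pt j x b) = b + Torus.mk (C.a j i x) := if_pos h

theorem coord_self (i : C.ι) (x : C.U i) (b : Torus n) :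
    C.coord i (C.pt i x b) = b := by
  rw [coord_pt _ _ _ _ _ x.2, C.mk_a_self i x x.2, add_zero]

theorem coord_change (i j : C.ι) (y : C.Total) (hi : C.totalProj y ∈ C.U i)
    (hj : C.totalProj y ∈ C.U j) :
    C.coord j y = C.coord i y + Torus.mk (C.a i j (C.totalProj y)) := by
  obtain ⟨k, ⟨x, hx⟩, b, rfl⟩ := C.exists_pt y
  have hi' : x ∈ C.U i := hi
  have hj' : x ∈ C.U j := hj
  rw [coord_pt _ _ _ _ _ hj', coord_pt _ _ _ _ _ hi']
  change _ = _ + Torus.mk (C.a i j x)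
  rw [C.mk_a k i j x hx hi' hj']
  abel

/-- The pairing `ℤⁿ × 𝕋ⁿ → U(1)`. -/
def pairing (m : Fin n → ℤ) (b : Torus n) : UnitAddCircle := ∑ p, m p • b p

theorem pairing_add_left (m m' : Fin n → ℤ) (b : Torus n) :
    pairing (m + m') b = pairing m b + pairing m' b := by
  simp [pairing, add_smul, Finset.sum_add_distrib]

theorem pairing_add_right (m : Fin n → ℤ) (b b' : Torus n) :
    pairing m (b + b') = pairing m b + pairing m b' := by
  simp [pairing, Finset.sum_add_distrib]

theorem pairing_mk (m : Fin n → ℤ) (v : Fin n → ℝ) :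
    pairing m (Torus.mk v) = toU (intVec m ⬝ᵥ v) := by
  have h : ∀ s : Finset (Fin n), ∑ p ∈ s, m p • Torus.mk v p = toU (∑ p ∈ s, intVec m p * v p) := by
    classical
    intro s
    induction s using Finset.induction_on with
    | empty => simp [toU]
    | insert a s ha ih =>
      rw [Finset.sum_insert ha, Finset.sum_insert ha, ih]
      simp only [toU, Torus.mk, intVec, AddCircle.coe_add, ← zsmul_eq_mul, AddCircle.coe_zsmul]
  exact h _

/-- The Čech 2-cocycle of the bundle gerbe of the left leg, with respect to the open sets
`E|_{U i}`: if `y` has the coordinates `(x, b)` over `U i`, then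
`c_ijk(y) = - t_ijk(x) - m̂_ijk(x) · b + a_ij(x) · â_jk(x)`. -/
noncomputable def legCocycle (i j k : C.ι) (y : C.Total) : UnitAddCircle :=
  - C.t i j k (C.totalProj y) - pairing (C.mhat i j k (C.totalProj y)) (C.coord i y)
    + toU (C.a i j (C.totalProj y) ⬝ᵥ C.ahat j k (C.totalProj y))

theorem legCocycle_eq (i j k l : C.ι) (y : C.Total) (hi : C.totalProj y ∈ C.U i)
    (hj : C.totalProj y ∈ C.U j) (hk : C.totalProj y ∈ C.U k) (hl : C.totalProj y ∈ C.U l) :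
    C.legCocycle i k l y + C.legCocycle i j k y = C.legCocycle i j l y + C.legCocycle j k l y := by
  have ht := C.t_eq i j k l _ hi hj hk hl
  have hm := congrArg (fun m => pairing m (C.coord i y)) (C.mhat_eq i j k l _ hi hj hk hl)
  simp only [pairing_add_left] at hm
  simp only [legCocycle]
  rw [C.coord_change i j y hi hj, pairing_add_right, pairing_mk,
    C.a_eq i j k _ hi hj hk, C.ahat_eq j k l _ hj hk hl]
  rw [dotProduct_comm (intVec (C.mhat j k l _))]
  simp only [add_dotProduct, dotProduct_add, toU, AddCircle.coe_add] at ht hm ⊢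
  linear_combination (norm := abel) - ht - hm

theorem legCocycle_smooth (i j k : C.ι) :
    C.bundle.SmoothOn (C.legCocycle i j k)
      ({y | C.totalProj y ∈ C.U i} ∩ {y | C.totalProj y ∈ C.U j}
        ∩ {y | C.totalProj y ∈ C.U k}) := by
  intro (l : C.ι)
  set S : Set (C.U l × (Fin n → ℝ)) :=
    {q | ((q.1 : X) ∈ C.U i ∧ (q.1 : X) ∈ C.U j) ∧ (q.1 : X) ∈ C.U k}
  have hφ : ContMDiffOn ((𝓡 d).prod 𝓘(ℝ, Fin n → ℝ)) (𝓡 d) ∞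
      (fun q : C.U l × (Fin n → ℝ) => (q.1 : X)) S :=
    (contMDiff_subtype_val.comp contMDiff_fst).contMDiffOn
  have hv : ContMDiffOn ((𝓡 d).prod 𝓘(ℝ, Fin n → ℝ)) 𝓘(ℝ, Fin n → ℝ) ∞
      (fun q : C.U l × (Fin n → ℝ) => q.2) S := contMDiff_snd.contMDiffOn
  have ht : SmoothU1On ((𝓡 d).prod 𝓘(ℝ, Fin n → ℝ))
      (fun q : C.U l × (Fin n → ℝ) => C.t i j k q.1) S :=
    ContMDiffOn.comp (g := fun x => ((AddCircle.toCircle (C.t i j k x) : Circle) : ℂ))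
      (C.t_smooth i j k) hφ fun q hq => ⟨⟨hq.1.1, hq.1.2⟩, hq.2⟩
  have ha := (C.a_smooth i j).comp hφ fun q hq => ⟨hq.1.1, hq.1.2⟩
  have hah := (C.ahat_smooth j k).comp hφ fun q hq => ⟨hq.1.2, hq.2⟩
  have hal := (C.a_smooth l i).comp hφ fun q hq => ⟨q.1.2, hq.1.1⟩
  have hm : ∀ p, ContMDiffOn ((𝓡 d).prod 𝓘(ℝ, Fin n → ℝ)) 𝓘(ℝ, ℝ) ∞
      (fun q : C.U l × (Fin n → ℝ) => (C.mhat i j k q.1 p : ℝ)) S := fun p =>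
    (((C.mhat_const i j k).map (fun m => m p)).smooth (I := 𝓡 d)).comp hφ
      fun q hq => ⟨⟨hq.1.1, hq.1.2⟩, hq.2⟩
  have key : SmoothU1On ((𝓡 d).prod 𝓘(ℝ, Fin n → ℝ))
      (fun q : C.U l × (Fin n → ℝ) => - C.t i j k q.1
        + - toU (intVec (C.mhat i j k q.1) ⬝ᵥ (q.2 + C.a l i q.1))
        + toU (C.a i j q.1 ⬝ᵥ C.ahat j k q.1)) S := by
    refine (ht.neg.add (SmoothU1On.neg (SmoothU1On.coe ?_))).add (SmoothU1On.coe ?_)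
    · exact smooth_sum _ fun p => smooth_mul (hm p)
        (smooth_add (smooth_coord hv p) (smooth_coord hal p))
    · exact smooth_sum _ fun p => smooth_mul (smooth_coord ha p) (smooth_coord hah p)
  change SmoothU1On _
    (fun q : C.U l × (Fin n → ℝ) => C.legCocycle i j k (C.pt l q.1 (Torus.mk q.2 + 0))) S
  refine key.congr fun q hq => ?_
  rw [legCocycle, add_zero, totalProj_pt, coord_pt _ _ _ _ _ hq.1.1, ← Torus.mk_add, pairing_mk,
    sub_eq_add_neg]

/-- The left leg of a T-duality correspondence: the principal `𝕋ⁿ`-bundle `E` with transition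
functions `a_ij`, and the bundle gerbe over `E` glued from trivial bundle gerbes over the
`E|_{U i}`. -/
noncomputable def leftLeg : TBackground d n X where
  bundle := C.bundle
  κ := C.ι
  V := fun i => {y | C.totalProj y ∈ C.U i}
  V_open := by
    intro k
    rw [TorusBundle.isOpen_iff]
    intro i
    exact (C.U k).isOpen.preimage (continuous_subtype_val.comp continuous_fst)
  V_cover := fun y => C.cover (C.totalProj y)
  c := C.legCocycle
  c_smooth := C.legCocycle_smooth
  c_eq := fun i j k l y => C.legCocycle_eq i j k l y

end TDCocycle

end LeftLeg

end TDuality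

/-! The equivalence of (a) and (c) is almost formal. Both correspondences have B = 0, so an
isomorphism in the half-geometric sense contains matrices D_i that agree on overlaps. They form one
locally constant function, hence a constant on each component, and for constant D the isomorphism
equations are those of an isomorphism from `C.push D` (`exists_isoOn_component`). Conversely,
isomorphisms over the components, which are open and disjoint, are put side by side
(`nonempty_of_components`).

For (a) ⇒ (b), the functions p_i define a bundle isomorphism, since the a-equation holds modulo ℤⁿ.
The cochain between the two gerbes is written down explicitly on a cover of E fine enough to carry
real-valued fibre coordinates, and its coboundary is computed (`legCochain_eq`).

The substance is (b) ⇒ (a). Over E restricted to U_i, each gerbe is trivialized by its own cocycle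
with first index i. After subtracting these trivializations, the given 1-cochain e becomes a
1-cocycle, that is, a U(1)-bundle over W × 𝕋ⁿ for small W (`comparison_add`). Such a bundle is
classified by its Chern class in Λ²ℤⁿ ≅ 𝔰𝔬(n,ℤ): pulled back to W × ℝⁿ it has a trivialization h
with h(v + m) = h(v) - ⟨m|B|v⟩_low for integral m (`exists_quasiPeriodic`). Here the matrix B, which
becomes -D, appears.

Two such local trivializations differ by a function q on an open set times ℝⁿ. Its differences under
integral translations force the two matrices to agree, and then q = λ·v + R(v) + e with R periodic
of mean zero. The pair (λ, e) is unique and behaves well under sums and shifts (`HasForm`), so the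
irrelevant R can be forgotten. On triple overlaps the relation between the three functions q splits
into a linear and a constant part (`transition_cocycle`). The linear part says that a certain
ℝⁿ-valued family is a 1-cocycle; a partition of unity writes it as a coboundary, which gives p̂
(`exists_cobounding`). The constant part then becomes the equation for t (`toHG_iso`). -/

namespace TDuality

/-! ### Circle-valued smooth functions and their real lifts -/

section CircleValued

variable {E H M : Type*} [NormedAddCommGroup E] [NormedSpace ℝ E] [TopologicalSpace H]
    {I : ModelWithCorners ℝ E H} [TopologicalSpace M] [ChartedSpace H M]
    {E' H' M' : Type*} [NormedAddCommGroup E'] [NormedSpace ℝ E'] [TopologicalSpace H']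
    {I' : ModelWithCorners ℝ E' H'} [TopologicalSpace M'] [ChartedSpace H' M']

theorem SmoothU1On.mono {f : M → UnitAddCircle} {S T : Set M} (hf : SmoothU1On I f S)
    (h : T ⊆ S) : SmoothU1On I f T := ContMDiffOn.mono hf h

theorem SmoothU1On.const (c : UnitAddCircle) (S : Set M) : SmoothU1On I (fun _ => c) S :=
  contMDiffOn_const

theorem SmoothU1On.sub {f g : M → UnitAddCircle} {S : Set M} (hf : SmoothU1On I f S)
    (hg : SmoothU1On I g S) : SmoothU1On I (fun x => f x - g x) S := by
  simpa only [sub_eq_add_neg] using hf.add hg.neg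

theorem SmoothU1On.comp {f : M' → UnitAddCircle} {S : Set M'} (hf : SmoothU1On I' f S)
    {φ : M → M'} {T : Set M} (hφ : ContMDiffOn I I' ∞ φ T) (h : Set.MapsTo φ T S) :
    SmoothU1On I (fun x => f (φ x)) T :=
  ContMDiffOn.comp (g := fun x => ((AddCircle.toCircle (f x) : Circle) : ℂ)) hf hφ h

/-- Smoothness is local: it suffices to agree with a smooth function near each point. -/
theorem SmoothU1On.of_local {f : M → UnitAddCircle} {S : Set M}
    (h : ∀ x ∈ S, ∃ g : M → UnitAddCircle, ∃ T ∈ 𝓝 x, SmoothU1On I g (T ∩ S) ∧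
      ∀ y ∈ T ∩ S, f y = g y) : SmoothU1On I f S := by
  intro x hx
  obtain ⟨g, T, hT, hg, he⟩ := h x hx
  have h1 : ContMDiffWithinAt I 𝓘(ℝ, ℂ) ∞
      (fun x => ((AddCircle.toCircle (f x) : Circle) : ℂ)) (T ∩ S) x :=
    (hg.congr he) x ⟨mem_of_mem_nhds hT, hx⟩
  rwa [Set.inter_comm, contMDiffWithinAt_inter hT] at h1

theorem contMDiffOn_of_local {F : Type*} [NormedAddCommGroup F] [NormedSpace ℝ F]
    {f : M → F} {S : Set M}
    (h : ∀ x ∈ S, ∃ g : M → F, ∃ T ∈ 𝓝 x, ContMDiffOn I 𝓘(ℝ, F) ∞ g (T ∩ S) ∧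
      ∀ y ∈ T ∩ S, f y = g y) : ContMDiffOn I 𝓘(ℝ, F) ∞ f S := by
  intro x hx
  obtain ⟨g, T, hT, hg, he⟩ := h x hx
  have h1 : ContMDiffWithinAt I 𝓘(ℝ, F) ∞ f (T ∩ S) x :=
    (hg.congr he) x ⟨mem_of_mem_nhds hT, hx⟩
  rwa [Set.inter_comm, contMDiffWithinAt_inter hT] at h1

theorem SmoothU1On.continuousOn {f : M → UnitAddCircle} {S : Set M} (hf : SmoothU1On I f S) :
    ContinuousOn f S := by
  have h : ContinuousOn (fun x => ((AddCircle.toCircle (f x) : Circle) : ℂ)) S :=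
    ContMDiffOn.continuousOn hf
  have h2 : ContinuousOn (fun x => AddCircle.toCircle (f x)) S :=
    Topology.IsInducing.subtypeVal.continuousOn_iff.2 h
  have h3 := (AddCircle.homeomorphCircle (T := 1) one_ne_zero).symm.continuous.comp_continuousOn h2
  refine h3.congr fun x _ => ?_
  simp only [Function.comp_apply]
  rw [← AddCircle.homeomorphCircle_apply one_ne_zero, Homeomorph.symm_apply_apply]

/-- The real representative in `(-1/2, 1/2]` of an element of `ℝ/ℤ`. -/
noncomputable def argLift (θ : UnitAddCircle) : ℝ :=
  Complex.arg (AddCircle.toCircle θ : Circle) / (2 * Real.pi)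

theorem toU_argLift (θ : UnitAddCircle) : toU (argLift θ) = θ := by
  apply AddCircle.injective_toCircle (T := 1) one_ne_zero
  rw [toU, AddCircle.toCircle_apply_mk, argLift]
  have : 2 * Real.pi / 1 * (Complex.arg (AddCircle.toCircle θ : Circle) / (2 * Real.pi))
      = Complex.arg (AddCircle.toCircle θ : Circle) := by
    field_simp
  rw [this, Circle.exp_arg]

theorem argLift_toU {r : ℝ} (h : |r| < 1 / 2) : argLift (toU r) = r := by
  rw [abs_lt] at h
  rw [argLift, toU, AddCircle.toCircle_apply_mk, Circle.arg_exp]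
  · field_simp
  · nlinarith [Real.pi_pos]
  · nlinarith [Real.pi_pos]

/-- The cut of the logarithm is the argument π, which corresponds to the excluded value 1/2. -/
theorem slitPlane_toU {r : ℝ} (h : |r| < 1 / 2) :
    ((AddCircle.toCircle (toU r) : Circle) : ℂ) ∈ Complex.slitPlane := by
  rw [Complex.mem_slitPlane_iff_arg]
  refine ⟨?_, Circle.coe_ne_zero _⟩
  have h1 := argLift_toU h
  rw [argLift] at h1
  intro h2
  rw [h2] at h1
  have : Real.pi / (2 * Real.pi) = 1 / 2 := by field_simp
  rw [this] at h1
  rw [← h1] at h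
  norm_num at h

theorem SmoothU1On.argLift {f : M → UnitAddCircle} {S : Set M} (hf : SmoothU1On I f S)
    (h : ∀ x ∈ S, ((AddCircle.toCircle (f x) : Circle) : ℂ) ∈ Complex.slitPlane) :
    ContMDiffOn I 𝓘(ℝ, ℝ) ∞ (fun x => argLift (f x)) S := by
  intro x hx
  have h1 : ContDiffAt ℝ ∞ (fun z : ℂ => (Complex.log z).im / (2 * Real.pi))
      ((AddCircle.toCircle (f x) : Circle) : ℂ) := by
    have h2 : ContDiffAt ℝ ∞ Complex.log ((AddCircle.toCircle (f x) : Circle) : ℂ) :=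
      (Complex.contDiffAt_log (n := ∞) (h x hx)).restrict_scalars ℝ
    exact (Complex.imCLM.contDiff.contDiffAt.comp _ h2).div_const _
  have h3 := h1.contMDiffAt.comp_contMDiffWithinAt x (hf x hx)
  simp only [Function.comp_def, Complex.log_im] at h3
  exact h3

/-- A continuous real lift of a smooth circle-valued function is smooth. -/
theorem SmoothU1On.smooth_of_lift {f : M → UnitAddCircle} {S : Set M} (hf : SmoothU1On I f S)
    {g : M → ℝ} (hg : ContinuousOn g S) (h : ∀ x ∈ S, toU (g x) = f x) :
    ContMDiffOn I 𝓘(ℝ, ℝ) ∞ g S := by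
  intro x hx
  -- As long as g stays within 1/2 of g x, the difference g - g x is the principal lift of f - f x,
  -- and that lift is smooth away from the cut.
  set T := {y | y ∈ S ∧ |g y - g x| < 1 / 2}
  have hT : T ∈ 𝓝[S] x := by
    have h1 : Filter.Tendsto (fun y => g y - g x) (𝓝[S] x) (𝓝 (g x - g x)) :=
      ((hg x hx).sub continuousWithinAt_const)
    rw [sub_self] at h1
    have h2 := h1.eventually (Metric.ball_mem_nhds (0 : ℝ) (by norm_num : (0 : ℝ) < 1 / 2))
    filter_upwards [h2, self_mem_nhdsWithin] with y hy hyS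
    exact ⟨hyS, by simpa using hy⟩
  have key : ∀ y ∈ T, f y - f x = toU (g y - g x) := fun y hy => by
    rw [← h y hy.1, ← h x hx]; exact (AddCircle.coe_sub _ _ _).symm
  have hs : SmoothU1On I (fun y => f y - f x) T :=
    (hf.mono fun y hy => hy.1).sub (SmoothU1On.const _ _)
  have h3 := hs.argLift fun y hy => by
    rw [key y hy]; exact slitPlane_toU hy.2
  have h4 : ContMDiffOn I 𝓘(ℝ, ℝ) ∞ g T := by
    refine (smooth_add h3 (contMDiffOn_const (c := g x))).congr fun y hy => ?_
    rw [key y hy, argLift_toU hy.2]; ring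
  have hxT : x ∈ T := ⟨hx, by simp⟩
  exact (h4 x hxT).mono_of_mem_nhdsWithin hT

theorem toU_surjective : Function.Surjective (toU : ℝ → UnitAddCircle) :=
  fun θ => ⟨argLift θ, toU_argLift θ⟩

theorem toU_eq_zero_iff {r : ℝ} : toU r = 0 ↔ ∃ k : ℤ, r = k := by
  rw [toU, AddCircle.coe_eq_zero_iff]
  exact ⟨fun ⟨k, hk⟩ => ⟨k, by simpa using hk.symm⟩, fun ⟨k, hk⟩ => ⟨k, by simpa using hk.symm⟩⟩

theorem toU_add (r s : ℝ) : toU (r + s) = toU r + toU s := AddCircle.coe_add _ _ _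

theorem toU_sub (r s : ℝ) : toU (r - s) = toU r - toU s := AddCircle.coe_sub _ _ _

theorem toU_neg (r : ℝ) : toU (-r) = -toU r := AddCircle.coe_neg _

theorem toU_zero : toU 0 = 0 := AddCircle.coe_zero _

theorem toU_int (k : ℤ) : toU (k : ℝ) = 0 := toU_eq_zero_iff.2 ⟨k, rfl⟩

/-- Local existence of smooth real lifts. -/
theorem SmoothU1On.exists_local_lift {f : M → UnitAddCircle} {S : Set M} (hS : IsOpen S)
    (hf : SmoothU1On I f S) {x : M} (hx : x ∈ S) :
    ∃ T : Set M, IsOpen T ∧ x ∈ T ∧ T ⊆ S ∧ ∃ g : M → ℝ, ContMDiffOn I 𝓘(ℝ, ℝ) ∞ g T ∧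
      ∀ y ∈ T, toU (g y) = f y := by
  -- Subtracting f x moves the value at x to the point 1 of the circle, away from the cut.
  have hs : SmoothU1On I (fun y => f y - f x) S := hf.sub (SmoothU1On.const _ _)
  have hc : ContinuousOn (fun y => ((AddCircle.toCircle (f y - f x) : Circle) : ℂ)) S :=
    ContMDiffOn.continuousOn hs
  have hT := hc.isOpen_inter_preimage hS Complex.isOpen_slitPlane
  obtain ⟨c, hc⟩ := toU_surjective (f x)
  refine ⟨_, hT, ⟨hx, ?_⟩, Set.inter_subset_left, fun y => TDuality.argLift (f y - f x) + c, ?_, ?_⟩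
  · simp
  · exact smooth_add ((hs.mono Set.inter_subset_left).argLift fun y hy => hy.2) contMDiffOn_const
  · intro y _
    rw [toU_add, toU_argLift, hc, sub_add_cancel]

/-- A continuous circle-valued function on a convex set has a continuous real lift. -/
theorem exists_lift_of_convex {V : Type*} [NormedAddCommGroup V] [NormedSpace ℝ V]
    {S : Set V} (hS : Convex ℝ S) {f : V → UnitAddCircle} (hf : ContinuousOn f S) :
    ∃ g : V → ℝ, ContinuousOn g S ∧ ∀ x ∈ S, toU (g x) = f x := by
  classical
  rcases S.eq_empty_or_nonempty with rfl | ⟨x, hx⟩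
  · exact ⟨0, by simp, by simp⟩
  -- A convex set is contractible and locally path connected, so maps from it lift along the
  -- covering ℝ → ℝ/ℤ.
  have := hS.contractibleSpace ⟨x, hx⟩
  have := hS.locallyPathConnectedSpace
  obtain ⟨c, hc⟩ := toU_surjective (f x)
  obtain ⟨F, ⟨-, hF⟩, -⟩ := (AddCircle.isCoveringMap_coe (1 : ℝ)).existsUnique_continuousMap_lifts
    (⟨S.domRestrict f, hf.domRestrict⟩ : C(S, UnitAddCircle)) ⟨x, hx⟩ c hc
  refine ⟨fun y => if h : y ∈ S then F ⟨y, h⟩ else 0, ?_, fun y hy => ?_⟩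
  · rw [continuousOn_iff_continuous_domRestrict]
    convert F.continuous using 1
    ext y
    simp
  · simp only [hy, dif_pos]
    exact congrFun hF ⟨y, hy⟩

theorem SmoothU1On.exists_lift_of_convex {V : Type*} [NormedAddCommGroup V] [NormedSpace ℝ V]
    {S : Set V} (hS : Convex ℝ S) {f : V → UnitAddCircle} (hf : SmoothU1On 𝓘(ℝ, V) f S) :
    ∃ g : V → ℝ, ContDiffOn ℝ ∞ g S ∧ ∀ x ∈ S, toU (g x) = f x := by
  obtain ⟨g, hg, h⟩ := TDuality.exists_lift_of_convex hS hf.continuousOn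
  exact ⟨g, (hf.smooth_of_lift hg h).contDiffOn, h⟩

/-- Two continuous real lifts of the same function on a preconnected set differ by an integer. -/
theorem exists_int_of_toU_eq {Z : Type*} [TopologicalSpace Z] {S : Set Z} (hS : IsPreconnected S)
    {g : Z → ℝ} (hg : ContinuousOn g S) (h : ∀ x ∈ S, toU (g x) = 0) :
    ∃ k : ℤ, ∀ x ∈ S, g x = k := by
  rcases S.eq_empty_or_nonempty with rfl | ⟨x, hx⟩
  · exact ⟨0, by simp⟩
  obtain ⟨k, hk⟩ := toU_eq_zero_iff.1 (h x hx)
  refine ⟨k, fun y hy => ?_⟩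
  have h1 : IsPreconnected (g '' S) := hS.image _ hg
  have h2 : (g '' S) ⊆ Set.range ((↑) : ℤ → ℝ) := by
    rintro _ ⟨y, hy, rfl⟩
    obtain ⟨k, hk⟩ := toU_eq_zero_iff.1 (h y hy)
    exact ⟨k, hk.symm⟩
  have h3 : (g '' S).Subsingleton := by
    have h4 : IsTotallyDisconnected (Set.range ((↑) : ℤ → ℝ)) :=
      Set.Countable.isTotallyDisconnected (Set.countable_range _)
    exact h4 _ h2 h1
  rw [← hk]
  exact h3 ⟨y, hy, rfl⟩ ⟨x, hx, rfl⟩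

end CircleValued

/-- A family of smooth circle-valued functions that agree on overlaps can be glued. -/
theorem SmoothU1On.exists_glue {E H M : Type*} [NormedAddCommGroup E] [NormedSpace ℝ E]
    [TopologicalSpace H] {I : ModelWithCorners ℝ E H} [TopologicalSpace M] [ChartedSpace H M]
    {σ : Type*} {Ω : σ → Set M} (hΩ : ∀ s, IsOpen (Ω s)) {N : Set M} (hN : ∀ y ∈ N, ∃ s, y ∈ Ω s)
    {w : σ → M → UnitAddCircle} (hw : ∀ s, SmoothU1On I (w s) (N ∩ Ω s))
    (h : ∀ y ∈ N, ∀ s t, y ∈ Ω s → y ∈ Ω t → w s y = w t y) :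
    ∃ q : M → UnitAddCircle, SmoothU1On I q N ∧ ∀ y ∈ N, ∀ s, y ∈ Ω s → q y = w s y := by
  classical
  have key : ∀ y ∈ N, ∀ s, y ∈ Ω s →
      (if h : ∃ s, y ∈ Ω s then w h.choose y else 0) = w s y := fun y hy s hs => by
    have h' : ∃ s, y ∈ Ω s := ⟨s, hs⟩
    rw [dif_pos h']
    exact h y hy _ _ h'.choose_spec hs
  refine ⟨fun y => if h : ∃ s, y ∈ Ω s then w h.choose y else 0, ?_, key⟩
  refine SmoothU1On.of_local fun y hy => ?_
  obtain ⟨s, hs⟩ := hN y hy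
  refine ⟨w s, Ω s, (hΩ s).mem_nhds hs, (hw s).mono fun z hz => ⟨hz.2, hz.1⟩, fun z hz => ?_⟩
  exact key z hz.2 s hz.1

/-! ### Trivializing U(1)-valued 1-cocycles near compact convex sets -/

section Cocycle

variable {F : Type*} [NormedAddCommGroup F] [NormedSpace ℝ F] {σ : Type*}

/-- A smooth Čech 1-cocycle with values in `U(1)` on a family of open subsets. -/
structure IsCocycle (Ω : σ → Set F) (g : σ → σ → F → UnitAddCircle) : Prop where
  isOpen : ∀ s, IsOpen (Ω s)
  smooth : ∀ s t, SmoothU1On 𝓘(ℝ, F) (g s t) (Ω s ∩ Ω t)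
  add : ∀ s t v y, y ∈ Ω s → y ∈ Ω t → y ∈ Ω v → g s t y + g t v y = g s v y

/-- The 0-cochain `h` trivializes the cocycle `g` on the set `O`. -/
structure IsTriv (Ω : σ → Set F) (g : σ → σ → F → UnitAddCircle) (O : Set F)
    (h : σ → F → UnitAddCircle) : Prop where
  smooth : ∀ s, SmoothU1On 𝓘(ℝ, F) (h s) (O ∩ Ω s)
  eq : ∀ s t y, y ∈ O → y ∈ Ω s → y ∈ Ω t → g s t y = h t y - h s y

/-- The cocycle `g` has a trivialization on a neighbourhood of `K`. -/
def TrivNear (Ω : σ → Set F) (g : σ → σ → F → UnitAddCircle) (K : Set F) : Prop :=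
  ∃ O, IsOpen O ∧ K ⊆ O ∧ ∃ h, IsTriv Ω g O h

variable {Ω : σ → Set F} {g : σ → σ → F → UnitAddCircle}

theorem IsTriv.mono {O O' : Set F} {h : σ → F → UnitAddCircle} (hO : IsTriv Ω g O h)
    (hs : O' ⊆ O) : IsTriv Ω g O' h :=
  ⟨fun s => (hO.smooth s).mono fun _ hy => ⟨hs hy.1, hy.2⟩,
    fun s t y hy => hO.eq s t y (hs hy)⟩

theorem TrivNear.mono {K K' : Set F} (hK : TrivNear Ω g K) (h : K' ⊆ K) : TrivNear Ω g K' := by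
  obtain ⟨O, hO, hKO, hh⟩ := hK
  exact ⟨O, hO, h.trans hKO, hh⟩

/-- On a single set Ω s, the cocycle is trivialized by its own row g s. -/
theorem IsCocycle.trivNear_subsingleton (hg : IsCocycle Ω g) {K : Set F} (hK : K.Subsingleton)
    (hc : ∀ y ∈ K, ∃ s, y ∈ Ω s) : TrivNear Ω g K := by
  rcases K.eq_empty_or_nonempty with rfl | ⟨y, hy⟩
  · exact ⟨∅, isOpen_empty, subset_rfl, fun _ _ => 0, fun s => SmoothU1On.const _ _,
      fun _ _ _ h => h.elim⟩
  obtain ⟨s, hs⟩ := hc y hy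
  refine ⟨Ω s, hg.isOpen s, fun z hz => hK hy hz ▸ hs, g s, fun t => hg.smooth s t,
    fun t v z hz ht hv => ?_⟩
  rw [← hg.add s t v z hz ht hv]
  abel

/-- The difference of two trivializations. -/
theorem IsCocycle.exists_diff (hg : IsCocycle Ω g) {O₁ O₂ N : Set F} {h₁ h₂ : σ → F → UnitAddCircle}
    (h1 : IsTriv Ω g O₁ h₁) (h2 : IsTriv Ω g O₂ h₂) (hN₁ : N ⊆ O₁) (hN₂ : N ⊆ O₂)
    (hc : ∀ y ∈ N, ∃ s, y ∈ Ω s) :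
    ∃ q : F → UnitAddCircle, SmoothU1On 𝓘(ℝ, F) q N ∧
      ∀ y ∈ N, ∀ s, y ∈ Ω s → q y = h₂ s y - h₁ s y := by
  refine SmoothU1On.exists_glue hg.isOpen hc (w := fun s y => h₂ s y - h₁ s y) (fun s => ?_) ?_
  · exact ((h2.mono hN₂).smooth s).sub ((h1.mono hN₁).smooth s)
  · intro y hy s t hs ht
    have e1 := h1.eq s t y (hN₁ hy) hs ht
    have e2 := h2.eq s t y (hN₂ hy) hs ht
    rw [e1] at e2
    linear_combination (norm := abel) e2

/-- On the compact set K \ N the continuous function |l - c| has no zero, hence a positive lower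
bound. -/
theorem exists_slab_subset {K N : Set F} (hK : IsCompact K) (hN : IsOpen N) (l : F →L[ℝ] ℝ) (c : ℝ)
    (h : K ∩ {y | l y = c} ⊆ N) : ∃ η > 0, ∀ y ∈ K, |l y - c| < η → y ∈ N := by
  have h1 : IsCompact (K \ N) := hK.diff hN
  obtain ⟨η, hη, h2⟩ := h1.exists_forall_le' (f := fun y => |l y - c|) (a := 0)
    (by fun_prop) (fun y hy => by
      rw [abs_pos, sub_ne_zero]
      exact fun e => hy.2 (h ⟨hy.1, e⟩))
  refine ⟨η, hη, fun y hy hlt => ?_⟩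
  by_contra hn
  exact absurd (h2 y ⟨hy, hn⟩) (not_le.2 hlt)

/-- Two trivializations on the two sides of a hyperplane can be glued. -/
theorem IsCocycle.trivNear_of_halves (hg : IsCocycle Ω g) {K : Set F} (hK : IsCompact K)
    (hconv : Convex ℝ K) (hc : ∀ y ∈ K, ∃ s, y ∈ Ω s) (l : F →L[ℝ] ℝ) (τ : ℝ)
    (h1 : TrivNear Ω g (K ∩ {y | l y ≤ τ})) (h2 : TrivNear Ω g (K ∩ {y | τ ≤ l y})) :
    TrivNear Ω g K := by
  classical
  obtain ⟨O₁, hO₁, hK₁, h₁, ht₁⟩ := h1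
  obtain ⟨O₂, hO₂, hK₂, h₂, ht₂⟩ := h2
  have hcl : IsClosed {y | l y = τ} := isClosed_eq l.continuous continuous_const
  have hΩ : IsOpen (⋃ s, Ω s) := isOpen_iUnion hg.isOpen
  obtain ⟨δ, hδ, hsub⟩ := (hK.inter_right hcl).exists_thickening_subset_open
    ((hO₁.inter hO₂).inter hΩ) (fun y hy => ⟨⟨hK₁ ⟨hy.1, le_of_eq hy.2⟩,
      hK₂ ⟨hy.1, ge_of_eq hy.2⟩⟩, Set.mem_iUnion.2 (hc y hy.1)⟩)
  -- A thickening of a convex set is convex. Hence the difference q of the two trivializations lifts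
  -- to a real function r on N, and a real function, unlike a circle-valued one, can be multiplied
  -- by a cut-off.
  set N := Metric.thickening δ (K ∩ {y | l y = τ})
  have hNo : IsOpen N := Metric.isOpen_thickening
  have hNc : Convex ℝ N := by
    refine (hconv.inter ?_).thickening δ
    exact convex_hyperplane l.toLinearMap.isLinear τ
  obtain ⟨q, hq, hqe⟩ := hg.exists_diff ht₁ ht₂ (fun y hy => (hsub hy).1.1)
    (fun y hy => (hsub hy).1.2) (fun y hy => Set.mem_iUnion.1 (hsub hy).2)
  obtain ⟨r, hr, hre⟩ := hq.exists_lift_of_convex hNc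
  obtain ⟨η, hη, hslab⟩ := exists_slab_subset hK hNo l τ (Metric.self_subset_thickening hδ _)
  -- The transition from 0 to 1 takes place for |l - τ| ≤ η/2, well inside the slab in which K is
  -- contained in N.
  set χ : F → ℝ := fun y => Real.smoothTransition ((l y - τ) / η + 1 / 2) with hχ
  have hχs : ContDiff ℝ ∞ χ := by
    refine Real.smoothTransition.contDiff.comp ?_
    exact ((l.contDiff.sub contDiff_const).div_const _).add contDiff_const
  have hχ0 : ∀ y, l y ≤ τ - η / 2 → χ y = 0 := fun y hy => by
    refine Real.smoothTransition.zero_of_nonpos ?_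
    rw [div_add' _ _ _ hη.ne']
    exact div_nonpos_of_nonpos_of_nonneg (by linarith) hη.le
  have hχ1 : ∀ y, τ + η / 2 ≤ l y → χ y = 1 := fun y hy => by
    refine Real.smoothTransition.one_of_one_le ?_
    rw [div_add' _ _ _ hη.ne', le_div_iff₀ hη]
    linarith
  -- The cochain h₁ + χ r passes from h₁ to h₁ + q = h₂ across the slab. Since χ r does not depend
  -- on s, the coboundary stays the same.
  set h : σ → F → UnitAddCircle := fun s y =>
    if l y ≤ τ - η / 2 then h₁ s y else if τ + η / 2 ≤ l y then h₂ s y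
      else h₁ s y + toU (χ y * r y) with hh
  have hA : ∀ s y, l y < τ - η / 2 → h s y = h₁ s y := fun s y hy => by
    simp only [hh, if_pos hy.le]
  have hB : ∀ s y, τ + η / 2 < l y → h s y = h₂ s y := fun s y hy => by
    simp only [hh, if_pos hy.le, if_neg (show ¬ l y ≤ τ - η / 2 by linarith)]
  have hC : ∀ s, ∀ y ∈ N, y ∈ Ω s → h s y = h₁ s y + toU (χ y * r y) := fun s y hy hs => by
    simp only [hh]
    split_ifs with c1 c2
    · rw [hχ0 y c1, zero_mul, toU_zero, add_zero]
    · rw [hχ1 y c2, one_mul, hre y hy, hqe y hy s hs]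
      abel
    · rfl
  have o1 : IsOpen (O₁ ∩ {y | l y < τ - η / 2}) :=
    hO₁.inter (isOpen_lt l.continuous continuous_const)
  have o2 : IsOpen (O₂ ∩ {y | τ + η / 2 < l y}) :=
    hO₂.inter (isOpen_lt continuous_const l.continuous)
  refine ⟨(O₁ ∩ {y | l y < τ - η / 2}) ∪ (O₂ ∩ {y | τ + η / 2 < l y}) ∪ N,
    (o1.union o2).union hNo, fun y hy => ?_, h, fun s => ?_, fun s t y hy hs ht => ?_⟩
  · by_cases c1 : l y < τ - η / 2
    · exact Or.inl (Or.inl ⟨hK₁ ⟨hy, show l y ≤ τ by linarith⟩, c1⟩)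
    by_cases c2 : τ + η / 2 < l y
    · exact Or.inl (Or.inr ⟨hK₂ ⟨hy, show τ ≤ l y by linarith⟩, c2⟩)
    · refine Or.inr (hslab y hy ?_)
      rw [abs_lt]
      constructor <;> linarith
  · refine SmoothU1On.of_local fun y hy => ?_
    rcases hy with ⟨(hy | hy) | hy, hs⟩
    · exact ⟨h₁ s, _, o1.mem_nhds hy, (ht₁.smooth s).mono fun z hz => ⟨hz.1.1, hz.2.2⟩,
        fun z hz => hA s z hz.1.2⟩
    · exact ⟨h₂ s, _, o2.mem_nhds hy, (ht₂.smooth s).mono fun z hz => ⟨hz.1.1, hz.2.2⟩,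
        fun z hz => hB s z hz.1.2⟩
    · refine ⟨_, N, hNo.mem_nhds hy, ?_, fun z hz => hC s z hz.1 hz.2.2⟩
      refine ((ht₁.smooth s).mono fun z hz => ⟨(hsub hz.1).1.1, hz.2.2⟩).add (SmoothU1On.coe ?_)
      exact smooth_mul hχs.contMDiff.contMDiffOn
        ((hr.mono fun z hz => hz.1).contMDiffOn)
  · rcases hy with (hy | hy) | hy
    · rw [hA s y hy.2, hA t y hy.2, ht₁.eq s t y hy.1 hs ht]
    · rw [hB s y hy.2, hB t y hy.2, ht₂.eq s t y hy.1 hs ht]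
    · rw [hC s y hy hs, hC t y hy ht, ht₁.eq s t y (hsub hy).1.1 hs ht]
      abel

/-- By compactness, a trivialization near a slice is also one near a slab. Finitely many slabs cover
K, and neighbouring ones are glued along a hyperplane. -/
theorem IsCocycle.trivNear_of_slices (hg : IsCocycle Ω g) {K : Set F} (hK : IsCompact K)
    (hconv : Convex ℝ K) (hc : ∀ y ∈ K, ∃ s, y ∈ Ω s) (l : F →L[ℝ] ℝ)
    (h : ∀ c, TrivNear Ω g (K ∩ {y | l y = c})) : TrivNear Ω g K := by
  rcases K.eq_empty_or_nonempty with rfl | hne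
  · exact (h 0).mono (by simp)
  obtain ⟨y₀, hy₀, hmin⟩ := hK.exists_isMinOn hne l.continuous.continuousOn
  obtain ⟨y₁, hy₁, hmax⟩ := hK.exists_isMaxOn hne l.continuous.continuousOn
  have hab : l y₀ ≤ l y₁ := hmin hy₁
  have h' : ∀ c, ∃ η > 0, TrivNear Ω g (K ∩ {y | |l y - c| < η}) := fun c => by
    obtain ⟨O, hO, hKO, hh⟩ := h c
    obtain ⟨η, hη, hs⟩ := exists_slab_subset hK hO l c hKO
    exact ⟨η, hη, O, hO, fun y hy => hs y hy.1 hy.2, hh⟩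
  choose η hη htriv using h'
  obtain ⟨t, ht0, htm, ⟨m, hm⟩, htc⟩ := exists_monotone_Icc_subset_open_cover_Icc hab
    (c := fun c : ℝ => {τ : Set.Icc (l y₀) (l y₁) | |(τ : ℝ) - c| < η c})
    (fun c => isOpen_lt (by fun_prop) continuous_const)
    (fun τ _ => Set.mem_iUnion.2 ⟨(τ : ℝ), by simpa using hη τ⟩)
  have hstep : ∀ k, TrivNear Ω g (K ∩ {y | (t k : ℝ) ≤ l y ∧ l y ≤ t (k + 1)}) := fun k => by
    obtain ⟨c, hc⟩ := htc k
    refine (htriv c).mono fun y hy => ⟨hy.1, ?_⟩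
    exact @hc ⟨l y, hmin hy.1, hmax hy.1⟩ ⟨hy.2.1, hy.2.2⟩
  -- The slabs are added one at a time from below. The start is the slice where l is minimal on K.
  have hind : ∀ k, TrivNear Ω g (K ∩ {y | l y ≤ t k}) := fun k => by
    induction k with
    | zero =>
      refine (h (l y₀)).mono fun y hy => ⟨hy.1, le_antisymm ?_ (hmin hy.1)⟩
      rw [← ht0]; exact hy.2
    | succ k ih =>
      refine hg.trivNear_of_halves (hK.inter_right (isClosed_le l.continuous continuous_const))
        (hconv.inter (convex_halfSpace_le l.toLinearMap.isLinear _)) (fun y hy => hc y hy.1) l (t k)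
        (ih.mono fun y hy => ⟨hy.1.1, hy.2⟩) ((hstep k).mono fun y hy => ⟨hy.1.1, hy.2, hy.1.2⟩)
  refine (hind m).mono fun y hy => ⟨hy, ?_⟩
  change l y ≤ t m
  rw [hm m le_rfl]
  exact hmax hy

/-- Slicing by one linear form after another. Slices of compact convex sets are again compact and
convex, so the induction runs over all such K at once. -/
theorem IsCocycle.trivNear_of_finset {ι : Type*} (hg : IsCocycle Ω g) (l : ι → F →L[ℝ] ℝ)
    (S : Finset ι) {K : Set F} (hK : IsCompact K)
    (hconv : Convex ℝ K) (hc : ∀ y ∈ K, ∃ s, y ∈ Ω s)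
    (h : ∀ c : ι → ℝ, TrivNear Ω g (K ∩ {y | ∀ i ∈ S, l i y = c i})) : TrivNear Ω g K := by
  classical
  induction S using Finset.induction_on generalizing K with
  | empty => exact (h 0).mono fun y hy => ⟨hy, by simp⟩
  | insert i S hi ih =>
    refine hg.trivNear_of_slices hK hconv hc (l i) fun c => ?_
    refine ih (hK.inter_right (isClosed_eq (l i).continuous continuous_const))
      (hconv.inter (convex_hyperplane (l i).toLinearMap.isLinear _)) (fun y hy => hc y hy.1)
      fun c' => ?_
    refine (h (Function.update c' i c)).mono fun y hy => ⟨hy.1.1, fun j hj => ?_⟩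
    rcases Finset.mem_insert.1 hj with rfl | hj'
    · simpa using hy.1.2
    · rw [Function.update_of_ne (by rintro rfl; exact hi hj')]
      exact hy.2 j hj'

end Cocycle

/-! ### Trivializations near a cube in one fibre -/

section Box

variable {V : Type*} [NormedAddCommGroup V] [NormedSpace ℝ V] {n : ℕ} {σ : Type*}
  {Ω : σ → Set (V × (Fin n → ℝ))} {g : σ → σ → V × (Fin n → ℝ) → UnitAddCircle}

/-- A cocycle is trivial over a neighbourhood of `{ξ₀} × [0,1]ⁿ`. -/
theorem IsCocycle.exists_triv_box (hg : IsCocycle Ω g) (ξ₀ : V)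
    (hc : ∀ v, ∃ s, (ξ₀, v) ∈ Ω s) :
    ∃ ε > 0, ∃ h, IsTriv Ω g (Metric.ball ξ₀ ε ×ˢ {v | ∀ i, -ε < v i ∧ v i < 1 + ε}) h := by
  set K : Set (V × (Fin n → ℝ)) := {ξ₀} ×ˢ Set.Icc 0 1
  have hK : IsCompact K := isCompact_singleton.prod isCompact_Icc
  have htriv : TrivNear Ω g K := by
    -- The linear forms are the n fibre coordinates. Fixing all of them leaves at most one point of
    -- {ξ₀} × [0,1]ⁿ.
    refine hg.trivNear_of_finset (ι := Fin n)
      (fun i => (ContinuousLinearMap.proj i).comp (ContinuousLinearMap.snd ℝ V (Fin n → ℝ)))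
      Finset.univ hK ((convex_singleton _).prod (convex_Icc _ _)) ?_ fun c => ?_
    · rintro ⟨ξ, v⟩ ⟨hξ, -⟩
      obtain rfl : ξ = ξ₀ := hξ
      exact hc v
    · refine hg.trivNear_subsingleton ?_ ?_
      · rintro ⟨ξ, v⟩ ⟨⟨hξ, -⟩, hv⟩ ⟨ξ', v'⟩ ⟨⟨hξ', -⟩, hv'⟩
        obtain rfl : ξ = ξ₀ := hξ
        obtain rfl : ξ' = ξ := hξ'
        refine Prod.ext rfl (funext fun i => ?_)
        have e1 := hv i (Finset.mem_univ i)
        have e2 := hv' i (Finset.mem_univ i)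
        exact e1.trans e2.symm
      · rintro ⟨ξ, v⟩ ⟨⟨hξ, -⟩, hv⟩
        obtain rfl : ξ = ξ₀ := hξ
        exact hc v
  obtain ⟨O, hO, hKO, h, hh⟩ := htriv
  obtain ⟨δ, hδ, hsub⟩ := hK.exists_thickening_subset_open hO hKO
  refine ⟨δ, hδ, h, hh.mono ?_⟩
  rintro ⟨ξ, v⟩ ⟨hξ, hv⟩
  -- The witness is a nearest point of the cube, obtained by clamping every coordinate to [0,1].
  refine hsub (Metric.mem_thickening_iff.2 ⟨(ξ₀, fun i => max 0 (min 1 (v i))), ⟨rfl, ?_⟩, ?_⟩)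
  · exact ⟨fun i => le_max_left _ _, fun i => max_le zero_le_one (min_le_left _ _)⟩
  · rw [Prod.dist_eq]
    refine max_lt hξ ((dist_pi_lt_iff hδ).2 fun i => ?_)
    have := hv i
    rw [Real.dist_eq, abs_lt]
    dsimp only at this ⊢
    rcases le_total (v i) 1 with h1 | h1 <;> rcases le_total (v i) 0 with h2 | h2
    · rw [min_eq_right h1, max_eq_left h2]; constructor <;> linarith [this.1]
    · rw [min_eq_right h1, max_eq_right h2]; constructor <;> linarith
    · linarith
    · rw [min_eq_left h1, max_eq_right zero_le_one]; constructor <;> linarith [this.2]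

end Box

/-! ### Quasi-periodic trivializations over a ball times ℝⁿ -/

section QuasiPeriodic

variable {V : Type*} {n : ℕ}

/-- Translation of the `i`-th fibre coordinate by `c`. -/
def tr (i : Fin n) (c : ℝ) (y : V × (Fin n → ℝ)) : V × (Fin n → ℝ) := (y.1, y.2 + Pi.single i c)

theorem tr_same (i : Fin n) (c : ℝ) (y : V × (Fin n → ℝ)) : (tr i c y).2 i = y.2 i + c := by
  simp [tr]

theorem tr_of_ne {i q : Fin n} (h : q ≠ i) (c : ℝ) (y : V × (Fin n → ℝ)) :
    (tr i c y).2 q = y.2 q := by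
  simp [tr, h]

theorem tr_tr (i : Fin n) (c c' : ℝ) (y : V × (Fin n → ℝ)) :
    tr i c (tr i c' y) = tr i (c' + c) y := by
  simp [tr, add_assoc, Pi.single_add]

theorem tr_comm (i i' : Fin n) (c c' : ℝ) (y : V × (Fin n → ℝ)) :
    tr i c (tr i' c' y) = tr i' c' (tr i c y) := by
  simp only [tr, add_right_comm]

theorem tr_zero (i : Fin n) (y : V × (Fin n → ℝ)) : tr i 0 y = y := by
  simp [tr]

/-- The linear form `∑_{q < i} d_{iq} v_q`. -/
def lowRow (d : Fin n → Fin n → ℤ) (i : Fin n) (v : Fin n → ℝ) : ℝ :=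
  ∑ q, if q < i then (d i q : ℝ) * v q else 0

theorem lowRow_tr (d : Fin n → Fin n → ℤ) (i p : Fin n) (c : ℝ) (y : V × (Fin n → ℝ)) :
    lowRow d i (tr p c y).2 = lowRow d i y.2 + if p < i then (d i p : ℝ) * c else 0 := by
  have : (if p < i then (d i p : ℝ) * c else 0)
      = ∑ q, if q < i then (d i q : ℝ) * (Pi.single p c : Fin n → ℝ) q else 0 := by
    rw [Finset.sum_eq_single p]
    · simp
    · intro q _ hq; simp [hq]
    · simp
  rw [this, lowRow, lowRow, ← Finset.sum_add_distrib]
  refine Finset.sum_congr rfl fun q _ => ?_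
  split_ifs
  · simp only [tr, Pi.add_apply]; ring
  · simp

theorem lowRow_congr {d d' : Fin n → Fin n → ℤ} {i : Fin n} (h : d i = d' i) (v : Fin n → ℝ) :
    lowRow d i v = lowRow d' i v := by
  simp only [lowRow, h]

variable [NormedAddCommGroup V]

/-- The domain over which the first `j` fibre coordinates are arbitrary and the others lie in
`(-ε, 1 + ε)`. -/
def boxDomain (n : ℕ) (ξ₀ : V) (ε : ℝ) (j : ℕ) : Set (V × (Fin n → ℝ)) :=
  {y | y.1 ∈ Metric.ball ξ₀ ε ∧ ∀ i : Fin n, j ≤ i → -ε < y.2 i ∧ y.2 i < 1 + ε}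

theorem boxDomain_mono (ξ₀ : V) {ε ε' : ℝ} (h : ε' ≤ ε) (j : ℕ) :
    boxDomain n ξ₀ ε' j ⊆ boxDomain n ξ₀ ε j := fun y hy =>
  ⟨Metric.ball_subset_ball h hy.1, fun i hi => ⟨by linarith [(hy.2 i hi).1],
    by linarith [(hy.2 i hi).2]⟩⟩

theorem tr_mem_boxDomain {ξ₀ : V} {ε : ℝ} {j : ℕ} {i : Fin n} (hi : (i : ℕ) < j) (c : ℝ)
    {y : V × (Fin n → ℝ)} (hy : y ∈ boxDomain n ξ₀ ε j) : tr i c y ∈ boxDomain n ξ₀ ε j := by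
  refine ⟨hy.1, fun q hq => ?_⟩
  rw [tr_of_ne (by rintro rfl; omega)]
  exact hy.2 q hq

theorem mem_boxDomain_of_succ {ξ₀ : V} {ε : ℝ} {i : Fin n} {y : V × (Fin n → ℝ)}
    (hy : y ∈ boxDomain n ξ₀ ε (i + 1)) (h : -ε < y.2 i ∧ y.2 i < 1 + ε) :
    y ∈ boxDomain n ξ₀ ε i := by
  refine ⟨hy.1, fun q hq => ?_⟩
  rcases eq_or_ne q i with rfl | hne
  · exact h
  · exact hy.2 q (by have := Fin.val_ne_of_ne hne; omega)

theorem boxDomain_succ {ξ₀ : V} {ε : ℝ} {j : ℕ} {y : V × (Fin n → ℝ)}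
    (hy : y ∈ boxDomain n ξ₀ ε j) : y ∈ boxDomain n ξ₀ ε (j + 1) :=
  ⟨hy.1, fun q hq => hy.2 q (by omega)⟩

theorem tr_mem_boxDomain_succ {ξ₀ : V} {ε : ℝ} {i : Fin n} (c : ℝ)
    {y : V × (Fin n → ℝ)} (hy : y ∈ boxDomain n ξ₀ ε (i + 1)) :
    tr i c y ∈ boxDomain n ξ₀ ε (i + 1) := tr_mem_boxDomain (Nat.lt_succ_self _) c hy

variable [NormedSpace ℝ V]

theorem contDiff_tr (i : Fin n) (c : ℝ) :
    ContDiff ℝ ∞ (tr i c : V × (Fin n → ℝ) → V × (Fin n → ℝ)) :=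
  contDiff_fst.prodMk (contDiff_snd.add contDiff_const)

theorem contDiff_fibre_coord (i : Fin n) : ContDiff ℝ ∞ (fun y : V × (Fin n → ℝ) => y.2 i) :=
  (contDiff_apply ℝ ℝ i).comp contDiff_snd

theorem contDiff_lowRow (d : Fin n → Fin n → ℤ) (i : Fin n) :
    ContDiff ℝ ∞ (fun y : V × (Fin n → ℝ) => lowRow d i y.2) := by
  refine ContDiff.sum fun q _ => ?_
  by_cases h : q < i
  · simp only [if_pos h]; exact contDiff_const.mul (contDiff_fibre_coord q)
  · simp only [if_neg h]; exact contDiff_const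

theorem convex_boxDomain (ξ₀ : V) (ε : ℝ) (j : ℕ) : Convex ℝ (boxDomain n ξ₀ ε j) := by
  have h1 : Convex ℝ {y : V × (Fin n → ℝ) | y.1 ∈ Metric.ball ξ₀ ε} :=
    (convex_ball ξ₀ ε).linear_preimage (LinearMap.fst ℝ V (Fin n → ℝ))
  have h2 : ∀ i : Fin n, Convex ℝ {y : V × (Fin n → ℝ) | j ≤ (i : ℕ) → -ε < y.2 i ∧ y.2 i < 1 + ε} := by
    intro i
    by_cases hi : j ≤ (i : ℕ)
    · have : {y : V × (Fin n → ℝ) | j ≤ (i : ℕ) → -ε < y.2 i ∧ y.2 i < 1 + ε}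
          = ((LinearMap.proj i).comp (LinearMap.snd ℝ V (Fin n → ℝ))) ⁻¹' Set.Ioo (-ε) (1 + ε) := by
        ext y; simp [hi]
      rw [this]
      exact (convex_Ioo _ _).linear_preimage _
    · have : {y : V × (Fin n → ℝ) | j ≤ (i : ℕ) → -ε < y.2 i ∧ y.2 i < 1 + ε} = Set.univ := by
        ext y; simp [hi]
      rw [this]
      exact convex_univ
  have : boxDomain n ξ₀ ε j = {y | y.1 ∈ Metric.ball ξ₀ ε} ∩
      ⋂ i : Fin n, {y | j ≤ (i : ℕ) → -ε < y.2 i ∧ y.2 i < 1 + ε} := by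
    ext y; simp [boxDomain]
  rw [this]
  exact h1.inter (convex_iInter h2)

variable {σ : Type*} {Ω : σ → Set (V × (Fin n → ℝ))}
  {g : σ → σ → V × (Fin n → ℝ) → UnitAddCircle}

/-- Quasi-periodicity in the first `j` fibre coordinates, with respect to the lower triangular
integral matrix `d`. -/
def IsQuasi (Ω : σ → Set (V × (Fin n → ℝ))) (D : Set (V × (Fin n → ℝ))) (j : ℕ)
    (d : Fin n → Fin n → ℤ) (h : σ → V × (Fin n → ℝ) → UnitAddCircle) : Prop :=
  ∀ i : Fin n, (i : ℕ) < j → ∀ y ∈ D, ∀ s, y ∈ Ω s → h s (tr i 1 y) = h s y - toU (lowRow d i y.2)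

/-- Normalizing the comparison of a trivialization with its translate in the next direction. -/
theorem IsCocycle.exists_normalized (hg : IsCocycle Ω g)
    (hΩp : ∀ s i (k : ℤ) y, tr i k y ∈ Ω s ↔ y ∈ Ω s)
    (hgp : ∀ s t i (k : ℤ) y, g s t (tr i k y) = g s t y)
    {ξ₀ : V} {ε : ℝ} (hε : 0 < ε) (hε1 : ε ≤ 1) (i₀ : Fin n)
    (hc : ∀ y : V × (Fin n → ℝ), y.1 ∈ Metric.ball ξ₀ ε → ∃ s, y ∈ Ω s)
    {d : Fin n → Fin n → ℤ} {h : σ → V × (Fin n → ℝ) → UnitAddCircle}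
    (hh : IsTriv Ω g (boxDomain n ξ₀ ε i₀) h) (hq : IsQuasi Ω (boxDomain n ξ₀ ε i₀) i₀ d h) :
    ∃ (d' : Fin n → Fin n → ℤ) (h' : σ → V × (Fin n → ℝ) → UnitAddCircle),
      IsTriv Ω g (boxDomain n ξ₀ ε i₀) h' ∧ IsQuasi Ω (boxDomain n ξ₀ ε i₀) i₀ d' h' ∧
      ∀ y ∈ boxDomain n ξ₀ ε i₀, y.2 i₀ < ε / 4 → -(ε / 4) < y.2 i₀ → ∀ s, y ∈ Ω s →
        h' s (tr i₀ 1 y) = h' s y - toU (lowRow d' i₀ y.2) := by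
  classical
  have hΩ1 : ∀ s i y, tr i 1 y ∈ Ω s ↔ y ∈ Ω s := fun s i y => by simpa using hΩp s i 1 y
  have hg1 : ∀ s t i y, g s t (tr i 1 y) = g s t y := fun s t i y => by simpa using hgp s t i 1 y
  -- N consists of the points near the lower face whose translate by 1 in direction i₀ still lies in
  -- the domain.
  set N : Set (V × (Fin n → ℝ)) := boxDomain n ξ₀ ε i₀ ∩ {y | y.2 i₀ < ε} with hN
  have hNconv : Convex ℝ N := (convex_boxDomain ξ₀ ε i₀).inter
    (convex_halfSpace_lt ((LinearMap.proj i₀).comp (LinearMap.snd ℝ V (Fin n → ℝ))).isLinear ε)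
  have htrN : ∀ y ∈ N, tr i₀ 1 y ∈ boxDomain n ξ₀ ε i₀ := fun y hy => by
    refine mem_boxDomain_of_succ (tr_mem_boxDomain_succ 1 (boxDomain_succ hy.1)) ?_
    rw [tr_same]
    have h1 := hy.1.2 i₀ le_rfl
    have h2 : y.2 i₀ < ε := hy.2
    constructor <;> linarith
  have hNtr : ∀ i : Fin n, (i : ℕ) < i₀ → ∀ c, ∀ y ∈ N, tr i c y ∈ N := fun i hi c y hy => by
    refine ⟨tr_mem_boxDomain hi c hy.1, ?_⟩
    change (tr i c y).2 i₀ < ε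
    rw [tr_of_ne (by rintro rfl; omega)]
    exact hy.2
  -- The cocycle is periodic, so the translate of h trivializes it too and can be compared with h.
  have hh2 : IsTriv Ω g N (fun s y => h s (tr i₀ 1 y)) := by
    refine ⟨fun s => ?_, fun s t y hy hs ht => ?_⟩
    · exact (hh.smooth s).comp (contDiff_tr i₀ 1).contMDiff.contMDiffOn
        fun y hy => ⟨htrN y hy.1, (hΩ1 s i₀ y).2 hy.2⟩
    · rw [← hg1 s t i₀ y]
      exact hh.eq s t _ (htrN y hy) ((hΩ1 s i₀ y).2 hs) ((hΩ1 t i₀ y).2 ht)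
  obtain ⟨q, hqs, hqe⟩ := hg.exists_diff hh hh2 (N := N) (fun y hy => hy.1) subset_rfl
    (fun y hy => hc y hy.1.1)
  obtain ⟨r₀, hr₀, hr₀e⟩ := hqs.exists_lift_of_convex hNconv
  -- For i < i₀, the function h and its translate have the same jump in direction i, since row i of
  -- the lower triangle does not involve the coordinate i₀. Their difference is therefore periodic
  -- in the circle, and its lift is periodic up to an integer.
  have hper : ∀ i : Fin n, ∃ k : ℤ, (i : ℕ) < i₀ → ∀ y ∈ N, r₀ (tr i 1 y) - r₀ y = k := by
    intro i
    by_cases hi : (i : ℕ) < i₀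
    · obtain ⟨k, hk⟩ := exists_int_of_toU_eq hNconv.isPreconnected
        (g := fun y => r₀ (tr i 1 y) - r₀ y)
        ((hr₀.continuousOn.comp (contDiff_tr i 1).continuous.continuousOn
          fun y hy => hNtr i hi 1 y hy).sub hr₀.continuousOn) (by
        intro y hy
        obtain ⟨s, hs⟩ := hc y hy.1.1
        rw [toU_sub, hr₀e _ (hNtr i hi 1 y hy), hr₀e _ hy, hqe _ hy s hs,
          hqe _ (hNtr i hi 1 y hy) s ((hΩ1 s i y).2 hs), tr_comm,
          hq i hi _ (htrN y hy) s ((hΩ1 s i₀ y).2 hs), hq i hi y hy.1 s hs, lowRow_tr,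
          if_neg (by rw [Fin.lt_def]; omega), add_zero]
        abel)
      exact ⟨k, fun _ => hk⟩
    · exact ⟨0, fun h => absurd h hi⟩
  choose k hk using hper
  -- These integers are the new Chern numbers. With the sign, row i₀ of d' cancels the drift of r₀,
  -- so that r is truly periodic in the earlier directions.
  set d' : Fin n → Fin n → ℤ := Function.update d i₀ (fun q => - k q) with hd'
  have hd'0 : d' i₀ = fun q => - k q := Function.update_self ..
  have hd'1 : ∀ i : Fin n, (i : ℕ) < i₀ → d i = d' i := fun i hi => by
    rw [hd', Function.update_of_ne (by rintro rfl; omega)]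
  set r : V × (Fin n → ℝ) → ℝ := fun y => r₀ y + lowRow d' i₀ y.2 with hr
  have hrs : ContDiffOn ℝ ∞ r N := hr₀.add (contDiff_lowRow d' i₀).contDiffOn
  have hrp : ∀ i : Fin n, (i : ℕ) < i₀ → ∀ y ∈ N, r (tr i 1 y) = r y := fun i hi y hy => by
    have h1 := hk i hi y hy
    simp only [hr]
    rw [lowRow_tr, if_pos (Fin.lt_def.2 hi), hd'0]
    push_cast
    linarith
  have hrq : ∀ y ∈ N, ∀ s, y ∈ Ω s → h s (tr i₀ 1 y) = h s y + toU (r y) - toU (lowRow d' i₀ y.2) :=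
    fun y hy s hs => by
      have h1 := hqe y hy s hs
      rw [← hr₀e y hy] at h1
      simp only [hr, toU_add]
      rw [h1]
      abel
  -- The cut-off vanishes up to 1 - ε/2 and equals 1 from 1 - ε/4 on. The correction w therefore
  -- lives near the upper face only, and subtracting it removes r from the jump between the two
  -- faces.
  set χ : V × (Fin n → ℝ) → ℝ := fun y =>
    Real.smoothTransition ((y.2 i₀ - (1 - ε / 2)) / (ε / 4)) with hχ
  have hχs : ContDiff ℝ ∞ χ := Real.smoothTransition.contDiff.comp
    (((contDiff_fibre_coord i₀).sub contDiff_const).div_const _)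
  have hχ0 : ∀ y, y.2 i₀ ≤ 1 - ε / 2 → χ y = 0 := fun y hy =>
    Real.smoothTransition.zero_of_nonpos
      (div_nonpos_of_nonpos_of_nonneg (by linarith) (by linarith))
  have hχ1 : ∀ y, 1 - ε / 4 ≤ y.2 i₀ → χ y = 1 := fun y hy => by
    refine Real.smoothTransition.one_of_one_le ?_
    rw [le_div_iff₀ (by linarith)]
    linarith
  have hback : ∀ y ∈ boxDomain n ξ₀ ε i₀, 1 - ε < y.2 i₀ → tr i₀ (-1) y ∈ N := fun y hy h1 => by
    have h2 := hy.2 i₀ le_rfl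
    refine ⟨mem_boxDomain_of_succ (tr_mem_boxDomain_succ (-1) (boxDomain_succ hy)) ?_, ?_⟩
    · rw [tr_same]; constructor <;> linarith
    · change (tr i₀ (-1) y).2 i₀ < ε
      rw [tr_same]; linarith
  set w : V × (Fin n → ℝ) → ℝ := fun y => χ y * r (tr i₀ (-1) y) with hw
  have hws : ContMDiffOn 𝓘(ℝ, V × (Fin n → ℝ)) 𝓘(ℝ, ℝ) ∞ w (boxDomain n ξ₀ ε i₀) := by
    have hco : Continuous fun y : V × (Fin n → ℝ) => y.2 i₀ := (contDiff_fibre_coord i₀).continuous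
    refine contMDiffOn_of_local fun y hy => ?_
    by_cases h1 : y.2 i₀ < 1 - ε / 2
    · refine ⟨fun _ => 0, {y | y.2 i₀ < 1 - ε / 2}, (isOpen_lt hco continuous_const).mem_nhds h1,
        contMDiffOn_const, fun z hz => ?_⟩
      simp only [hw, hχ0 z (le_of_lt hz.1), zero_mul]
    · refine ⟨w, {y | 1 - ε < y.2 i₀}, (isOpen_lt continuous_const hco).mem_nhds
        (show 1 - ε < y.2 i₀ by linarith), ?_, fun z hz => rfl⟩
      refine (hχs.contDiffOn.mul (hrs.comp (contDiff_tr i₀ (-1)).contDiffOn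
        fun z hz => hback z hz.2 hz.1)).contMDiffOn
  refine ⟨d', fun s y => h s y - toU (w y), ⟨fun s => ?_, fun s t y hy hs ht => ?_⟩, ?_, ?_⟩
  · exact (hh.smooth s).sub (SmoothU1On.coe (hws.mono fun y hy => hy.1))
  · rw [hh.eq s t y hy hs ht]
    abel
  · intro i hi y hy s hs
    -- The correction is periodic in the earlier directions because r is, so the earlier
    -- quasi-periodicity is not disturbed.
    have e1 : w (tr i 1 y) = w y := by
      have hne : i₀ ≠ i := by rintro rfl; omega
      have e2 : χ (tr i 1 y) = χ y := by simp only [hχ, tr_of_ne hne]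
      simp only [hw, e2]
      by_cases h1 : y.2 i₀ ≤ 1 - ε / 2
      · rw [hχ0 y h1, zero_mul, zero_mul]
      · rw [tr_comm, hrp i hi _ (hback y hy (by linarith))]
    dsimp only
    rw [e1, hq i hi y hy s hs, lowRow_congr (hd'1 i hi)]
    abel
  · intro y hy h1 h2 s hs
    have e1 : w y = 0 := by simp only [hw, hχ0 y (by linarith), zero_mul]
    have e2 : w (tr i₀ 1 y) = r y := by
      simp only [hw]
      rw [hχ1 _ (by rw [tr_same]; linarith), tr_tr, add_neg_cancel, tr_zero, one_mul]
    dsimp only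
    rw [e1, e2, hrq y ⟨hy, show y.2 i₀ < ε by linarith⟩ s hs, toU_zero]
    abel

/-- Quasi-periodic extension in the next direction. -/
theorem exists_extension
    (hΩp : ∀ s i (k : ℤ) y, tr i k y ∈ Ω s ↔ y ∈ Ω s)
    (hgp : ∀ s t i (k : ℤ) y, g s t (tr i k y) = g s t y)
    {ξ₀ : V} {ε : ℝ} (hε : 0 < ε) (hε1 : ε ≤ 1 / 4) (i₀ : Fin n)
    {d : Fin n → Fin n → ℤ} {h : σ → V × (Fin n → ℝ) → UnitAddCircle}
    (hh : IsTriv Ω g (boxDomain n ξ₀ ε i₀) h) (hq : IsQuasi Ω (boxDomain n ξ₀ ε i₀) i₀ d h)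
    (hq₀ : ∀ y ∈ boxDomain n ξ₀ ε i₀, y.2 i₀ < ε → ∀ s, y ∈ Ω s →
        h s (tr i₀ 1 y) = h s y - toU (lowRow d i₀ y.2)) :
    ∃ h' : σ → V × (Fin n → ℝ) → UnitAddCircle,
      IsTriv Ω g (boxDomain n ξ₀ ε (i₀ + 1)) h' ∧
      IsQuasi Ω (boxDomain n ξ₀ ε (i₀ + 1)) (i₀ + 1) d h' := by
  set D := boxDomain n ξ₀ ε (i₀ + 1)
  -- The quasi-periodic continuation that is forced on the k-th strip, where the coordinate i₀ lies
  -- in (k - ε, k + 1 + ε).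
  set ψ : ℤ → σ → V × (Fin n → ℝ) → UnitAddCircle := fun k s y =>
    h s (tr i₀ (-k) y) - toU (k * lowRow d i₀ y.2) with hψ
  have hmem : ∀ k : ℤ, ∀ y ∈ D, -ε < y.2 i₀ - k → y.2 i₀ - k < 1 + ε →
      tr i₀ (-k) y ∈ boxDomain n ξ₀ ε i₀ := fun k y hy h1 h2 => by
    refine mem_boxDomain_of_succ (tr_mem_boxDomain_succ (-k) hy) ?_
    rw [tr_same]
    exact ⟨h1, h2⟩
  have hΩk : ∀ (k : ℤ) s y, tr i₀ (-k) y ∈ Ω s ↔ y ∈ Ω s := fun k s y => by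
    simpa using hΩp s i₀ (-k) y
  -- Consecutive strips overlap within ε of k + 1; there the normalized jump relation says exactly
  -- that the two continuations agree.
  have hstep : ∀ k : ℤ, ∀ y ∈ D, -ε < y.2 i₀ - (k + 1) → y.2 i₀ - (k + 1) < ε → ∀ s, y ∈ Ω s →
      ψ (k + 1) s y = ψ k s y := fun k y hy h1 h2 s hs => by
    have h3 := hmem (k + 1) y hy (by push_cast; linarith) (by push_cast; linarith)
    have h4 := hq₀ _ h3 (by rw [tr_same]; push_cast; linarith) s ((hΩk _ s y).2 hs)
    rw [tr_tr, lowRow_tr, if_neg (lt_irrefl _), add_zero] at h4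
    simp only [hψ]
    have h5 : (-((k + 1 : ℤ) : ℝ) + 1) = -(k : ℝ) := by push_cast; ring
    have h6 : ((k + 1 : ℤ) : ℝ) * lowRow d i₀ y.2
        = k * lowRow d i₀ y.2 + lowRow d i₀ y.2 := by push_cast; ring
    rw [h5] at h4
    rw [h4, h6, toU_add]
    abel
  -- The floor makes a definite choice of strip. By `key` every other admissible strip gives the
  -- same value, hence smoothness also where the floor jumps.
  set h' : σ → V × (Fin n → ℝ) → UnitAddCircle := fun s y => ψ ⌊y.2 i₀⌋ s y with hh'
  have key : ∀ k : ℤ, ∀ y ∈ D, -ε < y.2 i₀ - k → y.2 i₀ - k < 1 + ε → ∀ s, y ∈ Ω s →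
      h' s y = ψ k s y := fun k y hy h1 h2 s hs => by
    have f1 := Int.floor_le (y.2 i₀)
    have f2 := Int.lt_floor_add_one (y.2 i₀)
    have c1 : ⌊y.2 i₀⌋ < k + 2 := by
      have : (⌊y.2 i₀⌋ : ℝ) < ((k + 2 : ℤ) : ℝ) := by push_cast; linarith
      exact_mod_cast this
    have c2 : k < ⌊y.2 i₀⌋ + 2 := by
      have : (k : ℝ) < ((⌊y.2 i₀⌋ + 2 : ℤ) : ℝ) := by push_cast; linarith
      exact_mod_cast this
    have c3 : ⌊y.2 i₀⌋ = k ∨ ⌊y.2 i₀⌋ = k + 1 ∨ k = ⌊y.2 i₀⌋ + 1 := by omega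
    simp only [hh']
    rcases c3 with c | c | c
    · rw [c]
    · rw [c] at f1 f2 ⊢
      push_cast at f1 f2
      exact hstep k y hy (by linarith) (by linarith) s hs
    · have c' : (k : ℝ) = ⌊y.2 i₀⌋ + 1 := by rw [c]; push_cast; rfl
      rw [c]
      exact (hstep _ y hy (by linarith) (by linarith) s hs).symm
  have hfl : ∀ y : V × (Fin n → ℝ), -ε < y.2 i₀ - ⌊y.2 i₀⌋ ∧ y.2 i₀ - ⌊y.2 i₀⌋ < 1 + ε :=
    fun y => ⟨by linarith [Int.floor_le (y.2 i₀)], by linarith [Int.lt_floor_add_one (y.2 i₀)]⟩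
  refine ⟨h', ⟨fun s => ?_, fun s t y hy hs ht => ?_⟩, fun i hi y hy s hs => ?_⟩
  · refine SmoothU1On.of_local fun y hy => ?_
    have hco' : Continuous fun z : V × (Fin n → ℝ) => z.2 i₀ - (⌊y.2 i₀⌋ : ℝ) := by fun_prop
    refine ⟨ψ ⌊y.2 i₀⌋ s, {z | -ε < z.2 i₀ - ⌊y.2 i₀⌋} ∩ {z | z.2 i₀ - ⌊y.2 i₀⌋ < 1 + ε},
      ((isOpen_lt continuous_const hco').inter (isOpen_lt hco' continuous_const)).mem_nhds (hfl y),
      ?_, fun z hz => key _ z hz.2.1 hz.1.1 hz.1.2 s hz.2.2⟩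
    refine ((hh.smooth s).comp (contDiff_tr i₀ _).contMDiff.contMDiffOn fun z hz =>
      ⟨hmem _ z hz.2.1 hz.1.1 hz.1.2, (hΩk _ s z).2 hz.2.2⟩).sub (SmoothU1On.coe ?_)
    exact (contDiff_const.mul (contDiff_lowRow d i₀)).contMDiff.contMDiffOn
  · simp only [hh', hψ]
    have e := hh.eq s t _ (hmem _ y hy (hfl y).1 (hfl y).2) ((hΩk _ s y).2 hs) ((hΩk _ t y).2 ht)
    have e2 := hgp s t i₀ (-⌊y.2 i₀⌋) y
    rw [Int.cast_neg] at e2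
    rw [e2] at e
    rw [e]
    abel
  · rcases eq_or_ne i i₀ with rfl | hne
    · simp only [hh', tr_same, Int.floor_add_one, hψ]
      rw [tr_tr, lowRow_tr, if_neg (lt_irrefl _), add_zero]
      have h5 : (1 + -((⌊y.2 i⌋ + 1 : ℤ) : ℝ)) = -(⌊y.2 i⌋ : ℝ) := by push_cast; ring
      have h6 : ((⌊y.2 i⌋ + 1 : ℤ) : ℝ) * lowRow d i y.2
        = ⌊y.2 i⌋ * lowRow d i y.2 + lowRow d i y.2 := by push_cast; ring
      rw [h5, h6, toU_add]
      abel
    · have hlt : (i : ℕ) < i₀ := by have := Fin.val_ne_of_ne hne; omega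
      simp only [hh', tr_of_ne hne.symm, hψ]
      rw [tr_comm, hq i hlt _ (hmem _ y hy (hfl y).1 (hfl y).2) s ((hΩk _ s y).2 hs), lowRow_tr,
        lowRow_tr, if_pos (Fin.lt_def.2 hlt), if_neg (by rw [Fin.lt_def]; omega), add_zero,
        mul_one, mul_add, toU_add]
      -- A unit step in an earlier direction changes the correction term by an integer, which is
      -- invisible in U(1).
      have : toU ((⌊y.2 i₀⌋ : ℝ) * (d i₀ i : ℝ)) = 0 := by
        rw [← Int.cast_mul]; exact toU_int _
      rw [this]
      abel

/-- Classification of smooth `U(1)`-bundles over `W × 𝕋ⁿ`, for a small ball `W`: pulled back to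
`W × ℝⁿ`, such a bundle has a trivialization with standard quasi-periodicity. -/
theorem IsCocycle.exists_quasiPeriodic (hg : IsCocycle Ω g)
    (hΩp : ∀ s i (k : ℤ) y, tr i k y ∈ Ω s ↔ y ∈ Ω s)
    (hgp : ∀ s t i (k : ℤ) y, g s t (tr i k y) = g s t y)
    {W : Set V} (hW : IsOpen W) {ξ₀ : V} (hξ₀ : ξ₀ ∈ W)
    (hc : ∀ ξ ∈ W, ∀ v, ∃ s, (ξ, v) ∈ Ω s) :
    ∃ ε > 0, Metric.ball ξ₀ ε ⊆ W ∧ ∃ (d : Fin n → Fin n → ℤ)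
      (h : σ → V × (Fin n → ℝ) → UnitAddCircle),
      IsTriv Ω g (Metric.ball ξ₀ ε ×ˢ Set.univ) h ∧
      ∀ (i : Fin n) y, y.1 ∈ Metric.ball ξ₀ ε → ∀ s, y ∈ Ω s →
        h s (tr i 1 y) = h s y - toU (lowRow d i y.2) := by
  obtain ⟨ε₁, hε₁, hball⟩ := Metric.isOpen_iff.1 hW ξ₀ hξ₀
  -- Induction on the number j of unbounded directions, starting from a neighbourhood of the cube.
  -- Each step costs a factor 4 in ε, because the normalized jump is available only within ε/4 of
  -- the lower face.
  have hind : ∀ j ≤ n, ∃ ε > 0, ε ≤ 1 ∧ Metric.ball ξ₀ ε ⊆ W ∧ ∃ (d : Fin n → Fin n → ℤ)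
      (h : σ → V × (Fin n → ℝ) → UnitAddCircle), IsTriv Ω g (boxDomain n ξ₀ ε j) h ∧
        IsQuasi Ω (boxDomain n ξ₀ ε j) j d h := by
    intro j
    induction j with
    | zero =>
      intro _
      obtain ⟨ε₀, hε₀, h, hh⟩ := hg.exists_triv_box ξ₀ (hc ξ₀ hξ₀)
      refine ⟨min ε₀ (min ε₁ 1), lt_min hε₀ (lt_min hε₁ one_pos), (min_le_right _ _).trans
        (min_le_right _ _), (Metric.ball_subset_ball ((min_le_right _ _).trans
        (min_le_left _ _))).trans hball, 0, h, hh.mono fun y hy => ?_, fun i hi => by omega⟩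
      have hy' := boxDomain_mono ξ₀ (min_le_left ε₀ (min ε₁ 1)) 0 hy
      exact ⟨hy'.1, fun i => hy'.2 i (Nat.zero_le _)⟩
    | succ j ih =>
      intro hj
      obtain ⟨ε, hε, hε1, hεW, d, h, hh, hq⟩ := ih (by omega)
      obtain ⟨d', h', hh', hq', hq₀⟩ := hg.exists_normalized hΩp hgp hε hε1 ⟨j, hj⟩
        (fun y hy => hc y.1 (hεW hy) y.2) hh hq
      have hsub : boxDomain n ξ₀ (ε / 4) j ⊆ boxDomain n ξ₀ ε j :=
        boxDomain_mono ξ₀ (by linarith) j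
      obtain ⟨h'', hh'', hq''⟩ := exists_extension hΩp hgp (ε := ε / 4) (by linarith)
        (by linarith) ⟨j, hj⟩ (hh'.mono hsub) (fun i hi y hy => hq' i hi y (hsub hy))
        (fun y hy hlt => hq₀ y (hsub hy) hlt (hy.2 _ le_rfl).1)
      exact ⟨ε / 4, by linarith, by linarith, (Metric.ball_subset_ball (by linarith)).trans hεW,
        d', h'', hh'', hq''⟩
  obtain ⟨ε, hε, -, hεW, d, h, hh, hq⟩ := hind n le_rfl
  have hD : ∀ y : V × (Fin n → ℝ), y.1 ∈ Metric.ball ξ₀ ε → y ∈ boxDomain n ξ₀ ε n :=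
    fun y hy => ⟨hy, fun i hi => by have := i.2; omega⟩
  exact ⟨ε, hε, hεW, d, h, hh.mono fun y hy => hD y hy.1,
    fun i y hy s hs => hq i i.2 y (hD y hy) s hs⟩

end QuasiPeriodic

/-! ### Means of periodic functions over the unit cube -/

section Mean

open MeasureTheory

variable {n : ℕ}

/-- The unit cube `[0,1)ⁿ`. -/
def unitCube (n : ℕ) : Set (Fin n → ℝ) := Set.pi Set.univ fun _ => Set.Ico 0 1

theorem measurableSet_unitCube : MeasurableSet (unitCube n) :=
  MeasurableSet.univ_pi fun _ => measurableSet_Ico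

theorem volume_unitCube : volume (unitCube n) = 1 := by
  simp [unitCube, volume_pi, Measure.pi_pi]

theorem unitCube_subset : unitCube n ⊆ Set.Icc 0 1 := fun _ hv =>
  ⟨fun i => (hv i trivial).1, fun i => (hv i trivial).2.le⟩

/-- `ℤⁿ`-periodicity. -/
def IsPeriodic (R : (Fin n → ℝ) → ℝ) : Prop := ∀ i v, R (v + Pi.single i 1) = R v

/-- The mean of a function over the unit cube. -/
noncomputable def mean (R : (Fin n → ℝ) → ℝ) : ℝ := ∫ v in unitCube n, R v

theorem integrableOn_unitCube {R : (Fin n → ℝ) → ℝ} (hR : Continuous R) :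
    IntegrableOn R (unitCube n) :=
  (hR.continuousOn.integrableOn_compact isCompact_Icc).mono_set unitCube_subset

theorem mean_add {R S : (Fin n → ℝ) → ℝ} (hR : Continuous R) (hS : Continuous S) :
    mean (fun v => R v + S v) = mean R + mean S :=
  integral_add (integrableOn_unitCube hR) (integrableOn_unitCube hS)

theorem mean_neg (R : (Fin n → ℝ) → ℝ) : mean (fun v => - R v) = - mean R := integral_neg _

theorem mean_const (c : ℝ) : mean (fun _ : Fin n → ℝ => c) = c := by
  simp [mean, Measure.real, volume_unitCube]

theorem IsPeriodic.add {R S : (Fin n → ℝ) → ℝ} (hR : IsPeriodic R) (hS : IsPeriodic S) :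
    IsPeriodic (fun v => R v + S v) := fun i v => by dsimp only; rw [hR, hS]

theorem IsPeriodic.neg {R : (Fin n → ℝ) → ℝ} (hR : IsPeriodic R) :
    IsPeriodic (fun v => - R v) := fun i v => by dsimp only; rw [hR]

theorem IsPeriodic.shift {R : (Fin n → ℝ) → ℝ} (hR : IsPeriodic R) (a : Fin n → ℝ) :
    IsPeriodic (fun v => R (v + a)) := fun i v => by
  dsimp only; rw [add_right_comm, hR]

/-- The unit cube and its translate are both fundamental domains of the lattice ℤⁿ, and an invariant
function has the same integral over each of them. -/
theorem mean_shift {R : (Fin n → ℝ) → ℝ} (hR : IsPeriodic R) (a : Fin n → ℝ) :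
    mean (fun v => R (v + a)) = mean R := by
  set b := Pi.basisFun ℝ (Fin n)
  have hcube : unitCube n = ZSpan.fundamentalDomain b := (ZSpan.fundamentalDomain_pi_basisFun).symm
  have hinv : ∀ w ∈ Submodule.span ℤ (Set.range b), ∀ v, R (v + w) = R v := by
    intro w hw
    induction hw using Submodule.span_induction with
    | mem x hx =>
      obtain ⟨i, rfl⟩ := hx
      intro v
      rw [Pi.basisFun_apply]
      exact hR i v
    | zero => simp
    | add x y _ _ hx hy => intro v; rw [← add_assoc, hy, hx]
    | smul k x _ hx =>
      intro v
      have hp : Function.Periodic R x := hx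
      exact hp.zsmul k v
  have : Countable (Submodule.span ℤ (Set.range b)).toAddSubgroup :=
    inferInstanceAs (Countable (Submodule.span ℤ (Set.range b)))
  have h1 := ZSpan.isAddFundamentalDomain' b volume
  have h2 := h1.vadd_of_comm a
  have h3 := h1.setIntegral_eq h2 (f := R) (fun g v => by
    change R ((g : Fin n → ℝ) + v) = R v
    rw [add_comm]
    exact hinv _ g.2 v)
  rw [mean, mean, hcube, h3]
  have h4 := (measurePreserving_add_right (volume : Measure (Fin n → ℝ)) a).setIntegral_image_emb
    (measurableEmbedding_addRight a) R (ZSpan.fundamentalDomain b)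
  rw [← h4]
  congr 2
  ext v
  simp only [Set.mem_vadd_set, Set.mem_image, vadd_eq_add, add_comm]

/-- The mean over the unit cube depends smoothly on parameters. -/
theorem contDiffOn_mean {V : Type*} [NormedAddCommGroup V] [NormedSpace ℝ V] {N : Set V}
    (hN : IsOpen N) {R : V → (Fin n → ℝ) → ℝ}
    (hR : ContDiffOn ℝ ∞ (fun y : V × (Fin n → ℝ) => R y.1 y.2) (N ×ˢ Set.univ)) :
    ContDiffOn ℝ ∞ (fun ξ => mean (R ξ)) N := by
  -- The mean is the value at 0 of the convolution of the indicator of the cube with w ↦ φ(w) R(-w).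
  -- The bump is 1 on the reflected cube and supplies the compact support needed for smoothness in
  -- the parameter.
  let φ : ContDiffBump (0 : Fin n → ℝ) := ⟨2, 3, by norm_num, by norm_num⟩
  set g : V → (Fin n → ℝ) → ℝ := fun ξ w => φ w * R ξ (-w) with hg
  have hgs : ContDiffOn ℝ ∞ ↿g (N ×ˢ Set.univ) := by
    refine ContDiffOn.mul (φ.contDiff.comp contDiff_snd).contDiffOn ?_
    exact hR.comp (contDiff_fst.prodMk contDiff_snd.neg).contDiffOn fun y hy => ⟨hy.1, trivial⟩
  have key := contDiffOn_convolution_right_with_param_comp (μ := volume) (n := ⊤)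
    (ContinuousLinearMap.mul ℝ ℝ) (v := fun _ : V => (0 : Fin n → ℝ)) contDiffOn_const
    (f := (unitCube n).indicator fun _ => (1 : ℝ)) (g := g) hN
    (isCompact_closedBall (0 : Fin n → ℝ) 3)
    (fun ξ w _ hw => by
      have : φ w = 0 := φ.zero_of_le_dist (by
        rw [Metric.mem_closedBall, not_le] at hw
        exact hw.le)
      simp [hg, this])
    (by
      refine IntegrableOn.integrable_indicator ?_ measurableSet_unitCube |>.locallyIntegrable
      exact integrableOn_unitCube continuous_const) hgs
  refine key.congr fun ξ _ => ?_
  rw [MeasureTheory.convolution, mean, ← integral_indicator measurableSet_unitCube]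
  refine integral_congr_ae (Filter.Eventually.of_forall fun v => ?_)
  by_cases hv : v ∈ unitCube n
  · have h1 : φ (-v) = 1 := φ.one_of_mem_closedBall (by
      rw [mem_closedBall_zero_iff, norm_neg]
      refine (pi_norm_le_iff_of_nonneg (by norm_num)).2 fun i => ?_
      have := hv i trivial
      rw [Real.norm_eq_abs, abs_le]
      constructor <;> linarith [this.1, this.2])
    simp [hv, hg, h1]
  · simp [hv]

end Mean

/-! ### Linear part, periodic part and constant part -/

section LinearForm

variable {n : ℕ}

/-- `q(v) = λ · v + R(v) + e` for a periodic function `R` of mean zero. -/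
def HasForm (q : (Fin n → ℝ) → UnitAddCircle) (l : Fin n → ℝ) (e : UnitAddCircle) : Prop :=
  ∃ R : (Fin n → ℝ) → ℝ, Continuous R ∧ IsPeriodic R ∧ mean R = 0 ∧ ∀ v, q v = toU (l ⬝ᵥ v + R v) + e

/-- The difference of two representations is a continuous integer-valued function, hence constant.
Comparing 0 with a unit vector identifies the linear parts; taking means then identifies the
constants. Mean zero is what pins down e. -/
theorem HasForm.unique {q : (Fin n → ℝ) → UnitAddCircle} {l l' : Fin n → ℝ} {e e' : UnitAddCircle}
    (h : HasForm q l e) (h' : HasForm q l' e') : l = l' ∧ e = e' := by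
  obtain ⟨R, hR, hRp, hRm, hq⟩ := h
  obtain ⟨R', hR', hRp', hRm', hq'⟩ := h'
  obtain ⟨c, hc⟩ := toU_surjective (e' - e)
  have hcont : Continuous fun v => l ⬝ᵥ v + R v - (l' ⬝ᵥ v + R' v) - c :=
    (((continuous_const.dotProduct continuous_id).add hR).sub
      ((continuous_const.dotProduct continuous_id).add hR')).sub continuous_const
  obtain ⟨k, hk⟩ := exists_int_of_toU_eq isPreconnected_univ hcont.continuousOn (fun v _ => by
    have := hq v
    rw [hq' v] at this
    rw [toU_sub, toU_sub, hc]
    linear_combination (norm := abel) -this)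
  have hl : l = l' := by
    funext i
    have h0 := hk 0 trivial
    have h1 := hk (0 + Pi.single i 1) trivial
    rw [hRp, hRp'] at h1
    simp only [dotProduct_zero, zero_add, dotProduct_single, mul_one] at h0 h1
    linarith
  refine ⟨hl, ?_⟩
  subst hl
  have h2 : R = fun v => R' v + (c + k) := by
    funext v
    have := hk v trivial
    linarith
  have h3 : mean R = mean R' + (c + k) := by
    rw [h2, mean_add hR' continuous_const, mean_const]
  rw [hRm, hRm'] at h3
  have h4 : e' - e = toU (-k : ℝ) := by rw [← hc]; congr 1; linarith
  rw [toU_neg, toU_int, neg_zero, sub_eq_zero] at h4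
  exact h4.symm

theorem HasForm.add {q q' : (Fin n → ℝ) → UnitAddCircle} {l l' : Fin n → ℝ} {e e' : UnitAddCircle}
    (h : HasForm q l e) (h' : HasForm q' l' e') : HasForm (fun v => q v + q' v) (l + l') (e + e') := by
  obtain ⟨R, hR, hRp, hRm, hq⟩ := h
  obtain ⟨R', hR', hRp', hRm', hq'⟩ := h'
  refine ⟨fun v => R v + R' v, hR.add hR', hRp.add hRp', by rw [mean_add hR hR', hRm, hRm', add_zero], fun v => ?_⟩
  simp only [hq v, hq' v, add_dotProduct, toU_add]
  abel

theorem HasForm.neg {q : (Fin n → ℝ) → UnitAddCircle} {l : Fin n → ℝ} {e : UnitAddCircle}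
    (h : HasForm q l e) : HasForm (fun v => - q v) (-l) (-e) := by
  obtain ⟨R, hR, hRp, hRm, hq⟩ := h
  refine ⟨fun v => - R v, hR.neg, hRp.neg, by rw [mean_neg, hRm, neg_zero], fun v => ?_⟩
  simp only [hq v, neg_dotProduct, toU_add, toU_neg]
  abel

/-- Translation preserves the mean of the periodic part, so only the linear part contributes to the
constant. -/
theorem HasForm.shift {q : (Fin n → ℝ) → UnitAddCircle} {l : Fin n → ℝ} {e : UnitAddCircle}
    (h : HasForm q l e) (a : Fin n → ℝ) : HasForm (fun v => q (v + a)) l (e + toU (l ⬝ᵥ a)) := by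
  obtain ⟨R, hR, hRp, hRm, hq⟩ := h
  refine ⟨_, hR.comp (continuous_add_const a), hRp.shift a, by rw [← hRm]; exact mean_shift hRp a,
    fun v => ?_⟩
  simp only [hq (v + a), dotProduct_add, toU_add, Function.comp_apply]
  abel

theorem hasForm_affine (l : Fin n → ℝ) (e : UnitAddCircle) :
    HasForm (fun v => toU (l ⬝ᵥ v) + e) l e :=
  ⟨fun _ => 0, continuous_const, fun _ _ => rfl, mean_const 0, fun v => by simp⟩

/-- The form of a smooth function with affine differences, with smooth dependence on parameters. -/
theorem exists_hasForm {V : Type*} [NormedAddCommGroup V] [NormedSpace ℝ V] {N : Set V}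
    (hN : IsOpen N) (hconv : Convex ℝ N) {q : V × (Fin n → ℝ) → UnitAddCircle}
    (hq : SmoothU1On 𝓘(ℝ, V × (Fin n → ℝ)) q (N ×ˢ Set.univ)) {b : Fin n → V → ℝ}
    (hb : ∀ i, ContDiffOn ℝ ∞ (b i) N)
    (h : ∀ i y, y.1 ∈ N → q (tr i 1 y) = q y + toU (b i y.1)) :
    ∃ (l : V → (Fin n → ℝ)) (e : V → UnitAddCircle), ContDiffOn ℝ ∞ l N ∧ SmoothU1On 𝓘(ℝ, V) e N ∧
      (∀ ξ ∈ N, HasForm (fun v => q (ξ, v)) (l ξ) (e ξ)) ∧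
      ∀ i, ∃ k : ℤ, ∀ ξ ∈ N, l ξ i = b i ξ + k := by
  have hNc : Convex ℝ (N ×ˢ (Set.univ : Set (Fin n → ℝ))) := hconv.prod convex_univ
  obtain ⟨r, hr, hre⟩ := hq.exists_lift_of_convex hNc
  have hper : ∀ i, ∃ k : ℤ, ∀ y ∈ N ×ˢ (Set.univ : Set (Fin n → ℝ)),
      r (tr i 1 y) - r y - b i y.1 = k := fun i => by
    refine exists_int_of_toU_eq hNc.isPreconnected ?_ fun y hy => ?_
    · refine ((hr.continuousOn.comp (contDiff_tr i 1).continuous.continuousOn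
        fun y hy => ⟨hy.1, trivial⟩).sub hr.continuousOn).sub
        ((hb i).continuousOn.comp continuous_fst.continuousOn fun y hy => hy.1)
    · rw [toU_sub, toU_sub, hre y hy, hre (tr i 1 y) ⟨hy.1, trivial⟩, h i y hy.1]
      abel
  choose k hk using hper
  -- The slope is the actual difference of the real lift r: the prescribed b up to the integers k.
  -- Subtracting it leaves a periodic function, whose mean becomes e.
  set l : V → (Fin n → ℝ) := fun ξ i => b i ξ + k i with hl
  have hls : ContDiffOn ℝ ∞ l N := contDiffOn_pi.2 fun i => (hb i).add contDiffOn_const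
  set R : V → (Fin n → ℝ) → ℝ := fun ξ v => r (ξ, v) - l ξ ⬝ᵥ v with hR
  have hRs : ContDiffOn ℝ ∞ (fun y : V × (Fin n → ℝ) => R y.1 y.2) (N ×ˢ Set.univ) := by
    refine hr.sub (ContDiffOn.sum fun i _ => ?_)
    refine ContDiffOn.mul ?_ (contDiff_fibre_coord i).contDiffOn
    exact ((hb i).add contDiffOn_const).comp contDiff_fst.contDiffOn fun y hy => hy.1
  have hRc : ∀ ξ ∈ N, Continuous (R ξ) := fun ξ hξ => by
    have := hRs.continuousOn.comp (Continuous.prodMk_right ξ).continuousOn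
      (s := Set.univ) fun v _ => ⟨hξ, trivial⟩
    exact continuousOn_univ.1 this
  have hRp : ∀ ξ ∈ N, IsPeriodic (R ξ) := fun ξ hξ i v => by
    have := hk i (ξ, v) ⟨hξ, trivial⟩
    simp only [tr] at this
    simp only [hR, dotProduct_add, dotProduct_single, mul_one]
    simp only [hl]
    linarith
  have hms := contDiffOn_mean hN hRs
  refine ⟨l, fun ξ => toU (mean (R ξ)), hls, SmoothU1On.coe hms.contMDiffOn, fun ξ hξ => ?_,
    fun i => ⟨k i, fun ξ _ => rfl⟩⟩
  refine ⟨fun v => R ξ v + -mean (R ξ), (hRc ξ hξ).add continuous_const,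
    (hRp ξ hξ).add fun _ _ => rfl, ?_, fun v => ?_⟩
  · rw [mean_add (hRc ξ hξ) continuous_const, mean_const, add_neg_cancel]
  · dsimp only
    rw [← hre (ξ, v) ⟨hξ, trivial⟩, ← toU_add]
    congr 1
    simp only [hR]
    ring

theorem lowRow_zero (c : Fin n → Fin n → ℤ) (i : Fin n) : lowRow c i 0 = 0 := by simp [lowRow]

theorem lowRow_single (c : Fin n → Fin n → ℤ) (i p : Fin n) :
    lowRow c i (Pi.single p 1) = if p < i then (c i p : ℝ) else 0 := by
  have := lowRow_tr c i p 1 ((0 : ℝ), (0 : Fin n → ℝ))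
  simpa [tr, lowRow_zero] using this

/-- A function on `ℝⁿ` cannot have linear differences given by a nonzero strictly lower triangular
matrix. -/
theorem lowRow_eq_zero_of_differences {q : (Fin n → ℝ) → UnitAddCircle} (hq : Continuous q)
    {c : Fin n → Fin n → ℤ} {w : Fin n → ℝ}
    (h : ∀ i v, q (v + Pi.single i 1) = q v + toU (lowRow c i v + w i)) {i p : Fin n} (hp : p < i) :
    c i p = 0 := by
  obtain ⟨r, hr, hre⟩ := exists_lift_of_convex convex_univ hq.continuousOn
  have hr' : Continuous r := continuousOn_univ.1 hr
  have hc : ∀ i, Continuous (lowRow c i) := fun i => by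
    refine continuous_finsetSum _ fun q _ => ?_
    split_ifs <;> fun_prop
  have hper : ∀ i, ∃ k : ℤ, ∀ v, r (v + Pi.single i 1) - r v - (lowRow c i v + w i) = k := fun i => by
    obtain ⟨k, hk⟩ := exists_int_of_toU_eq isPreconnected_univ
      (g := fun v => r (v + Pi.single i 1) - r v - (lowRow c i v + w i))
      (Continuous.continuousOn (((hr'.comp (continuous_add_const (Pi.single i 1))).sub hr').sub
        ((hc i).add (continuous_const (y := w i))))) (fun v _ => by
      rw [toU_sub, toU_sub, hre _ trivial, hre _ trivial, h]
      abel)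
    exact ⟨k, fun v => hk v trivial⟩
  obtain ⟨ki, hi⟩ := hper i
  obtain ⟨kp, hpp⟩ := hper p
  -- Walking from 0 to the sum of the two unit vectors along either side of the square must give the
  -- same increment of r. The two ways differ by the entry c i p only.
  have e1 := hi (Pi.single p 1)
  have e2 := hpp 0
  have e3 := hpp (Pi.single i 1)
  have e4 := hi 0
  rw [lowRow_single, if_pos hp] at e1
  rw [lowRow_single, if_neg hp.not_gt, add_comm (Pi.single i 1)] at e3
  rw [lowRow_zero, zero_add] at e2 e4
  have : (c i p : ℝ) = 0 := by linarith
  exact_mod_cast this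

end LinearForm

/-! ### Transport of the local results to the manifold -/

section Charts

variable {d n : ℕ} {X : Type u} [TopologicalSpace X] [ChartedSpace (EuclideanSpace ℝ (Fin d)) X]

/-- The model with corners of `X × ℝⁿ`. -/
noncomputable abbrev prodModel (d n : ℕ) := (𝓡 d).prod 𝓘(ℝ, Fin n → ℝ)

theorem contMDiff_base : ContMDiff (prodModel d n) (𝓡 d) ∞ (fun q : X × (Fin n → ℝ) => q.1) :=
  contMDiff_fst

theorem contMDiff_fibre : ContMDiff (prodModel d n) 𝓘(ℝ, Fin n → ℝ) ∞
    (fun q : X × (Fin n → ℝ) => q.2) :=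
  contMDiff_snd

variable (d) in
/-- The map `X × ℝⁿ → V × ℝⁿ` given by a chart of `X`. -/
noncomputable def chartProd (x₀ : X) (q : X × (Fin n → ℝ)) : EuclideanSpace ℝ (Fin d) × (Fin n → ℝ) :=
  (extChartAt (𝓡 d) x₀ q.1, q.2)

variable (d) in
/-- The map `V × ℝⁿ → X × ℝⁿ` given by a chart of `X`. -/
noncomputable def chartProdSymm (x₀ : X) (y : EuclideanSpace ℝ (Fin d) × (Fin n → ℝ)) :
    X × (Fin n → ℝ) := ((extChartAt (𝓡 d) x₀).symm y.1, y.2)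

theorem tr_chartProdSymm (x₀ : X) (i : Fin n) (c : ℝ)
    (y : EuclideanSpace ℝ (Fin d) × (Fin n → ℝ)) :
    chartProdSymm d x₀ (tr i c y) = tr i c (chartProdSymm d x₀ y) := rfl

theorem chartProdSymm_chartProd {x₀ : X} {q : X × (Fin n → ℝ)}
    (h : q.1 ∈ (extChartAt (𝓡 d) x₀).source) : chartProdSymm d x₀ (chartProd d x₀ q) = q :=
  Prod.ext ((extChartAt (𝓡 d) x₀).left_inv h) rfl

variable [IsManifold (𝓡 d) ∞ X]

theorem contMDiffOn_chartProd (x₀ : X) :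
    ContMDiffOn (prodModel d n) 𝓘(ℝ, EuclideanSpace ℝ (Fin d) × (Fin n → ℝ)) ∞
      (chartProd d (n := n) x₀) {q | q.1 ∈ (extChartAt (𝓡 d) x₀).source} := by
  refine ContMDiffOn.prodMk_space ?_ contMDiff_fibre.contMDiffOn
  refine (contMDiffOn_extChartAt (I := 𝓡 d) (x := x₀)).comp contMDiff_base.contMDiffOn fun q hq => ?_
  rwa [Set.mem_ofPred_eq, extChartAt_source] at hq

theorem contMDiffOn_chartProdSymm (x₀ : X) :
    ContMDiffOn 𝓘(ℝ, EuclideanSpace ℝ (Fin d) × (Fin n → ℝ)) (prodModel d n) ∞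
      (chartProdSymm d (n := n) x₀) {y | y.1 ∈ (extChartAt (𝓡 d) x₀).target} := by
  refine ContMDiffOn.prodMk ?_ contDiff_snd.contMDiff.contMDiffOn
  exact (contMDiffOn_extChartAt_symm x₀).comp contDiff_fst.contMDiff.contMDiffOn fun y hy => hy

/-- The local classification of smooth `U(1)`-bundles over `X × 𝕋ⁿ`. -/
theorem exists_local_trivialization {σ : Type*} {Ω : σ → Set (X × (Fin n → ℝ))}
    {g : σ → σ → X × (Fin n → ℝ) → UnitAddCircle} {O : Set X} (hO : IsOpen O) {x₀ : X} (hx₀ : x₀ ∈ O)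
    (hΩ : ∀ s, IsOpen (Ω s))
    (hg : ∀ s t, SmoothU1On (prodModel d n) (g s t) (Ω s ∩ Ω t))
    (hadd : ∀ s t v y, y ∈ Ω s → y ∈ Ω t → y ∈ Ω v → g s t y + g t v y = g s v y)
    (hΩp : ∀ s i (k : ℤ) y, tr i k y ∈ Ω s ↔ y ∈ Ω s)
    (hgp : ∀ s t i (k : ℤ) y, g s t (tr i k y) = g s t y)
    (hc : ∀ x ∈ O, ∀ v, ∃ s, (x, v) ∈ Ω s) :
    ∃ W : Set X, IsOpen W ∧ x₀ ∈ W ∧ W ⊆ O ∧ ∃ (c : Fin n → Fin n → ℤ)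
      (h : σ → X × (Fin n → ℝ) → UnitAddCircle),
      (∀ s, SmoothU1On (prodModel d n) (h s) {q | q.1 ∈ W ∧ q ∈ Ω s}) ∧
      (∀ s t q, q.1 ∈ W → q ∈ Ω s → q ∈ Ω t → g s t q = h t q - h s q) ∧
      ∀ (i : Fin n) q, q.1 ∈ W → ∀ s, q ∈ Ω s →
        h s (tr i 1 q) = h s q - toU (lowRow c i q.2) := by
  set φ := extChartAt (𝓡 d) x₀ with hφ
  have hΦ := contMDiffOn_chartProdSymm (d := d) (n := n) x₀
  have hT : IsOpen {y : EuclideanSpace ℝ (Fin d) × (Fin n → ℝ) | y.1 ∈ φ.target} :=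
    (isOpen_extChartAt_target (I := 𝓡 d) x₀).preimage continuous_fst
  set Ω' : σ → Set (EuclideanSpace ℝ (Fin d) × (Fin n → ℝ)) := fun s =>
    {y | y.1 ∈ φ.target} ∩ chartProdSymm d x₀ ⁻¹' Ω s with hΩ'
  have hcoc : IsCocycle Ω' (fun s t y => g s t (chartProdSymm d x₀ y)) := by
    refine ⟨fun s => hΦ.continuousOn.isOpen_inter_preimage hT (hΩ s), fun s t => ?_, ?_⟩
    · exact (hg s t).comp (hΦ.mono fun y hy => hy.1.1) fun y hy => ⟨hy.1.2, hy.2.2⟩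
    · intro s t v y hs ht hv
      exact hadd s t v _ hs.2 ht.2 hv.2
  have hW : IsOpen (φ.target ∩ φ.symm ⁻¹' O) :=
    (continuousOn_extChartAt_symm x₀).isOpen_inter_preimage (isOpen_extChartAt_target (I := 𝓡 d) x₀) hO
  obtain ⟨ε, hε, hsub, c, h, hh, hqp⟩ := hcoc.exists_quasiPeriodic (V := EuclideanSpace ℝ (Fin d))
    (fun s i k y => by
      change (_ ∧ _) ↔ (_ ∧ _)
      rw [Set.mem_preimage, Set.mem_preimage, tr_chartProdSymm, hΩp]
      exact Iff.rfl)
    (fun s t i k y => by rw [tr_chartProdSymm, hgp]) hW (ξ₀ := φ x₀)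
    ⟨mem_extChartAt_target x₀, by
      rw [Set.mem_preimage, hφ, extChartAt_to_inv]; exact hx₀⟩
    (fun ξ hξ v => by
      obtain ⟨s, hs⟩ := hc _ hξ.2 v
      exact ⟨s, hξ.1, hs⟩)
  set W : Set X := φ.source ∩ φ ⁻¹' Metric.ball (φ x₀) ε with hWdef
  have hWo : IsOpen W := (continuousOn_extChartAt x₀).isOpen_inter_preimage
    (isOpen_extChartAt_source x₀) Metric.isOpen_ball
  have hin : ∀ q : X × (Fin n → ℝ), q.1 ∈ W → ∀ s, q ∈ Ω s → chartProd d x₀ q ∈ Ω' s :=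
    fun q hq s hs => by
      refine ⟨φ.map_source hq.1, ?_⟩
      rw [Set.mem_preimage, chartProdSymm_chartProd hq.1]
      exact hs
  refine ⟨W, hWo, ⟨mem_extChartAt_source x₀, Metric.mem_ball_self hε⟩, fun x hx => ?_, c,
    fun s q => h s (chartProd d x₀ q), fun s => ?_, fun s t q hq hs ht => ?_, fun i q hq s hs => ?_⟩
  · have := (hsub hx.2).2
    rwa [Set.mem_preimage, φ.left_inv hx.1] at this
  · have hΨ : ContMDiffOn (prodModel d n) 𝓘(ℝ, EuclideanSpace ℝ (Fin d) × (Fin n → ℝ)) ∞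
        (chartProd d x₀) {q : X × (Fin n → ℝ) | q.1 ∈ W ∧ q ∈ Ω s} :=
      (contMDiffOn_chartProd x₀).mono fun q hq => hq.1.1
    exact SmoothU1On.comp (hh.smooth s) hΨ
      fun q hq => ⟨⟨hq.1.2, trivial⟩, hin q hq.1 s hq.2⟩
  · have hm : chartProd d x₀ q ∈ Metric.ball (φ x₀) ε ×ˢ (Set.univ : Set (Fin n → ℝ)) :=
      Set.mk_mem_prod hq.2 trivial
    have e := hh.eq s t (chartProd d x₀ q) hm (hin q hq s hs) (hin q hq t ht)
    rw [chartProdSymm_chartProd hq.1] at e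
    exact e
  · exact hqp i (chartProd d x₀ q) hq.2 s (hin q hq s hs)

/-- The chart changes the base coordinate only, while `HasForm` concerns one fibre at a time, so
`exists_hasForm` carries over. -/
theorem exists_local_hasForm {O : Set X} (hO : IsOpen O) {x₀ : X} (hx₀ : x₀ ∈ O)
    {q : X × (Fin n → ℝ) → UnitAddCircle}
    (hq : SmoothU1On (prodModel d n) q {y | y.1 ∈ O}) {b : Fin n → X → ℝ}
    (hb : ∀ i, ContMDiffOn (𝓡 d) 𝓘(ℝ, ℝ) ∞ (b i) O)
    (h : ∀ i y, y.1 ∈ O → q (tr i 1 y) = q y + toU (b i y.1)) :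
    ∃ W : Set X, IsOpen W ∧ x₀ ∈ W ∧ W ⊆ O ∧ ∃ (l : X → (Fin n → ℝ)) (e : X → UnitAddCircle),
      ContMDiffOn (𝓡 d) 𝓘(ℝ, Fin n → ℝ) ∞ l W ∧ SmoothU1On (𝓡 d) e W ∧
      (∀ x ∈ W, HasForm (fun v => q (x, v)) (l x) (e x)) ∧
      ∀ i, ∃ k : ℤ, ∀ x ∈ W, l x i = b i x + k := by
  set φ := extChartAt (𝓡 d) x₀ with hφ
  have hW : IsOpen (φ.target ∩ φ.symm ⁻¹' O) :=
    (continuousOn_extChartAt_symm x₀).isOpen_inter_preimage (isOpen_extChartAt_target (I := 𝓡 d) x₀) hO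
  obtain ⟨ε, hε, hsub⟩ := Metric.isOpen_iff.1 hW (φ x₀) ⟨mem_extChartAt_target x₀, by
      rw [Set.mem_preimage, hφ, extChartAt_to_inv]; exact hx₀⟩
  obtain ⟨l, e, hl, he, hf, hk⟩ := exists_hasForm (V := EuclideanSpace ℝ (Fin d))
    (q := fun y => q (chartProdSymm d x₀ y)) (b := fun i ξ => b i (φ.symm ξ))
    Metric.isOpen_ball (convex_ball (φ x₀) ε)
    (hq.comp ((contMDiffOn_chartProdSymm x₀).mono fun y hy => (hsub hy.1).1)
      fun y hy => (hsub hy.1).2)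
    (fun i => ((hb i).comp ((contMDiffOn_extChartAt_symm x₀).mono fun ξ hξ => (hsub hξ).1)
      fun ξ hξ => (hsub hξ).2).contDiffOn)
    (fun i y hy => by rw [tr_chartProdSymm]; exact h i _ (hsub hy).2)
  set W : Set X := φ.source ∩ φ ⁻¹' Metric.ball (φ x₀) ε with hWdef
  have hWo : IsOpen W := (continuousOn_extChartAt x₀).isOpen_inter_preimage
    (isOpen_extChartAt_source x₀) Metric.isOpen_ball
  have hφs : ContMDiffOn (𝓡 d) 𝓘(ℝ, EuclideanSpace ℝ (Fin d)) ∞ φ W :=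
    (contMDiffOn_extChartAt (I := 𝓡 d) (x := x₀)).mono fun x hx => by
      rw [← extChartAt_source (𝓡 d)]; exact hx.1
  refine ⟨W, hWo, ⟨mem_extChartAt_source x₀, Metric.mem_ball_self hε⟩, fun x hx => ?_,
    fun x => l (φ x), fun x => e (φ x), ?_, ?_, fun x hx => ?_, fun i => ?_⟩
  · have := (hsub hx.2).2
    rwa [Set.mem_preimage, φ.left_inv hx.1] at this
  · exact hl.contMDiffOn.comp hφs fun x hx => hx.2
  · exact he.comp hφs fun x hx => hx.2
  · have := hf (φ x) hx.2
    simp only [chartProdSymm] at this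
    rwa [show (extChartAt (𝓡 d) x₀).symm (φ x) = x from φ.left_inv hx.1] at this
  · obtain ⟨k, hk⟩ := hk i
    refine ⟨k, fun x hx => ?_⟩
    have := hk (φ x) hx.2
    rwa [φ.left_inv hx.1] at this

end Charts

/-! ### Topology and smoothness on the total space -/

section Total

variable {d n : ℕ} {X : Type u} [TopologicalSpace X] [ChartedSpace (EuclideanSpace ℝ (Fin d)) X]

namespace TDCocycle

variable (C : TDCocycle d n X)

open Classical in
/-- The point `[i, x, b]` of the total space (with a junk point over `x` if `x ∉ U i`). -/
noncomputable def point (i : C.ι) (x : X) (b : Torus n) : C.Total :=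
  if h : x ∈ C.U i then C.pt i ⟨x, h⟩ b else C.pt (C.cover x).choose ⟨x, (C.cover x).choose_spec⟩ b

variable {C}

theorem point_of_mem {i : C.ι} {x : X} (h : x ∈ C.U i) (b : Torus n) :
    C.point i x b = C.pt i ⟨x, h⟩ b := dif_pos h

theorem totalProj_point (i : C.ι) (x : X) (b : Torus n) : C.totalProj (C.point i x b) = x := by
  rw [point]
  split_ifs <;> rfl

theorem vadd_point (i : C.ι) (x : X) (b b' : Torus n) :
    b +ᵥ C.point i x b' = C.point i x (b + b') := by
  simp only [point]
  split_ifs <;> rfl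

theorem point_eq {i j : C.ι} {x : X} (hi : x ∈ C.U i) (hj : x ∈ C.U j) (b : Torus n) :
    C.point i x b = C.point j x (b + Torus.mk (C.a i j x)) := by
  rw [point_of_mem hi, point_of_mem hj, C.pt_eq hi hj]

theorem coord_point {i j : C.ι} {x : X} (hi : x ∈ C.U i) (hj : x ∈ C.U j) (b : Torus n) :
    C.coord j (C.point i x b) = b + Torus.mk (C.a i j x) := by
  rw [point_of_mem hi, C.coord_pt j i ⟨x, hi⟩ b hj]

theorem coord_point_self {i : C.ι} {x : X} (hi : x ∈ C.U i) (b : Torus n) :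
    C.coord i (C.point i x b) = b := by
  rw [point_of_mem hi, C.coord_self]

theorem point_coord {i : C.ι} {y : C.Total} (hi : C.totalProj y ∈ C.U i) :
    C.point i (C.totalProj y) (C.coord i y) = y := by
  obtain ⟨j, ⟨x, hx⟩, b, rfl⟩ := C.exists_pt y
  rw [← point_of_mem hx] at hi ⊢
  rw [totalProj_point] at hi ⊢
  rw [coord_point hx hi, ← point_eq hx hi]

theorem point_injective {i : C.ι} {x : X} (hi : x ∈ C.U i) {b b' : Torus n}
    (h : C.point i x b = C.point i x b') : b = b' := by
  rw [← coord_point_self hi b, h, coord_point_self hi]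

theorem coord_vadd {i : C.ι} {y : C.Total} (hi : C.totalProj y ∈ C.U i) (b : Torus n) :
    C.coord i (b +ᵥ y) = b + C.coord i y := by
  conv_lhs => rw [← point_coord hi]
  rw [vadd_point, coord_point_self hi]

theorem continuous_torusMk : Continuous (Torus.mk : (Fin n → ℝ) → Torus n) :=
  continuous_pi fun p => (AddCircle.continuous_mk' 1).comp (continuous_apply p)

theorem chart_bundle (i : C.ι) (x : C.U i) (b : Torus n) :
    C.bundle.chart i (x, b) = C.point i x b := by
  rw [point_of_mem x.2]
  change C.pt i x (b + 0) = _
  rw [add_zero]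

/-- Since U i × 𝕋ⁿ is open in X × 𝕋ⁿ, openness can be tested there, without subtypes. -/
theorem isOpen_total_iff {V : Set C.bundle.E} : IsOpen V ↔
    ∀ i, IsOpen {q : X × Torus n | q.1 ∈ C.U i ∧ C.point i q.1 q.2 ∈ V} := by
  rw [TorusBundle.isOpen_iff]
  refine forall_congr' fun (i : C.ι) => ?_
  have hemb : Topology.IsOpenEmbedding
      (Prod.map Subtype.val id : C.U i × Torus n → X × Torus n) :=
    (C.U i).isOpen.isOpenEmbedding_subtypeVal.prodMap Topology.IsOpenEmbedding.id
  have h1 : (Prod.map Subtype.val id : C.U i × Torus n → X × Torus n) ''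
      (C.bundle.chart i ⁻¹' V) = {q : X × Torus n | q.1 ∈ C.U i ∧ C.point i q.1 q.2 ∈ V} := by
    ext ⟨x, b⟩
    constructor
    · rintro ⟨⟨x', b'⟩, h, he⟩
      obtain ⟨rfl, rfl⟩ := Prod.ext_iff.1 he
      have h' : C.bundle.chart i (x', b') ∈ V := h
      rw [chart_bundle] at h'
      exact ⟨x'.2, h'⟩
    · rintro ⟨hx, h⟩
      refine ⟨(⟨x, hx⟩, b), ?_, rfl⟩
      exact (congrArg (· ∈ V) (chart_bundle i ⟨x, hx⟩ b)).mpr h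
  rw [← h1]
  exact hemb.isOpen_iff_image_isOpen

/-- The preimage in `U i × ℝⁿ` of a subset of the total space. -/
def lifted (i : C.ι) (V : Set C.bundle.E) : Set (X × (Fin n → ℝ)) :=
  {q | q.1 ∈ C.U i ∧ C.point i q.1 (Torus.mk q.2) ∈ V}

theorem smoothOn_iff {F : C.bundle.E → UnitAddCircle} {V : Set C.bundle.E} :
    C.bundle.SmoothOn F V ↔ ∀ i : C.ι, SmoothU1On (prodModel d n)
      (fun q : X × (Fin n → ℝ) => F (C.point i q.1 (Torus.mk q.2))) (lifted i V) := by
  classical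
  refine forall_congr' fun (i : C.ι) => ?_
  have hfun : ∀ q : C.U i × (Fin n → ℝ),
      C.bundle.chart i (q.1, Torus.mk q.2) = C.point i q.1 (Torus.mk q.2) :=
    fun q => chart_bundle i q.1 _
  constructor
  · intro h
    rcases isEmpty_or_nonempty (C.U i) with he | ⟨⟨x₁⟩⟩
    · intro q hq
      exact (he.false ⟨q.1, hq.1⟩).elim
    -- A left inverse of the inclusion of U i, with an arbitrary value outside. On U i it is smooth
    -- because it becomes the identity after composing with the inclusion.
    set ρ : X → C.U i := fun x => if h : x ∈ C.U i then ⟨x, h⟩ else x₁ with hρ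
    have hρv : ∀ x ∈ C.U i, ((ρ x : C.U i) : X) = x := fun x hx => by simp [hρ, hx]
    have hρs : ContMDiffOn (𝓡 d) (𝓡 d) ∞ ρ (C.U i) := fun x hx => by
      refine ContMDiffAt.contMDiffWithinAt ?_
      rw [← ContMDiffAt.subtypeVal_comp_iff]
      refine contMDiffAt_id.congr_of_eventuallyEq ?_
      filter_upwards [(C.U i).isOpen.mem_nhds hx] with z hz
      exact hρv z hz
    have hρ2 : ContMDiffOn (prodModel d n) (prodModel d n) ∞
        (fun q : X × (Fin n → ℝ) => (ρ q.1, q.2)) (lifted i V) :=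
      ContMDiffOn.prodMk (hρs.comp contMDiff_base.contMDiffOn fun q hq => hq.1)
        contMDiff_fibre.contMDiffOn
    refine (h.comp hρ2 fun q hq => ?_).congr fun q hq => ?_
    · change C.bundle.chart i (ρ q.1, Torus.mk q.2) ∈ V
      rw [chart_bundle, hρv q.1 hq.1]
      exact hq.2
    · dsimp only
      rw [chart_bundle, hρv q.1 hq.1]
  · intro h
    have hv : ContMDiff (prodModel d n) (prodModel d n) ∞
        (fun q : C.U i × (Fin n → ℝ) => ((q.1 : X), q.2)) :=
      ContMDiff.prodMk (contMDiff_subtype_val.comp contMDiff_fst) contMDiff_snd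
    refine (h.comp hv.contMDiffOn fun q hq => ⟨q.1.2, ?_⟩).congr fun q hq => ?_
    · exact (hfun q) ▸ hq
    · dsimp only
      rw [← hfun q]

end TDCocycle

end Total

/-! ### Vanishing of Čech cohomology for smooth vector-valued functions -/

section Partition

variable {d : ℕ} {X : Type u} [TopologicalSpace X] [ChartedSpace (EuclideanSpace ℝ (Fin d)) X]
  [IsManifold (𝓡 d) ∞ X] [T2Space X] [SecondCountableTopology X]
  {F : Type*} [NormedAddCommGroup F] [NormedSpace ℝ F]

/-- The first Čech cohomology of the sheaf of smooth vector-valued functions vanishes. -/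
theorem exists_cobounding {κ : Type*} {W : κ → Opens X} (hW : ∀ x, ∃ k, x ∈ W k)
    {β : κ → κ → X → F}
    (hβ : ∀ k l, ContMDiffOn (𝓡 d) 𝓘(ℝ, F) ∞ (β k l) (W k ∩ W l))
    (hadd : ∀ k l m x, x ∈ W k → x ∈ W l → x ∈ W m → β k m x = β l m x + β k l x) :
    ∃ φ : κ → X → F, (∀ k, ContMDiffOn (𝓡 d) 𝓘(ℝ, F) ∞ (φ k) (W k)) ∧
      ∀ k l x, x ∈ W k → x ∈ W l → φ l x - φ k x = β k l x := by
  have : LocallyCompactSpace X := ChartedSpace.locallyCompactSpace (EuclideanSpace ℝ (Fin d)) X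
  obtain ⟨ρ, hρ⟩ := SmoothPartitionOfUnity.exists_isSubordinate (𝓡 d) (s := (Set.univ : Set X))
    isClosed_univ (fun k => (W k : Set X)) (fun k => (W k).isOpen)
    (fun x _ => Set.mem_iUnion.2 (hW x))
  have hsupp : ∀ m x, ρ m x ≠ 0 → x ∈ W m := fun m x h =>
    hρ m (subset_tsupport _ (Function.mem_support.2 h))
  -- The usual average of the cocycle against the partition of unity. The cocycle condition is used
  -- only at indices m with ρ m x ≠ 0, for which x lies in W m.
  refine ⟨fun k x => - ∑ᶠ m, ρ m x • β k m x, fun k x hx => ?_, fun k l x hk hl => ?_⟩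
  · have h1 : ContMDiffAt (𝓡 d) 𝓘(ℝ, F) ∞ (fun x => ∑ᶠ m, ρ m x • β k m x) x :=
      ρ.contMDiffAt_finsum fun m hm => (hβ k m).contMDiffAt
        (((W k).isOpen.inter (W m).isOpen).mem_nhds ⟨hx, hρ m hm⟩)
    exact (contDiff_neg.contMDiff.contMDiffAt.comp x h1).contMDiffWithinAt
  · have hfin : ∀ k, (Function.support fun m => ρ m x • β k m x).Finite := fun k =>
      (ρ.locallyFinite.point_finite x).subset fun m hm => by
        rw [Function.mem_support] at hm
        exact fun h => hm (by rw [h, zero_smul])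
    have h2 : ∀ m, ρ m x • β k m x = ρ m x • β l m x + ρ m x • β k l x := fun m => by
      by_cases h : ρ m x = 0
      · simp [h]
      · rw [hadd k l m x hk hl (hsupp m x h), smul_add]
    have h3 : ∑ᶠ m, ρ m x • β k l x = β k l x := by
      rw [← finsum_smul, ρ.sum_eq_one (Set.mem_univ x), one_smul]
    have h4 : (Function.support fun m => ρ m x • β k l x).Finite :=
      (ρ.locallyFinite.point_finite x).subset fun m hm => by
        rw [Function.mem_support] at hm
        exact fun h => hm (by rw [h, zero_smul])
    dsimp only
    rw [finsum_congr h2, finsum_add_distrib (hfin l) h4, h3]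
    abel

end Partition

/-! ### Algebra of the lower triangular form and of integral vectors -/

section LowForm

variable {n : ℕ}

theorem lowForm_smul_left (B : Matrix (Fin n) (Fin n) ℤ) (c : ℝ) (v w : Fin n → ℝ) :
    lowForm B (c • v) w = c * lowForm B v w := by
  simp only [lowForm, Finset.mul_sum]
  refine Finset.sum_congr rfl fun p _ => Finset.sum_congr rfl fun q _ => ?_
  split_ifs
  · simp only [Pi.smul_apply, smul_eq_mul]; ring
  · simp

theorem lowForm_neg_left (B : Matrix (Fin n) (Fin n) ℤ) (v w : Fin n → ℝ) :
    lowForm B (-v) w = -lowForm B v w := by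
  have := lowForm_smul_left B (-1) v w
  simpa using this

theorem lowForm_smul_right (B : Matrix (Fin n) (Fin n) ℤ) (c : ℝ) (v w : Fin n → ℝ) :
    lowForm B v (c • w) = c * lowForm B v w := by
  simp only [lowForm, Finset.mul_sum]
  refine Finset.sum_congr rfl fun p _ => Finset.sum_congr rfl fun q _ => ?_
  split_ifs
  · simp only [Pi.smul_apply, smul_eq_mul]; ring
  · simp

theorem lowForm_neg_right (B : Matrix (Fin n) (Fin n) ℤ) (v w : Fin n → ℝ) :
    lowForm B v (-w) = -lowForm B v w := by
  have := lowForm_smul_right B (-1) v w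
  simpa using this

theorem lowForm_sub_left (B : Matrix (Fin n) (Fin n) ℤ) (v v' w : Fin n → ℝ) :
    lowForm B (v - v') w = lowForm B v w - lowForm B v' w := by
  rw [sub_eq_add_neg, lowForm_add_left, lowForm_neg_left, sub_eq_add_neg]

theorem lowForm_sub_right (B : Matrix (Fin n) (Fin n) ℤ) (v w w' : Fin n → ℝ) :
    lowForm B v (w - w') = lowForm B v w - lowForm B v w' := by
  rw [sub_eq_add_neg, lowForm_add_right, lowForm_neg_right, sub_eq_add_neg]

theorem lowForm_neg_mat (B : Matrix (Fin n) (Fin n) ℤ) (v w : Fin n → ℝ) :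
    lowForm (-B) v w = -lowForm B v w := by
  simp only [lowForm, ← Finset.sum_neg_distrib]
  refine Finset.sum_congr rfl fun p _ => Finset.sum_congr rfl fun q _ => ?_
  split_ifs
  · simp
  · simp

theorem matAct_neg_mat (B : Matrix (Fin n) (Fin n) ℤ) (v : Fin n → ℝ) :
    matAct (-B) v = -matAct B v := by
  ext p; simp [matAct]

theorem intVec_neg (v : Fin n → ℤ) : intVec (-v) = -intVec v := by
  ext p; simp [intVec]

theorem intVec_zero : intVec (0 : Fin n → ℤ) = 0 := by
  ext p; simp [intVec]

theorem intVec_single (i : Fin n) (k : ℤ) : intVec (Pi.single i k) = Pi.single i (k : ℝ) := by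
  ext p
  by_cases h : p = i
  · subst h; simp [intVec]
  · simp [intVec, h]

theorem dotProduct_int (v w : Fin n → ℤ) : ∃ k : ℤ, intVec v ⬝ᵥ intVec w = k :=
  ⟨v ⬝ᵥ w, by simp [intVec, dotProduct]⟩

theorem lowForm_single_left (B : Matrix (Fin n) (Fin n) ℤ) (i : Fin n) (w : Fin n → ℝ) :
    lowForm B (Pi.single i 1) w = lowRow (fun p q => B p q) i w := by
  rw [lowForm, lowRow, Finset.sum_eq_single i]
  · simp
  · intro p _ hp
    refine Finset.sum_eq_zero fun q _ => ?_
    simp [hp]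
  · simp

/-- `⟨v | B | w⟩_low` as a linear form in `v`. -/
def lowVec (B : Matrix (Fin n) (Fin n) ℤ) (w : Fin n → ℝ) : Fin n → ℝ :=
  fun i => lowForm B (Pi.single i 1) w

/-- `⟨v | B | w⟩_low` as a linear form in `w`. -/
def lowVecT (B : Matrix (Fin n) (Fin n) ℤ) (v : Fin n → ℝ) : Fin n → ℝ :=
  fun i => lowForm B v (Pi.single i 1)

theorem lowVec_dotProduct (B : Matrix (Fin n) (Fin n) ℤ) (v w : Fin n → ℝ) :
    lowVec B w ⬝ᵥ v = lowForm B v w := by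
  simp only [dotProduct, lowVec, lowForm_single_left]
  simp only [lowRow, lowForm, Finset.sum_mul]
  refine Finset.sum_congr rfl fun p _ => Finset.sum_congr rfl fun q _ => ?_
  split_ifs
  · ring
  · simp

theorem lowVecT_apply (B : Matrix (Fin n) (Fin n) ℤ) (v : Fin n → ℝ) (i : Fin n) :
    lowVecT B v i = ∑ p, if i < p then (B p i : ℝ) * v p else 0 := by
  rw [lowVecT, lowForm]
  refine Finset.sum_congr rfl fun p _ => ?_
  rw [Finset.sum_eq_single i]
  · simp
  · intro q _ hq; simp [hq]
  · simp

theorem lowVecT_dotProduct (B : Matrix (Fin n) (Fin n) ℤ) (v w : Fin n → ℝ) :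
    lowVecT B v ⬝ᵥ w = lowForm B v w := by
  simp only [dotProduct, lowVecT_apply, Finset.sum_mul]
  rw [Finset.sum_comm, lowForm]
  refine Finset.sum_congr rfl fun p _ => Finset.sum_congr rfl fun q _ => ?_
  split_ifs <;> simp

theorem lowVec_add (B : Matrix (Fin n) (Fin n) ℤ) (v w : Fin n → ℝ) :
    lowVec B (v + w) = lowVec B v + lowVec B w := by
  ext i; simp [lowVec, lowForm_add_right]

/-- A skew-symmetric matrix is its lower triangle minus the transpose of that. In this way the full
matrix B comes back out of expressions in the triangular form. -/
theorem lowVec_sub_lowVecT {B : Matrix (Fin n) (Fin n) ℤ} (hB : B ∈ soZ n) (v : Fin n → ℝ) :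
    lowVec B v - lowVecT B v = matAct B v := by
  ext i
  have := dotProduct_matAct hB (Pi.single i 1) v
  rw [single_dotProduct, one_mul] at this
  rw [this]
  rfl

theorem soZ_apply (B : soZ n) (p q : Fin n) :
    (B : Matrix (Fin n) (Fin n) ℤ) q p = - (B : Matrix (Fin n) (Fin n) ℤ) p q := by
  have h : (B : Matrix (Fin n) (Fin n) ℤ)ᵀ = -B := B.2
  exact congrFun (congrFun h p) q

theorem soZ_ext {B B' : soZ n} (h : ∀ p q, q < p →
    (B : Matrix (Fin n) (Fin n) ℤ) p q = (B' : Matrix (Fin n) (Fin n) ℤ) p q) : B = B' := by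
  apply Subtype.ext
  ext p q
  rcases lt_trichotomy p q with hpq | rfl | hpq
  · rw [soZ_apply B q p, soZ_apply B' q p, h q p hpq]
  · have h1 := soZ_apply B p p
    have h2 := soZ_apply B' p p
    omega
  · exact h p q hpq

/-- The skew-symmetric matrix with prescribed lower triangular part. -/
def soZOfLower (c : Fin n → Fin n → ℤ) : soZ n :=
  ⟨Matrix.of fun p q => if q < p then c p q else if p < q then - c q p else 0, by
    change _ = _
    ext p q
    simp only [Matrix.transpose_apply, Matrix.of_apply, Matrix.neg_apply]
    rcases lt_trichotomy p q with h | rfl | h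
    · simp [h, h.not_gt]
    · simp
    · simp [h, h.not_gt]⟩

theorem lowRow_soZOfLower (c : Fin n → Fin n → ℤ) (i : Fin n) (v : Fin n → ℝ) :
    lowForm (soZOfLower c) (Pi.single i 1) v = lowRow c i v := by
  rw [lowForm_single_left, lowRow, lowRow]
  refine Finset.sum_congr rfl fun q _ => ?_
  split_ifs with h
  · simp [soZOfLower, h]
  · rfl

/-- A function with values in `ℤⁿ` that is continuous as a function with values in `ℝⁿ` is locally
constant. -/
theorem locConstOn_of_continuousOn {Z : Type*} [TopologicalSpace Z] {S : Set Z}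
    {z : Z → (Fin n → ℤ)} (hz : ContinuousOn (fun x => intVec (z x)) S) : LocConstOn z S := by
  intro x hx
  have h1 : ∀ᶠ y in 𝓝[S] x, dist (intVec (z y)) (intVec (z x)) < 1 :=
    (hz x hx).eventually (Metric.ball_mem_nhds _ one_pos)
  filter_upwards [h1] with y hy
  funext p
  have h2 := (dist_pi_lt_iff one_pos).1 hy p
  simp only [intVec, Int.dist_cast_real] at h2
  rw [Int.dist_eq] at h2
  have h3 : |z y p - z x p| < 1 := by exact_mod_cast h2
  rw [Int.abs_lt_one_iff] at h3
  omega

theorem Torus.mk_eq_zero_iff {v : Fin n → ℝ} : Torus.mk v = 0 ↔ ∃ m : Fin n → ℤ, v = intVec m := by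
  constructor
  · intro h
    have h1 : ∀ p, ∃ k : ℤ, v p = k := fun p => toU_eq_zero_iff.1 (congrFun h p)
    choose m hm using h1
    exact ⟨m, funext hm⟩
  · rintro ⟨m, rfl⟩
    exact Torus.mk_intVec m

theorem Torus.mk_eq_iff {v w : Fin n → ℝ} :
    Torus.mk v = Torus.mk w ↔ ∃ m : Fin n → ℤ, v = intVec m + w := by
  have h : Torus.mk (v - w) = Torus.mk v - Torus.mk w := by
    rw [eq_sub_iff_add_eq, ← Torus.mk_add, sub_add_cancel]
  rw [← sub_eq_zero, ← h, Torus.mk_eq_zero_iff]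
  exact exists_congr fun m => sub_eq_iff_eq_add

theorem Torus.mk_add_single (v : Fin n → ℝ) (i : Fin n) (k : ℤ) :
    Torus.mk (v + Pi.single i (k : ℝ)) = Torus.mk v := by
  rw [← intVec_single, Torus.mk_add, Torus.mk_intVec, add_zero]

/-- A property of integral vectors that holds for the unit vectors and is compatible with
addition and negation holds always. -/
theorem intVec_induction {P : (Fin n → ℤ) → Prop} (hs : ∀ i, P (Pi.single i 1)) (h0 : P 0)
    (hadd : ∀ v w, P v → P w → P (v + w)) (hneg : ∀ v, P v → P (-v)) (m : Fin n → ℤ) : P m := by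
  let H : AddSubgroup (Fin n → ℤ) :=
    { carrier := {m | P m}, zero_mem' := h0, add_mem' := fun ha hb => hadd _ _ ha hb,
      neg_mem' := fun ha => hneg _ ha }
  have h1 : m = ∑ i, m i • (Pi.single i 1 : Fin n → ℤ) := by
    ext p
    simp [Finset.sum_apply, Pi.single_apply]
  have h2 : m ∈ H := by
    rw [h1]
    exact H.sum_mem fun i _ => H.zsmul_mem (hs i) _
  exact h2

end LowForm

/-! ### Isomorphisms of left legs and their local trivializations -/

section LegEquivalence

variable {d n : ℕ} {X : Type u} [TopologicalSpace X] [ChartedSpace (EuclideanSpace ℝ (Fin d)) X]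

/-- The data of an isomorphism between the left legs of two T-duality correspondences, in terms
of the coordinates of the total spaces. -/
structure LegEquiv (C C' : TDCocycle d n X) where
  f : C.Total → C'.Total
  f_proj : ∀ y, C'.totalProj (f y) = C.totalProj y
  f_vadd : ∀ (b : Torus n) (y : C.Total), f (b +ᵥ y) = b +ᵥ f y
  f_smooth : ∀ (i : C.ι) (i' : C'.ι), ∃ h : X → Torus n,
    (∀ p, SmoothU1On (𝓡 d) (fun x => h x p) (C.U i ∩ C'.U i')) ∧
    ∀ x, x ∈ C.U i → x ∈ C'.U i' → f (C.point i x 0) = C'.point i' x (h x)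
  /-- the index set of the common refinement -/
  σ : Type u
  W : σ → Set C.Total
  W_open : ∀ s (i : C.ι), IsOpen {q : X × Torus n | q.1 ∈ C.U i ∧ C.point i q.1 q.2 ∈ W s}
  W_cover : ∀ y, ∃ s, y ∈ W s
  r : σ → C.ι
  r' : σ → C'.ι
  le : ∀ s, ∀ y ∈ W s, C.totalProj y ∈ C.U (r s)
  le' : ∀ s, ∀ y ∈ W s, C.totalProj y ∈ C'.U (r' s)
  e : σ → σ → C.Total → UnitAddCircle
  e_smooth : ∀ s t (i : C.ι), SmoothU1On (prodModel d n)
    (fun q : X × (Fin n → ℝ) => e s t (C.point i q.1 (Torus.mk q.2)))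
    {q | q.1 ∈ C.U i ∧ C.point i q.1 (Torus.mk q.2) ∈ W s ∩ W t}
  c_eq : ∀ s t v y, y ∈ W s → y ∈ W t → y ∈ W v →
    C'.legCocycle (r' s) (r' t) (r' v) (f y) + e s t y + e t v y
      = e s v y + C.legCocycle (r s) (r t) (r v) y

theorem LegEquiv.nonempty_iff (C C' : TDCocycle d n X) :
    Nonempty (LegEquiv C C') ↔ C.leftLeg.Iso C'.leftLeg := by
  constructor
  · rintro ⟨L⟩
    refine ⟨⟨L.f, L.f_proj, L.f_vadd, ?_, L.σ, L.W, fun s => ?_, L.W_cover, L.r, L.r', L.le, ?_, L.e,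
      ?_, L.c_eq⟩⟩
    · intro i i'
      obtain ⟨h, hs, he⟩ := L.f_smooth i i'
      refine ⟨h, hs, fun x hi hi' => ?_⟩
      have e1 := he x hi hi'
      have e2 := TDCocycle.vadd_point i' x (h x) 0 (C := C')
      rw [TDCocycle.point_of_mem hi', TDCocycle.point_of_mem hi', add_zero] at e2
      rw [TDCocycle.point_of_mem hi, TDCocycle.point_of_mem hi', ← e2] at e1
      exact e1
    · exact TDCocycle.isOpen_total_iff.2 (L.W_open s)
    · intro s y hy
      exact (congrArg (· ∈ C'.U (L.r' s)) (L.f_proj y)).mpr (L.le' s y hy)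
    · intro s t
      exact TDCocycle.smoothOn_iff.2 (L.e_smooth s t)
  · rintro ⟨Q⟩
    refine ⟨⟨Q.f, Q.f_proj, Q.f_vadd, ?_, Q.σ, Q.W, fun s => ?_, Q.W_cover, Q.r, Q.r', Q.le, ?_, Q.e,
      ?_, Q.c_eq⟩⟩
    · intro i i'
      obtain ⟨h, hs, he⟩ := Q.f_smooth i i'
      refine ⟨h, hs, fun x hi hi' => ?_⟩
      have e1 := he x hi hi'
      have e2 := TDCocycle.vadd_point i' x (h x) 0 (C := C')
      rw [add_zero] at e2
      rw [TDCocycle.point_of_mem hi, ← e2, TDCocycle.point_of_mem hi']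
      exact e1
    · exact TDCocycle.isOpen_total_iff.1 (Q.W_open s)
    · intro s y hy
      have h1 : C'.totalProj (Q.f y) ∈ C'.U (Q.r' s) := Q.le' s y hy
      have h2 : C'.totalProj (Q.f y) = C.totalProj y := Q.f_proj y
      rwa [h2] at h1
    · intro s t
      exact TDCocycle.smoothOn_iff.1 (Q.e_smooth s t)

theorem TDCocycle.legCocycle_point (C : TDCocycle d n X) {i : C.ι} {x : X} (hi : x ∈ C.U i)
    (j k : C.ι) (v : Fin n → ℝ) :
    C.legCocycle i j k (C.point i x (Torus.mk v))
      = - C.t i j k x - toU (intVec (C.mhat i j k x) ⬝ᵥ v) + toU (C.a i j x ⬝ᵥ C.ahat j k x) := by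
  rw [TDCocycle.legCocycle, TDCocycle.totalProj_point, TDCocycle.coord_point_self hi,
    TDCocycle.pairing_mk]

theorem TDCocycle.legCocycle_smooth_point (C : TDCocycle d n X) (l i j k : C.ι) :
    SmoothU1On (prodModel d n)
      (fun q : X × (Fin n → ℝ) => C.legCocycle i j k (C.point l q.1 (Torus.mk q.2)))
      {q | q.1 ∈ C.U l ∧ q.1 ∈ C.U i ∧ q.1 ∈ C.U j ∧ q.1 ∈ C.U k} := by
  refine (TDCocycle.smoothOn_iff.1 (C.legCocycle_smooth i j k) l).mono fun q hq => ⟨hq.1, ?_⟩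
  have h : ∀ j, q.1 ∈ C.U j → C.totalProj (C.point l q.1 (Torus.mk q.2)) ∈ C.U j := fun j hj => by
    rwa [TDCocycle.totalProj_point]
  exact ⟨⟨h i hq.2.1, h j hq.2.2.1⟩, h k hq.2.2.2⟩

namespace LegEquiv

variable {C C' : TDCocycle d n X}

/-- Over a small open set `W`, the bundle isomorphism is given by a smooth function `p`, and the
`U(1)`-bundle that compares the two gerbes has a trivialization `h` over `W × ℝⁿ` with standard
quasi-periodicity. -/
structure LocalTriv (L : LegEquiv C C') where
  i : C.ι
  i' : C'.ι
  W : Opens X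
  le : ∀ x ∈ W, x ∈ C.U i
  le' : ∀ x ∈ W, x ∈ C'.U i'
  p : X → (Fin n → ℝ)
  p_smooth : ContMDiffOn (𝓡 d) 𝓘(ℝ, Fin n → ℝ) ∞ p W
  f_eq : ∀ x ∈ W, ∀ v, L.f (C.point i x (Torus.mk v)) = C'.point i' x (Torus.mk (v + p x))
  B : soZ n
  h : L.σ → X × (Fin n → ℝ) → UnitAddCircle
  h_smooth : ∀ s, SmoothU1On (prodModel d n) (h s)
    {q | q.1 ∈ W ∧ C.point i q.1 (Torus.mk q.2) ∈ L.W s}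
  h_eq : ∀ s t x v, x ∈ W → C.point i x (Torus.mk v) ∈ L.W s → C.point i x (Torus.mk v) ∈ L.W t →
    L.e s t (C.point i x (Torus.mk v))
      + C'.legCocycle i' (L.r' s) (L.r' t) (L.f (C.point i x (Torus.mk v)))
      - C.legCocycle i (L.r s) (L.r t) (C.point i x (Torus.mk v)) = h t (x, v) - h s (x, v)
  h_quasi : ∀ s x v, x ∈ W → C.point i x (Torus.mk v) ∈ L.W s → ∀ m : Fin n → ℤ,
    h s (x, v + intVec m) = h s (x, v) - toU (lowForm B (intVec m) v)

/-- The comparison cocycle over `U i`. -/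
noncomputable def comparison (L : LegEquiv C C') (i : C.ι) (i' : C'.ι) (s t : L.σ)
    (y : C.Total) : UnitAddCircle :=
  L.e s t y + C'.legCocycle i' (L.r' s) (L.r' t) (L.f y) - C.legCocycle i (L.r s) (L.r t) y

/-- The four-index cocycle identity with first index i exhibits each gerbe over U i as a coboundary.
The failure of e to be a cocycle is the difference of the two gerbe cocycles, so subtracting both
coboundaries repairs it. -/
theorem comparison_add (L : LegEquiv C C') {i : C.ι} {i' : C'.ι} {s t v : L.σ} {y : C.Total}
    (hi : C.totalProj y ∈ C.U i) (hi' : C.totalProj y ∈ C'.U i')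
    (hs : y ∈ L.W s) (ht : y ∈ L.W t) (hv : y ∈ L.W v) :
    L.comparison i i' s t y + L.comparison i i' t v y = L.comparison i i' s v y := by
  have h1 := L.c_eq s t v y hs ht hv
  have h2 := C.legCocycle_eq i (L.r s) (L.r t) (L.r v) y hi (L.le s y hs) (L.le t y ht) (L.le v y hv)
  have h3 := C'.legCocycle_eq i' (L.r' s) (L.r' t) (L.r' v) (L.f y) (by rwa [L.f_proj])
    (by rw [L.f_proj]; exact L.le' s y hs) (by rw [L.f_proj]; exact L.le' t y ht)
    (by rw [L.f_proj]; exact L.le' v y hv)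
  simp only [comparison]
  linear_combination (norm := abel) h1 - h2 + h3

/-- By equivariance f is determined by its values on a local section. There it is a smooth 𝕋ⁿ-valued
function, which lifts to ℝⁿ near x₀. -/
theorem exists_local_lift_f (L : LegEquiv C C') {i : C.ι} {i' : C'.ι} {x₀ : X} (hi : x₀ ∈ C.U i)
    (hi' : x₀ ∈ C'.U i') :
    ∃ O : Set X, IsOpen O ∧ x₀ ∈ O ∧ O ⊆ C.U i ∩ C'.U i' ∧ ∃ p : X → (Fin n → ℝ),
      ContMDiffOn (𝓡 d) 𝓘(ℝ, Fin n → ℝ) ∞ p O ∧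
      ∀ x ∈ O, ∀ v, L.f (C.point i x (Torus.mk v)) = C'.point i' x (Torus.mk (v + p x)) := by
  obtain ⟨h, hs, he⟩ := L.f_smooth i i'
  have hO : IsOpen ((C.U i : Set X) ∩ C'.U i') := (C.U i).isOpen.inter (C'.U i').isOpen
  choose T hTo hxT hTs g hg hge using fun q => (hs q).exists_local_lift hO (x := x₀) ⟨hi, hi'⟩
  refine ⟨(⋂ q, T q) ∩ (C.U i ∩ C'.U i'), (isOpen_iInter_of_finite hTo).inter hO,
    ⟨Set.mem_iInter.2 hxT, hi, hi'⟩, Set.inter_subset_right, fun x q => g q x, ?_, ?_⟩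
  · exact contMDiffOn_pi_space.2 fun q => (hg q).mono fun x hx => Set.mem_iInter.1 hx.1 q
  · intro x hx v
    have h1 : Torus.mk (fun q => g q x) = h x := funext fun q => hge q x (Set.mem_iInter.1 hx.1 q)
    have h2 : C.point i x (Torus.mk v) = Torus.mk v +ᵥ C.point i x 0 := by
      rw [TDCocycle.vadd_point, add_zero]
    rw [h2, L.f_vadd, he x hx.2.1 hx.2.2, TDCocycle.vadd_point, Torus.mk_add, h1]

variable [IsManifold (𝓡 d) ∞ X]

/-- The comparison cocycle is defined on the total space, so its pullback to O × ℝⁿ is ℤⁿ-periodic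
and the local classification of U(1)-bundles applies. The resulting lower triangle is completed to a
skew-symmetric matrix. -/
theorem exists_localTriv (L : LegEquiv C C') (x₀ : X) : ∃ T : L.LocalTriv, x₀ ∈ T.W := by
  obtain ⟨i, hi⟩ := C.cover x₀
  obtain ⟨i', hi'⟩ := C'.cover x₀
  obtain ⟨O, hO, hx₀, hOs, p, hp, hf⟩ := L.exists_local_lift_f hi hi'
  set Ω : L.σ → Set (X × (Fin n → ℝ)) := fun s =>
    {q | q.1 ∈ O ∧ C.point i q.1 (Torus.mk q.2) ∈ L.W s} with hΩ
  have hΩo : ∀ s, IsOpen (Ω s) := fun s => by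
    have h1 : IsOpen {q : X × (Fin n → ℝ) | q.1 ∈ C.U i ∧ C.point i q.1 (Torus.mk q.2) ∈ L.W s} :=
      (L.W_open s i).preimage
        (continuous_fst.prodMk (TDCocycle.continuous_torusMk.comp continuous_snd))
    have h2 : Ω s = {q | q.1 ∈ O} ∩
        {q : X × (Fin n → ℝ) | q.1 ∈ C.U i ∧ C.point i q.1 (Torus.mk q.2) ∈ L.W s} := by
      ext q
      exact ⟨fun h => ⟨h.1, (hOs h.1).1, h.2⟩, fun h => ⟨h.1, h.2.2⟩⟩
    rw [h2]
    exact (hO.preimage continuous_fst).inter h1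
  have hle : ∀ s, ∀ q ∈ Ω s, q.1 ∈ C.U (L.r s) ∧ q.1 ∈ C'.U (L.r' s) := fun s q hq => by
    have h1 := L.le s _ hq.2
    have h2 := L.le' s _ hq.2
    rw [TDCocycle.totalProj_point] at h1 h2
    exact ⟨h1, h2⟩
  have htr : ∀ j (k : ℤ) (q : X × (Fin n → ℝ)),
      C.point i (tr j k q).1 (Torus.mk (tr j k q).2) = C.point i q.1 (Torus.mk q.2) := by
    intro j k q
    simp only [tr, Torus.mk_add_single]
  obtain ⟨W, hW, hxW, hWO, c, h, hs, heq, hq⟩ := exists_local_trivialization (d := d) hO hx₀ hΩo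
    (g := fun s t q => L.comparison i i' s t (C.point i q.1 (Torus.mk q.2)))
    (fun s t => by
      refine ((((L.e_smooth s t i).mono ?_).add ?_).sub ?_)
      · exact fun q hq => ⟨(hOs hq.1.1).1, hq.1.2, hq.2.2⟩
      · have h1 : ContMDiffOn (prodModel d n) (prodModel d n) ∞
            (fun q : X × (Fin n → ℝ) => (q.1, q.2 + p q.1)) (Ω s ∩ Ω t) := by
          refine ContMDiffOn.prodMk contMDiff_base.contMDiffOn (contMDiffOn_pi_space.2 fun j => ?_)
          exact smooth_add (smooth_coord contMDiff_fibre.contMDiffOn j)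
            (smooth_coord (hp.comp contMDiff_base.contMDiffOn fun q hq => hq.1.1) j)
        refine ((C'.legCocycle_smooth_point i' i' (L.r' s) (L.r' t)).comp h1 fun q hq => ?_).congr
          fun q hq => ?_
        · exact ⟨(hOs hq.1.1).2, (hOs hq.1.1).2, (hle s q hq.1).2, (hle t q hq.2).2⟩
        · rw [hf q.1 hq.1.1]
      · exact (C.legCocycle_smooth_point i i (L.r s) (L.r t)).mono fun q hq =>
          ⟨(hOs hq.1.1).1, (hOs hq.1.1).1, (hle s q hq.1).1, (hle t q hq.2).1⟩)
    (fun s t v q hs ht hv => L.comparison_add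
      (by rw [TDCocycle.totalProj_point]; exact (hOs hs.1).1)
      (by rw [TDCocycle.totalProj_point]; exact (hOs hs.1).2) hs.2 ht.2 hv.2)
    (fun s j k q => by
      simp only [hΩ, Set.mem_ofPred_eq, htr]
      exact Iff.rfl)
    (fun s t j k q => by rw [htr])
    (fun x hx v => by
      obtain ⟨s, hs⟩ := L.W_cover (C.point i x (Torus.mk v))
      exact ⟨s, hx, hs⟩)
  refine ⟨⟨i, i', ⟨W, hW⟩, fun x hx => (hOs (hWO hx)).1, fun x hx => (hOs (hWO hx)).2, p,
    hp.mono hWO, fun x hx => hf x (hWO hx), soZOfLower c, h, fun s => ?_, ?_, ?_⟩, hxW⟩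
  · exact (hs s).mono fun q hq => ⟨hq.1, hWO hq.1, hq.2⟩
  · intro s t x v hx hxs hxt
    exact heq s t (x, v) hx ⟨hWO hx, hxs⟩ ⟨hWO hx, hxt⟩
  · intro s x v hx hxs m
    have hmk : ∀ v (m : Fin n → ℤ), Torus.mk (v + intVec m) = Torus.mk v := fun v m => by
      rw [Torus.mk_add, Torus.mk_intVec, add_zero]
    revert v
    -- From unit vectors to all integral vectors: translating by m and then by m' produces the cross
    -- term ⟨m'|B|m⟩_low, which is an integer.
    refine intVec_induction (P := fun m => ∀ v, C.point i x (Torus.mk v) ∈ L.W s →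
      h s (x, v + intVec m) = h s (x, v) - toU (lowForm (soZOfLower c) (intVec m) v))
      ?_ ?_ ?_ ?_ m
    · intro j v hv
      have := hq j (x, v) hx s ⟨hWO hx, hv⟩
      rw [intVec_single, Int.cast_one, lowRow_soZOfLower]
      exact this
    · intro v _
      rw [intVec_zero, add_zero, lowForm_zero_left, toU_zero, sub_zero]
    · intro m m' hm hm' v hv
      have e1 := hm' (v + intVec m) (by rwa [hmk])
      rw [hm v hv] at e1
      rw [intVec_add, ← add_assoc, e1, lowForm_add_right, lowForm_add_left, toU_add, toU_add,
        toU_lowForm_int]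
      abel
    · intro m hm v hv
      have e1 := hm (v + intVec (-m)) (by rwa [hmk])
      rw [add_assoc, ← intVec_add, neg_add_cancel, intVec_zero, add_zero, lowForm_add_right,
        toU_add, toU_lowForm_int, add_zero] at e1
      rw [e1, intVec_neg, lowForm_neg_left, toU_neg]
      abel

end LegEquiv

end LegEquivalence

/-! ### Transitions between local trivializations -/

section LegToHG

variable {d n : ℕ} {X : Type u} [TopologicalSpace X] [ChartedSpace (EuclideanSpace ℝ (Fin d)) X]

namespace LegEquiv

variable {C C' : TDCocycle d n X} {L : LegEquiv C C'}

/-- The formula for the comparison of two local trivializations. -/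
noncomputable def transitionFormula (T T' : L.LocalTriv) (s : L.σ) (y : X × (Fin n → ℝ)) :
    UnitAddCircle :=
  T'.h s (y.1, y.2 + C.a T.i T'.i y.1) - T.h s y
    + C'.legCocycle T.i' T'.i' (L.r' s) (L.f (C.point T.i y.1 (Torus.mk y.2)))
    - C.legCocycle T.i T'.i (L.r s) (C.point T.i y.1 (Torus.mk y.2))

theorem point_change (T T' : L.LocalTriv) {x : X} (hx : x ∈ T.W) (hx' : x ∈ T'.W)
    (v : Fin n → ℝ) : C.point T.i x (Torus.mk v)
      = C.point T'.i x (Torus.mk (v + C.a T.i T'.i x)) := by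
  rw [TDCocycle.point_eq (T.le x hx) (T'.le x hx'), Torus.mk_add]

theorem mem_U_of_point {i : C.ι} {x : X} {b : Torus n} {s : L.σ} (h : C.point i x b ∈ L.W s) :
    x ∈ C.U (L.r s) ∧ x ∈ C'.U (L.r' s) := by
  have h1 := L.le s _ h
  have h2 := L.le' s _ h
  rw [TDCocycle.totalProj_point] at h1 h2
  exact ⟨h1, h2⟩

theorem transitionFormula_smooth (T T' : L.LocalTriv) (s : L.σ) :
    SmoothU1On (prodModel d n) (transitionFormula T T' s)
      {y | (y.1 ∈ T.W ∧ y.1 ∈ T'.W) ∧ C.point T.i y.1 (Torus.mk y.2) ∈ L.W s} := by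
  set S := {y : X × (Fin n → ℝ) |
    (y.1 ∈ T.W ∧ y.1 ∈ T'.W) ∧ C.point T.i y.1 (Torus.mk y.2) ∈ L.W s}
  have hb : ContMDiffOn (prodModel d n) (𝓡 d) ∞ (fun q : X × (Fin n → ℝ) => q.1) S :=
    contMDiff_base.contMDiffOn
  have hf : ContMDiffOn (prodModel d n) 𝓘(ℝ, Fin n → ℝ) ∞ (fun q : X × (Fin n → ℝ) => q.2) S :=
    contMDiff_fibre.contMDiffOn
  have h1 : ContMDiffOn (prodModel d n) (prodModel d n) ∞
      (fun y : X × (Fin n → ℝ) => (y.1, y.2 + C.a T.i T'.i y.1)) S := by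
    refine ContMDiffOn.prodMk hb (contMDiffOn_pi_space.2 fun j => ?_)
    exact smooth_add (smooth_coord hf j) (smooth_coord ((C.a_smooth T.i T'.i).comp hb
      fun q hq => ⟨T.le _ hq.1.1, T'.le _ hq.1.2⟩) j)
  have h2 : ContMDiffOn (prodModel d n) (prodModel d n) ∞
      (fun y : X × (Fin n → ℝ) => (y.1, y.2 + T.p y.1)) S := by
    refine ContMDiffOn.prodMk hb (contMDiffOn_pi_space.2 fun j => ?_)
    exact smooth_add (smooth_coord hf j) (smooth_coord (T.p_smooth.comp hb fun q hq => hq.1.1) j)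
  refine ((((T'.h_smooth s).comp h1 fun y hy => ⟨hy.1.2, ?_⟩).sub
    ((T.h_smooth s).mono fun y hy => ⟨hy.1.1, hy.2⟩)).add ?_).sub ?_
  · dsimp only
    rw [← point_change T T' hy.1.1 hy.1.2]
    exact hy.2
  · refine ((C'.legCocycle_smooth_point T.i' T.i' T'.i' (L.r' s)).comp h2 fun y hy => ?_).congr
      fun y hy => ?_
    · exact ⟨T.le' _ hy.1.1, T.le' _ hy.1.1, T'.le' _ hy.1.2, (mem_U_of_point hy.2).2⟩
    · rw [T.f_eq _ hy.1.1]
  · exact (C.legCocycle_smooth_point T.i T.i T'.i (L.r s)).mono fun y hy =>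
      ⟨T.le _ hy.1.1, T.le _ hy.1.1, T'.le _ hy.1.2, (mem_U_of_point hy.2).1⟩

/-- Passing from s to t changes the two functions h by the two comparison cocycles. The cochain e is
common to both and cancels; what remains cancels against the leg terms by the four-index cocycle
identities. -/
theorem transitionFormula_indep (T T' : L.LocalTriv) (s t : L.σ) {x : X} {v : Fin n → ℝ}
    (hx : x ∈ T.W) (hx' : x ∈ T'.W) (hs : C.point T.i x (Torus.mk v) ∈ L.W s)
    (ht : C.point T.i x (Torus.mk v) ∈ L.W t) :
    transitionFormula T T' s (x, v) = transitionFormula T T' t (x, v) := by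
  have e1 := T.h_eq s t x v hx hs ht
  have hpc := point_change T T' hx hx' v
  have e2 := T'.h_eq s t x (v + C.a T.i T'.i x) hx' (by rwa [← hpc]) (by rwa [← hpc])
  rw [← hpc] at e2
  simp only [transitionFormula]
  set y := C.point T.i x (Torus.mk v) with hy
  have hyx : C.totalProj y = x := TDCocycle.totalProj_point _ _ _
  have hfx : C'.totalProj (L.f y) = x := by rw [L.f_proj, hyx]
  have us := mem_U_of_point hs
  have ut := mem_U_of_point ht
  have e3 := C.legCocycle_eq T.i T'.i (L.r s) (L.r t) y (hyx ▸ T.le x hx) (hyx ▸ T'.le x hx')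
    (hyx ▸ us.1) (hyx ▸ ut.1)
  have e4 := C'.legCocycle_eq T.i' T'.i' (L.r' s) (L.r' t) (L.f y) (hfx ▸ T.le' x hx)
    (hfx ▸ T'.le' x hx') (hfx ▸ us.2) (hfx ▸ ut.2)
  linear_combination (norm := abel) e2 - e1 + e4 - e3

/-- The comparison of two local trivializations. -/
structure Transition (T T' : L.LocalTriv) where
  q : X × (Fin n → ℝ) → UnitAddCircle
  q_eq : ∀ x v s, x ∈ T.W → x ∈ T'.W → C.point T.i x (Torus.mk v) ∈ L.W s →
    q (x, v) = transitionFormula T T' s (x, v)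
  zeta : X → (Fin n → ℤ)
  e : X → UnitAddCircle
  zeta_const : LocConstOn zeta (T.W ∩ T'.W)
  e_smooth : SmoothU1On (𝓡 d) e (T.W ∩ T'.W)
  B_eq : ∀ x, x ∈ T.W → x ∈ T'.W → T.B = T'.B
  form : ∀ x, x ∈ T.W → x ∈ T'.W →
    HasForm (fun v => q (x, v)) (intVec (zeta x) - lowVec T.B (C.a T.i T'.i x)) (e x)

/-- The gerbe terms depend on the point of E only and are periodic, so all of the jump comes from
the two functions h. -/
theorem transition_quasi {T T' : L.LocalTriv} {q : X × (Fin n → ℝ) → UnitAddCircle}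
    (hq : ∀ x v s, x ∈ T.W → x ∈ T'.W → C.point T.i x (Torus.mk v) ∈ L.W s →
      q (x, v) = transitionFormula T T' s (x, v)) {x : X} (hx : x ∈ T.W) (hx' : x ∈ T'.W)
    (v : Fin n → ℝ) (m : Fin n → ℤ) :
    q (x, v + intVec m) = q (x, v) + toU (lowForm T.B (intVec m) v
      - lowForm T'.B (intVec m) (v + C.a T.i T'.i x)) := by
  obtain ⟨s, hs⟩ := L.W_cover (C.point T.i x (Torus.mk v))
  have hmk : Torus.mk (v + intVec m) = Torus.mk v := by
    rw [Torus.mk_add, Torus.mk_intVec, add_zero]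
  rw [hq x v s hx hx' hs, hq x (v + intVec m) s hx hx' (by rwa [hmk])]
  simp only [transitionFormula, hmk]
  rw [T.h_quasi s x v hx hs, add_right_comm v, T'.h_quasi s x _ hx'
    (by rwa [← point_change T T' hx hx']), toU_sub]
  abel

variable [IsManifold (𝓡 d) ∞ X]

/-- The local formulas glue to q. Its differences are affine in v with matrix T.B - T'.B, so the
matrices agree and the differences no longer depend on v. The slope and the constant exist locally
with smooth dependence, and uniqueness makes them global. -/
theorem nonempty_transition (T T' : L.LocalTriv) : Nonempty (Transition T T') := by
  obtain ⟨q, hqs, hq⟩ := SmoothU1On.exists_glue (I := prodModel d n)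
    (N := {y : X × (Fin n → ℝ) | y.1 ∈ T.W ∧ y.1 ∈ T'.W})
    (Ω := fun s => {y : X × (Fin n → ℝ) | y.1 ∈ C.U T.i ∧ C.point T.i y.1 (Torus.mk y.2) ∈ L.W s})
    (fun s => (L.W_open s T.i).preimage
      (continuous_fst.prodMk (TDCocycle.continuous_torusMk.comp continuous_snd)))
    (fun y hy => by
      obtain ⟨s, hs⟩ := L.W_cover (C.point T.i y.1 (Torus.mk y.2))
      exact ⟨s, T.le _ hy.1, hs⟩)
    (w := fun s => transitionFormula T T' s)
    (fun s => (transitionFormula_smooth T T' s).mono fun y hy => ⟨hy.1, hy.2.2⟩)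
    (fun y hy s t hs ht => transitionFormula_indep T T' s t hy.1 hy.2 hs.2 ht.2)
  have hq' : ∀ x v s, x ∈ T.W → x ∈ T'.W → C.point T.i x (Torus.mk v) ∈ L.W s →
      q (x, v) = transitionFormula T T' s (x, v) := fun x v s hx hx' hs =>
    hq (x, v) ⟨hx, hx'⟩ s ⟨T.le x hx, hs⟩
  have hqc : ∀ x, x ∈ T.W → x ∈ T'.W → Continuous fun v => q (x, v) := fun x hx hx' => by
    refine continuousOn_univ.1 ?_
    exact hqs.continuousOn.comp (Continuous.prodMk_right x).continuousOn fun v _ => ⟨hx, hx'⟩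
  have hB : ∀ x, x ∈ T.W → x ∈ T'.W → T.B = T'.B := fun x hx hx' => by
    refine soZ_ext fun i j hj => ?_
    have := lowRow_eq_zero_of_differences (hqc x hx hx')
      (c := fun i j => (T.B : Matrix (Fin n) (Fin n) ℤ) i j - (T'.B : Matrix (Fin n) (Fin n) ℤ) i j)
      (w := fun i => - lowForm T'.B (Pi.single i 1) (C.a T.i T'.i x)) (fun i v => by
        have h := transition_quasi hq' hx hx' v (Pi.single i 1)
        rw [intVec_single, Int.cast_one] at h
        rw [h, lowForm_add_right]
        congr 2
        have : lowRow (fun i j => (T.B : Matrix (Fin n) (Fin n) ℤ) i j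
            - (T'.B : Matrix (Fin n) (Fin n) ℤ) i j) i v
            = lowForm T.B (Pi.single i 1) v - lowForm T'.B (Pi.single i 1) v := by
          rw [lowForm_single_left, lowForm_single_left, lowRow, lowRow, lowRow,
            ← Finset.sum_sub_distrib]
          refine Finset.sum_congr rfl fun p _ => ?_
          split_ifs
          · push_cast; ring
          · simp
        rw [this]
        ring) hj
    exact sub_eq_zero.1 this
  have hO : IsOpen ((T.W : Set X) ∩ T'.W) := T.W.isOpen.inter T'.W.isOpen
  -- The change of coordinates by a in the fibre contributes the slope -⟨·|B|a⟩_low; the remaining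
  -- integral part k is the future ẑ.
  have hloc : ∀ x₀, x₀ ∈ T.W → x₀ ∈ T'.W → ∃ W : Set X, IsOpen W ∧ x₀ ∈ W ∧
      W ⊆ (T.W : Set X) ∩ T'.W ∧ ∃ (k : Fin n → ℤ) (e : X → UnitAddCircle),
      SmoothU1On (𝓡 d) e W ∧ ∀ x ∈ W,
        HasForm (fun v => q (x, v)) (intVec k - lowVec T.B (C.a T.i T'.i x)) (e x) := by
    intro x₀ hx₀ hx₀'
    obtain ⟨W, hW, hxW, hWs, l, e, -, he, hform, hk⟩ := exists_local_hasForm (q := q) hO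
      (x₀ := x₀) ⟨hx₀, hx₀'⟩ hqs
      (b := fun i x => - lowForm T.B (Pi.single i 1) (C.a T.i T'.i x))
      (fun i => by
        have hcs : ∀ p, ContMDiffOn (𝓡 d) 𝓘(ℝ, ℝ) ∞
            (fun _ : X => (Pi.single i 1 : Fin n → ℝ) p) (T.W ∩ T'.W) :=
          fun p => contMDiffOn_const
        have h1 : ContMDiffOn (𝓡 d) 𝓘(ℝ, ℝ) ∞
            (fun x => lowForm T.B (Pi.single i 1) (C.a T.i T'.i x)) (T.W ∩ T'.W) :=
          smooth_lowForm _ hcs fun p => smooth_coord ((C.a_smooth T.i T'.i).mono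
            fun x hx => ⟨T.le _ hx.1, T'.le _ hx.2⟩) p
        exact contDiff_neg.contMDiff.comp_contMDiffOn h1)
      (fun i y hy => by
        have h := transition_quasi hq' hy.1 hy.2 y.2 (Pi.single i 1)
        rw [intVec_single, Int.cast_one, ← hB y.1 hy.1 hy.2, lowForm_add_right] at h
        simp only [tr]
        rw [h]
        congr 2
        ring)
    choose k hk using hk
    refine ⟨W, hW, hxW, hWs, k, e, he, fun x hx => ?_⟩
    have : l x = intVec k - lowVec T.B (C.a T.i T'.i x) := by
      funext i
      rw [hk i x hx]
      simp only [Pi.sub_apply, intVec, lowVec]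
      ring
    rw [← this]
    exact hform x hx
  have hex : ∀ x, ∃ (k : Fin n → ℤ) (e : UnitAddCircle), x ∈ T.W → x ∈ T'.W →
      HasForm (fun v => q (x, v)) (intVec k - lowVec T.B (C.a T.i T'.i x)) e := fun x => by
    by_cases h : x ∈ T.W ∧ x ∈ T'.W
    · obtain ⟨W, -, hxW, -, k, e, -, hf⟩ := hloc x h.1 h.2
      exact ⟨k, e x, fun _ _ => hf x hxW⟩
    · exact ⟨0, 0, fun h1 h2 => absurd ⟨h1, h2⟩ h⟩
  choose ζ e hform using hex
  -- The pointwise choices of ζ and e coincide near x₀ with the local ones, by uniqueness of the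
  -- form; hence ζ is locally constant and e is smooth.
  have huniq : ∀ x₀, x₀ ∈ T.W → x₀ ∈ T'.W → ∃ W : Set X, IsOpen W ∧ x₀ ∈ W ∧
      ∃ (k : Fin n → ℤ) (e' : X → UnitAddCircle), SmoothU1On (𝓡 d) e' W ∧
        ∀ x ∈ W, ζ x = k ∧ e x = e' x := by
    intro x₀ hx₀ hx₀'
    obtain ⟨W, hW, hxW, hWs, k, e', he', hf⟩ := hloc x₀ hx₀ hx₀'
    refine ⟨W, hW, hxW, k, e', he', fun x hx => ?_⟩
    obtain ⟨h1, h2⟩ := (hform x (hWs hx).1 (hWs hx).2).unique (hf x hx)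
    exact ⟨intVec_injective (sub_left_injective h1), h2⟩
  refine ⟨⟨q, hq', ζ, e, fun x hx => ?_, SmoothU1On.of_local fun x hx => ?_, hB, hform⟩⟩
  · obtain ⟨W, hW, hxW, k, e', -, hf⟩ := huniq x hx.1 hx.2
    filter_upwards [mem_nhdsWithin_of_mem_nhds (hW.mem_nhds hxW)] with y hy
    rw [(hf y hy).1, (hf x hxW).1]
  · obtain ⟨W, hW, hxW, k, e', he', hf⟩ := huniq x hx.1 hx.2
    exact ⟨e', W, hW.mem_nhds hxW, he'.mono fun y hy => hy.1, fun y hy => (hf y hy.1).2⟩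

end LegEquiv

end LegToHG

/-! ### Smoothness of vector-valued expressions -/

section SmoothVectors

variable {E H M : Type*} [NormedAddCommGroup E] [NormedSpace ℝ E] [TopologicalSpace H]
    {I : ModelWithCorners ℝ E H} [TopologicalSpace M] [ChartedSpace H M] {n : ℕ}

theorem smooth_dotProduct {v w : M → (Fin n → ℝ)} {S : Set M}
    (hv : ContMDiffOn I 𝓘(ℝ, Fin n → ℝ) ∞ v S) (hw : ContMDiffOn I 𝓘(ℝ, Fin n → ℝ) ∞ w S) :
    ContMDiffOn I 𝓘(ℝ, ℝ) ∞ (fun x => v x ⬝ᵥ w x) S :=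
  smooth_sum _ fun p => smooth_mul (smooth_coord hv p) (smooth_coord hw p)

theorem smooth_matAct (B : Matrix (Fin n) (Fin n) ℤ) {v : M → (Fin n → ℝ)} {S : Set M}
    (hv : ContMDiffOn I 𝓘(ℝ, Fin n → ℝ) ∞ v S) :
    ContMDiffOn I 𝓘(ℝ, Fin n → ℝ) ∞ (fun x => matAct B (v x)) S :=
  contMDiffOn_pi_space.2 fun _ => smooth_sum _ fun q =>
    smooth_mul contMDiffOn_const (smooth_coord hv q)

theorem smooth_vadd {v w : M → (Fin n → ℝ)} {S : Set M}
    (hv : ContMDiffOn I 𝓘(ℝ, Fin n → ℝ) ∞ v S) (hw : ContMDiffOn I 𝓘(ℝ, Fin n → ℝ) ∞ w S) :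
    ContMDiffOn I 𝓘(ℝ, Fin n → ℝ) ∞ (fun x => v x + w x) S :=
  contMDiffOn_pi_space.2 fun p => smooth_add (smooth_coord hv p) (smooth_coord hw p)

theorem smooth_vneg {v : M → (Fin n → ℝ)} {S : Set M}
    (hv : ContMDiffOn I 𝓘(ℝ, Fin n → ℝ) ∞ v S) :
    ContMDiffOn I 𝓘(ℝ, Fin n → ℝ) ∞ (fun x => - v x) S :=
  contDiff_neg.contMDiff.comp_contMDiffOn hv

theorem smooth_vsub {v w : M → (Fin n → ℝ)} {S : Set M}
    (hv : ContMDiffOn I 𝓘(ℝ, Fin n → ℝ) ∞ v S) (hw : ContMDiffOn I 𝓘(ℝ, Fin n → ℝ) ∞ w S) :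
    ContMDiffOn I 𝓘(ℝ, Fin n → ℝ) ∞ (fun x => v x - w x) S := by
  simp only [sub_eq_add_neg]
  exact smooth_vadd hv (smooth_vneg hw)

theorem LocConstOn.smooth_intVec {z : M → (Fin n → ℤ)} {S : Set M} (hz : LocConstOn z S) :
    ContMDiffOn I 𝓘(ℝ, Fin n → ℝ) ∞ (fun x => intVec (z x)) S :=
  contMDiffOn_pi_space.2 fun p => (hz.map fun m => m p).smooth

end SmoothVectors

/-! ### From left legs to half-geometric correspondences -/

section LegToHG

variable {d n : ℕ} {X : Type u} [TopologicalSpace X] [ChartedSpace (EuclideanSpace ℝ (Fin d)) X]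

namespace LegEquiv

variable {C C' : TDCocycle d n X} {L : LegEquiv C C'}

/-- The functions h cancel, except that T''.h is evaluated at two points which differ by the
integral vector m; quasi-periodicity turns this into ⟨m|B|·⟩_low. The gerbe terms combine to the two
cocycles on the triple overlap. -/
theorem transition_triple {T T' T'' : L.LocalTriv} (P : Transition T T') (P' : Transition T' T'')
    (P'' : Transition T T'') {x : X} (h : x ∈ T.W) (h' : x ∈ T'.W) (h'' : x ∈ T''.W)
    (v : Fin n → ℝ) :
    P'.q (x, v + C.a T.i T'.i x) + P.q (x, v) - P''.q (x, v)
      = toU (lowForm T.B (intVec (C.m T.i T'.i T''.i x))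
          (v + C.a T.i T'.i x + C.a T'.i T''.i x))
        + (- C'.t T.i' T'.i' T''.i' x - toU (intVec (C'.mhat T.i' T'.i' T''.i' x) ⬝ᵥ (v + T.p x))
          + toU (C'.a T.i' T'.i' x ⬝ᵥ C'.ahat T'.i' T''.i' x))
        - (- C.t T.i T'.i T''.i x - toU (intVec (C.mhat T.i T'.i T''.i x) ⬝ᵥ v)
          + toU (C.a T.i T'.i x ⬝ᵥ C.ahat T'.i T''.i x)) := by
  have hB : T.B = T''.B := P''.B_eq x h h''
  have hpc := point_change T T' h h' v
  have hpc' := point_change T T'' h h'' v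
  have hfy := T.f_eq x h v
  have hcy := C.legCocycle_point (T.le x h) T'.i T''.i v
  have hcfy := C'.legCocycle_point (T.le' x h) T'.i' T''.i' (v + T.p x)
  rw [← hfy] at hcfy
  rw [← hcy, ← hcfy]
  obtain ⟨s, hs⟩ := L.W_cover (C.point T.i x (Torus.mk v))
  have e1 := P.q_eq x v s h h' hs
  have e2 := P'.q_eq x (v + C.a T.i T'.i x) s h' h'' (by rwa [← hpc])
  have e3 := P''.q_eq x v s h h'' hs
  simp only [transitionFormula] at e1 e2 e3
  rw [← hpc] at e2
  have ha : v + C.a T.i T''.i x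
      = v + C.a T.i T'.i x + C.a T'.i T''.i x + intVec (C.m T.i T'.i T''.i x) := by
    rw [C.a_eq _ _ _ x (T.le x h) (T'.le x h') (T''.le x h'')]
    abel
  have hmk : C.point T''.i x (Torus.mk (v + C.a T.i T'.i x + C.a T'.i T''.i x))
      = C.point T.i x (Torus.mk v) := by
    rw [hpc', ha, Torus.mk_add _ (intVec _), Torus.mk_intVec, add_zero]
  rw [ha, T''.h_quasi s x _ h'' (by rwa [hmk]), ← hB] at e3
  set y := C.point T.i x (Torus.mk v) with hy
  have hyx : C.totalProj y = x := TDCocycle.totalProj_point _ _ _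
  have hfx : C'.totalProj (L.f y) = x := by rw [L.f_proj, hyx]
  have us := mem_U_of_point hs
  have e4 := C.legCocycle_eq T.i T'.i T''.i (L.r s) y (hyx ▸ T.le x h) (hyx ▸ T'.le x h')
    (hyx ▸ T''.le x h'') (hyx ▸ us.1)
  have e5 := C'.legCocycle_eq T.i' T'.i' T''.i' (L.r' s) (L.f y) (hfx ▸ T.le' x h)
    (hfx ▸ T'.le' x h') (hfx ▸ T''.le' x h'') (hfx ▸ us.2)
  rw [e1, e2, e3]
  linear_combination (norm := abel) e4 - e5

/-- Both sides of the triple relation have a form, and forms are unique. In the slopes, the term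
-⟨·|B|a⟩_low contributes `lowVec` of m and the jump of h contributes `lowVecT` of m; their
difference is B m. -/
theorem transition_cocycle {T T' T'' : L.LocalTriv} (P : Transition T T') (P' : Transition T' T'')
    (P'' : Transition T T'') {x : X} (h : x ∈ T.W) (h' : x ∈ T'.W) (h'' : x ∈ T''.W) :
    intVec (P'.zeta x) + intVec (P.zeta x) - intVec (P''.zeta x)
        + matAct T.B (intVec (C.m T.i T'.i T''.i x))
      = intVec (C.mhat T.i T'.i T''.i x) - intVec (C'.mhat T.i' T'.i' T''.i' x) ∧
    P'.e x + toU (intVec (P'.zeta x) ⬝ᵥ C.a T.i T'.i x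
        - lowForm T.B (C.a T.i T'.i x) (C.a T'.i T''.i x)) + P.e x - P''.e x
      = toU (lowForm T.B (intVec (C.m T.i T'.i T''.i x)) (C.a T.i T'.i x + C.a T'.i T''.i x))
        - C'.t T.i' T'.i' T''.i' x - toU (intVec (C'.mhat T.i' T'.i' T''.i' x) ⬝ᵥ T.p x)
        + toU (C'.a T.i' T'.i' x ⬝ᵥ C'.ahat T'.i' T''.i' x) + C.t T.i T'.i T''.i x
        - toU (C.a T.i T'.i x ⬝ᵥ C.ahat T'.i T''.i x) := by
  have f1 := (((P'.form x h' h'').shift (C.a T.i T'.i x)).add (P.form x h h')).add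
    (P''.form x h h'').neg
  set m := C.m T.i T'.i T''.i x with hm
  set e := toU (lowForm T.B (intVec m) (C.a T.i T'.i x + C.a T'.i T''.i x))
        - C'.t T.i' T'.i' T''.i' x - toU (intVec (C'.mhat T.i' T'.i' T''.i' x) ⬝ᵥ T.p x)
        + toU (C'.a T.i' T'.i' x ⬝ᵥ C'.ahat T'.i' T''.i' x) + C.t T.i T'.i T''.i x
        - toU (C.a T.i T'.i x ⬝ᵥ C.ahat T'.i T''.i x) with he
  have f2 := hasForm_affine (lowVecT T.B (intVec m) + intVec (C.mhat T.i T'.i T''.i x)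
    - intVec (C'.mhat T.i' T'.i' T''.i' x)) e
  have heq : (fun v => P'.q (x, v + C.a T.i T'.i x) + P.q (x, v) + -P''.q (x, v))
      = fun v => toU ((lowVecT T.B (intVec m) + intVec (C.mhat T.i T'.i T''.i x)
          - intVec (C'.mhat T.i' T'.i' T''.i' x)) ⬝ᵥ v) + e := by
    funext v
    rw [← sub_eq_add_neg, transition_triple P P' P'' h h' h'' v, he, ← hm]
    simp only [sub_dotProduct, add_dotProduct, dotProduct_add, lowVecT_dotProduct,
      lowForm_add_right, toU_add, toU_sub]
    abel
  rw [heq] at f1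
  obtain ⟨g1, g2⟩ := f1.unique f2
  have hB : T.B = T'.B := P.B_eq x h h'
  rw [← hB] at g1 g2
  have ha : C.a T.i T''.i x = intVec m + C.a T'.i T''.i x + C.a T.i T'.i x :=
    C.a_eq _ _ _ x (T.le x h) (T'.le x h') (T''.le x h'')
  constructor
  · rw [← lowVec_sub_lowVecT T.B.2]
    rw [ha, lowVec_add, lowVec_add] at g1
    linear_combination (norm := abel) g1
  · rw [← g2, sub_dotProduct, lowVec_dotProduct, toU_sub]
    abel

/-- Computing f in both trivializations gives the same point of E', so the two lifts agree up to an
integral vector. -/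
theorem exists_z (T T' : L.LocalTriv) {x : X} (h : x ∈ T.W) (h' : x ∈ T'.W) :
    ∃ z : Fin n → ℤ, intVec z + T'.p x + C.a T.i T'.i x = C'.a T.i' T'.i' x + T.p x := by
  have e1 := T.f_eq x h 0
  have e2 := T'.f_eq x h' (0 + C.a T.i T'.i x)
  rw [← point_change T T' h h', e1, TDCocycle.point_eq (T.le' x h) (T'.le' x h'), ← Torus.mk_add]
    at e2
  obtain ⟨z, hz⟩ := Torus.mk_eq_iff.1 (TDCocycle.point_injective (T'.le' x h') e2)
  refine ⟨z, ?_⟩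
  linear_combination (norm := abel) - hz

variable [IsManifold (𝓡 d) ∞ X] [T2Space X] [SecondCountableTopology X]

theorem toHG_iso (L : LegEquiv C C') : C.toHG.Iso C'.toHG := by
  choose T hT using L.exists_localTriv
  have P : ∀ k l, Transition (T k) (T l) := fun k l => (nonempty_transition (T k) (T l)).some
  have hz : ∀ k l x, ∃ z : Fin n → ℤ, x ∈ (T k).W → x ∈ (T l).W →
      intVec z + (T l).p x + C.a (T k).i (T l).i x
        = C'.a (T k).i' (T l).i' x + (T k).p x := fun k l x => by
    by_cases h : x ∈ (T k).W ∧ x ∈ (T l).W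
    · obtain ⟨z, hz⟩ := exists_z (T k) (T l) h.1 h.2
      exact ⟨z, fun _ _ => hz⟩
    · exact ⟨0, fun h1 h2 => absurd ⟨h1, h2⟩ h⟩
  choose z hz using hz
  have sa : ∀ k l, ContMDiffOn (𝓡 d) 𝓘(ℝ, Fin n → ℝ) ∞ (C.a (T k).i (T l).i)
      ((T k).W ∩ (T l).W) := fun k l =>
    (C.a_smooth _ _).mono fun x hx => ⟨(T k).le x hx.1, (T l).le x hx.2⟩
  have sah : ∀ k l, ContMDiffOn (𝓡 d) 𝓘(ℝ, Fin n → ℝ) ∞ (C.ahat (T k).i (T l).i)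
      ((T k).W ∩ (T l).W) := fun k l =>
    (C.ahat_smooth _ _).mono fun x hx => ⟨(T k).le x hx.1, (T l).le x hx.2⟩
  have sa' : ∀ k l, ContMDiffOn (𝓡 d) 𝓘(ℝ, Fin n → ℝ) ∞ (C'.a (T k).i' (T l).i')
      ((T k).W ∩ (T l).W) := fun k l =>
    (C'.a_smooth _ _).mono fun x hx => ⟨(T k).le' x hx.1, (T l).le' x hx.2⟩
  have sah' : ∀ k l, ContMDiffOn (𝓡 d) 𝓘(ℝ, Fin n → ℝ) ∞ (C'.ahat (T k).i' (T l).i')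
      ((T k).W ∩ (T l).W) := fun k l =>
    (C'.ahat_smooth _ _).mono fun x hx => ⟨(T k).le' x hx.1, (T l).le' x hx.2⟩
  have sp : ∀ k l, ContMDiffOn (𝓡 d) 𝓘(ℝ, Fin n → ℝ) ∞ (T k).p ((T k).W ∩ (T l).W) :=
    fun k l => (T k).p_smooth.mono fun x hx => hx.1
  have sp' : ∀ k l, ContMDiffOn (𝓡 d) 𝓘(ℝ, Fin n → ℝ) ∞ (T l).p ((T k).W ∩ (T l).W) :=
    fun k l => (T l).p_smooth.mono fun x hx => hx.2
  -- The required equation for p̂ prescribes its differences on overlaps. The slope part of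
  -- `transition_cocycle` says that these form a cocycle.
  obtain ⟨ph, phs, hph⟩ := exists_cobounding (d := d) (W := fun k => (T k).W)
    (fun x => ⟨x, hT x⟩)
    (β := fun k l x => C'.ahat (T k).i' (T l).i' x - C.ahat (T k).i (T l).i x
      + matAct (T k).B (C.a (T k).i (T l).i x) - intVec ((P k l).zeta x))
    (fun k l => smooth_vsub (smooth_vadd (smooth_vsub (sah' k l) (sah k l))
      (smooth_matAct _ (sa k l))) (P k l).zeta_const.smooth_intVec)
    (fun k l m x hk hl hm => by
      have e1 := (transition_cocycle (P k l) (P l m) (P k m) hk hl hm).1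
      rw [← (P k l).B_eq x hk hl, C.a_eq _ _ _ x ((T k).le x hk) ((T l).le x hl) ((T m).le x hm),
        C.ahat_eq _ _ _ x ((T k).le x hk) ((T l).le x hl) ((T m).le x hm),
        C'.ahat_eq _ _ _ x ((T k).le' x hk) ((T l).le' x hl) ((T m).le' x hm), matAct_add,
        matAct_add]
      linear_combination (norm := abel) e1)
  -- The cover has one trivialization for each point of X. The matrix is D = -B because h jumps by
  -- -⟨m|B|v⟩_low. The products p·â' and a·p̂ in e absorb the terms a'·â', a·â and m̂'·p of the
  -- left-leg cocycles.
  refine ⟨⟨X, fun k => (T k).W, fun x => ⟨x, hT x⟩, fun k => (T k).i, fun k => (T k).i',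
    fun k => (T k).le, fun k => (T k).le', fun k _ => - (T k).B, fun k => (T k).p, ph, z,
    fun k l => (P k l).zeta, fun k l x => (P k l).e x
      - toU ((T k).p x ⬝ᵥ C'.ahat (T k).i' (T l).i' x) + toU (C.a (T k).i (T l).i x ⬝ᵥ ph l x),
    fun k x _ => Filter.Eventually.of_forall fun _ => rfl, fun k => (T k).p_smooth, phs,
    fun k l => ?_, fun k l => (P k l).zeta_const, fun k l => ?_, fun k l x hk hl => ?_,
    fun k l x => hz k l x, fun k l x hk hl => ?_, fun i j k x hi hj hk => ?_⟩⟩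
  · refine locConstOn_of_continuousOn ?_
    refine ((((sa' k l).continuousOn.add (sp k l).continuousOn).sub
      (sa k l).continuousOn).sub (sp' k l).continuousOn).congr fun x hx => ?_
    have := hz k l x hx.1 hx.2
    simp only [Pi.add_apply, Pi.sub_apply]
    linear_combination (norm := abel) this
  · exact ((P k l).e_smooth.sub (SmoothU1On.coe (smooth_dotProduct (sp k l) (sah' k l)))).add
      (SmoothU1On.coe (smooth_dotProduct (sa k l) ((phs l).mono fun x hx => hx.2)))
  · change - (T l).B + 0 = 0 + - (T k).B
    rw [(P k l).B_eq x hk hl, add_zero, zero_add]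
  · have h1 := hph k l x hk hl
    change intVec ((P k l).zeta x) + ph l x + matAct (-(T l).B : Matrix (Fin n) (Fin n) ℤ)
        (C.a (T k).i (T l).i x) + C.ahat (T k).i (T l).i x
      = C'.ahat (T k).i' (T l).i' x + matAct 0 ((T k).p x) + ph k x
    rw [matAct_neg_mat, matAct_mat_zero, ← (P k l).B_eq x hk hl]
    linear_combination (norm := abel) h1
  · have e1 := (transition_cocycle (P i j) (P j k) (P i k) hi hj hk).2
    have hBij := (P i j).B_eq x hi hj
    have hBik := (P i k).B_eq x hi hk
    have h1 := hph j k x hj hk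
    have h2 := hz i j x hi hj
    have ha := C.a_eq _ _ _ x ((T i).le x hi) ((T j).le x hj) ((T k).le x hk)
    have hah' := C'.ahat_eq _ _ _ x ((T i).le' x hi) ((T j).le' x hj) ((T k).le' x hk)
    have z1 := toU_lowForm_int (T i).B (C.m (T i).i (T j).i (T k).i x)
      (C.m (T i).i (T j).i (T k).i x)
    change C'.t (T i).i' (T j).i' (T k).i' x
        + toU (lowForm 0 (C'.a (T i).i' (T j).i' x) ((T i).p x))
        - toU (lowForm 0 (intVec (z i j x)) ((T j).p x + C.a (T i).i (T j).i x))
        + ((P i j).e x - toU ((T i).p x ⬝ᵥ C'.ahat (T i).i' (T j).i' x)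
          + toU (C.a (T i).i (T j).i x ⬝ᵥ ph j x))
        - toU (C'.ahat (T j).i' (T k).i' x ⬝ᵥ intVec (z i j x))
        - toU (lowForm 0 ((T j).p x) (C.a (T i).i (T j).i x))
        + ((P j k).e x - toU ((T j).p x ⬝ᵥ C'.ahat (T j).i' (T k).i' x)
          + toU (C.a (T j).i (T k).i x ⬝ᵥ ph k x))
      = ((P i k).e x - toU ((T i).p x ⬝ᵥ C'.ahat (T i).i' (T k).i' x)
          + toU (C.a (T i).i (T k).i x ⬝ᵥ ph k x))
        - toU (lowForm (-(T k).B : Matrix (Fin n) (Fin n) ℤ)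
          (intVec (C.m (T i).i (T j).i (T k).i x)) (C.a (T i).i (T k).i x))
        + C.t (T i).i (T j).i (T k).i x
        - toU (ph k x ⬝ᵥ intVec (C.m (T i).i (T j).i (T k).i x))
        - toU (lowForm (-(T k).B : Matrix (Fin n) (Fin n) ℤ) (C.a (T j).i (T k).i x)
          (C.a (T i).i (T j).i x))
    simp only [lowForm_mat_zero, lowForm_neg_mat, toU_zero, toU_neg]
    rw [← hBij] at h1
    rw [← hBik]
    -- The vector equations are paired with the vectors that occur in e; in U(1) the equation for t
    -- is then a linear combination of these, of the constant part of `transition_cocycle` and of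
    -- ⟨m|B|m⟩_low ∈ ℤ.
    have A1 := congrArg (· ⬝ᵥ ph k x) ha
    have A2 := congrArg ((T i).p x ⬝ᵥ ·) hah'
    have A3 := congrArg (· ⬝ᵥ C'.ahat (T j).i' (T k).i' x) h2
    have A4 := congrArg (C.a (T i).i (T j).i x ⬝ᵥ ·) h1
    have A6 := congrArg (lowForm (T i).B (intVec (C.m (T i).i (T j).i (T k).i x))) ha
    simp only [add_dotProduct, dotProduct_add, dotProduct_sub,
      dotProduct_matAct (T i).B.2, lowForm_add_right] at A1 A2 A3 A4 A6
    have c1 := dotProduct_comm (C'.ahat (T j).i' (T k).i' x) (intVec (z i j x))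
    have c2 := dotProduct_comm (ph k x) (intVec (C.m (T i).i (T j).i (T k).i x))
    have c3 := dotProduct_comm (intVec (C'.mhat (T i).i' (T j).i' (T k).i' x)) ((T i).p x)
    have c4 := dotProduct_comm (intVec ((P j k).zeta x)) (C.a (T i).i (T j).i x)
    rw [c3, c4] at e1
    rw [c1, c2]
    replace A1 := congrArg toU A1
    replace A2 := congrArg toU A2
    replace A3 := congrArg toU A3
    replace A4 := congrArg toU A4
    replace A6 := congrArg toU A6
    simp only [toU_add, toU_sub, lowForm_add_right] at A1 A2 A3 A4 A6 e1 ⊢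
    linear_combination (norm := abel) e1 - A1 + A2 - A3 - A4 - A6 - z1

end LegEquiv

end LegToHG

/-! ### From half-geometric correspondences to left legs -/

section HGToLeg

theorem smooth_lowForm_mat {E H M : Type*} [NormedAddCommGroup E] [NormedSpace ℝ E]
    [TopologicalSpace H] {I : ModelWithCorners ℝ E H} [TopologicalSpace M] [ChartedSpace H M] {n : ℕ}
    {S : Set M} {B : M → Matrix (Fin n) (Fin n) ℤ} {v w : M → (Fin n → ℝ)}
    (hB : ∀ p q, ContMDiffOn I 𝓘(ℝ, ℝ) ∞ (fun x => (B x p q : ℝ)) S)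
    (hv : ContMDiffOn I 𝓘(ℝ, Fin n → ℝ) ∞ v S) (hw : ContMDiffOn I 𝓘(ℝ, Fin n → ℝ) ∞ w S) :
    ContMDiffOn I 𝓘(ℝ, ℝ) ∞ (fun x => lowForm (B x) (v x) (w x)) S := by
  refine smooth_sum _ fun p => smooth_sum _ fun q => ?_
  by_cases h : q < p
  · simp only [if_pos h]
    exact smooth_mul (smooth_mul (hB p q) (smooth_coord hv p)) (smooth_coord hw q)
  · simp only [if_neg h]
    exact contMDiffOn_const

variable {d n : ℕ} {X : Type u} [TopologicalSpace X] [ChartedSpace (EuclideanSpace ℝ (Fin d)) X]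

/-- The data of an isomorphism between the half-geometric T-duality correspondences underlying two
T-duality correspondences. -/
structure TwistedEquiv (C C' : TDCocycle d n X) where
  κ : Type u
  W : κ → Opens X
  cover : ∀ x, ∃ k, x ∈ W k
  r : κ → C.ι
  r' : κ → C'.ι
  index_le : ∀ {k x}, x ∈ W k → x ∈ C.U (r k)
  index_le' : ∀ {k x}, x ∈ W k → x ∈ C'.U (r' k)
  D : κ → X → soZ n
  p : κ → X → (Fin n → ℝ)
  phat : κ → X → (Fin n → ℝ)
  z : κ → κ → X → (Fin n → ℤ)
  zhat : κ → κ → X → (Fin n → ℤ)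
  e : κ → κ → X → UnitAddCircle
  D_const : ∀ i, LocConstOn (D i) (W i)
  p_smooth : ∀ i, ContMDiffOn (𝓡 d) 𝓘(ℝ, Fin n → ℝ) ∞ (p i) (W i)
  phat_smooth : ∀ i, ContMDiffOn (𝓡 d) 𝓘(ℝ, Fin n → ℝ) ∞ (phat i) (W i)
  z_const : ∀ i j, LocConstOn (z i j) (W i ∩ W j)
  zhat_const : ∀ i j, LocConstOn (zhat i j) (W i ∩ W j)
  e_smooth : ∀ i j, SmoothU1On (𝓡 d) (e i j) (W i ∩ W j)
  D_eq : ∀ {i j x}, x ∈ W i → x ∈ W j → D j x = D i x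
  a_eq : ∀ i j x, x ∈ W i → x ∈ W j →
    intVec (z i j x) + p j x + C.a (r i) (r j) x = C'.a (r' i) (r' j) x + p i x
  ahat_eq : ∀ i j x, x ∈ W i → x ∈ W j →
    intVec (zhat i j x) + phat j x + matAct (D j x) (C.a (r i) (r j) x) + C.ahat (r i) (r j) x
      = C'.ahat (r' i) (r' j) x + phat i x
  t_eq : ∀ i j k x, x ∈ W i → x ∈ W j → x ∈ W k →
    C'.t (r' i) (r' j) (r' k) x + e i j x
        - toU (C'.ahat (r' j) (r' k) x ⬝ᵥ intVec (z i j x)) + e j k x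
      = e i k x
        - toU (lowForm (D k x) (intVec (C.m (r i) (r j) (r k) x)) (C.a (r i) (r k) x))
        + C.t (r i) (r j) (r k) x
        - toU (phat k x ⬝ᵥ intVec (C.m (r i) (r j) (r k) x))
        - toU (lowForm (D k x) (C.a (r j) (r k) x) (C.a (r i) (r j) x))

theorem TwistedEquiv.nonempty_iff (C C' : TDCocycle d n X) :
    Nonempty (TwistedEquiv C C') ↔ C.toHG.Iso C'.toHG := by
  constructor
  · rintro ⟨Q⟩
    refine ⟨⟨Q.κ, Q.W, Q.cover, Q.r, Q.r', fun _ _ => Q.index_le, fun _ _ => Q.index_le', Q.D, Q.p,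
      Q.phat, Q.z, Q.zhat, Q.e, Q.D_const, Q.p_smooth, Q.phat_smooth, Q.z_const, Q.zhat_const,
      Q.e_smooth, fun i j x hi hj => ?_, Q.a_eq, fun i j x hi hj => ?_,
      fun i j k x hi hj hk => ?_⟩⟩
    · change Q.D j x + 0 = 0 + Q.D i x
      rw [Q.D_eq hi hj, add_zero, zero_add]
    · refine (Q.ahat_eq i j x hi hj).trans ?_
      change _ = _ + matAct 0 _ + _
      rw [matAct_mat_zero, add_zero]
      rfl
    · have h := Q.t_eq i j k x hi hj hk
      refine Eq.trans ?_ h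
      change C'.t (Q.r' i) (Q.r' j) (Q.r' k) x
          + toU (lowForm 0 (C'.a (Q.r' i) (Q.r' j) x) (Q.p i x))
          - toU (lowForm 0 (intVec (Q.z i j x)) (Q.p j x + C.a (Q.r i) (Q.r j) x))
          + Q.e i j x - toU (C'.ahat (Q.r' j) (Q.r' k) x ⬝ᵥ intVec (Q.z i j x))
          - toU (lowForm 0 (Q.p j x) (C.a (Q.r i) (Q.r j) x)) + Q.e j k x = _
      simp only [lowForm_mat_zero, toU_zero, add_zero, sub_zero]
  · rintro ⟨Q⟩
    refine ⟨⟨Q.κ, Q.W, Q.cover, Q.r, Q.r', fun {k x} hk => Q.le k hk, fun {k x} hk => Q.le' k hk,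
      Q.D, Q.p, Q.phat, Q.z, Q.zhat, Q.e, Q.D_const, Q.p_smooth, Q.phat_smooth, Q.z_const,
      Q.zhat_const, Q.e_smooth, fun {i j x} hi hj => ?_, Q.a_eq, fun i j x hi hj => ?_,
      fun i j k x hi hj hk => ?_⟩⟩
    · have h : Q.D j x + 0 = 0 + Q.D i x := Q.B_eq i j x hi hj
      rwa [add_zero, zero_add] at h
    · refine (Q.ahat_eq i j x hi hj).trans ?_
      change C'.ahat (Q.r' i) (Q.r' j) x + matAct 0 (Q.p i x) + Q.phat i x
        = C'.ahat (Q.r' i) (Q.r' j) x + Q.phat i x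
      rw [matAct_mat_zero, add_zero]
    · have h := Q.t_eq i j k x hi hj hk
      refine Eq.trans ?_ h
      change _ = C'.t (Q.r' i) (Q.r' j) (Q.r' k) x
          + toU (lowForm 0 (C'.a (Q.r' i) (Q.r' j) x) (Q.p i x))
          - toU (lowForm 0 (intVec (Q.z i j x)) (Q.p j x + C.a (Q.r i) (Q.r j) x))
          + Q.e i j x - toU (C'.ahat (Q.r' j) (Q.r' k) x ⬝ᵥ intVec (Q.z i j x))
          - toU (lowForm 0 (Q.p j x) (C.a (Q.r i) (Q.r j) x)) + Q.e j k x
      simp only [lowForm_mat_zero, toU_zero, add_zero, sub_zero]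

namespace TwistedEquiv

variable {C C' : TDCocycle d n X} (Q : TwistedEquiv C C')

/-- The formula over `W k` for the isomorphism of the underlying torus bundles. -/
noncomputable def legMapOn (k : Q.κ) (y : C.Total) : C'.Total :=
  C'.point (Q.r' k) (C.totalProj y)
    (C.coord (Q.r k) y + Torus.mk (Q.p k (C.totalProj y)))

/-- This is the equation for a and p read modulo ℤⁿ, where the integral z disappears. -/
theorem legMapOn_eq {k l : Q.κ} {y : C.Total} (hk : C.totalProj y ∈ Q.W k)
    (hl : C.totalProj y ∈ Q.W l) : Q.legMapOn k y = Q.legMapOn l y := by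
  have h1 : intVec (Q.z k l _) + Q.p l _ + C.a (Q.r k) (Q.r l) _
    = C'.a (Q.r' k) (Q.r' l) _ + Q.p k _ := Q.a_eq k l _ hk hl
  rw [legMapOn, legMapOn, TDCocycle.point_eq (Q.index_le' hk) (Q.index_le' hl),
    C.coord_change _ _ y (Q.index_le hk) (Q.index_le hl)]
  congr 1
  have h2 := congrArg Torus.mk h1
  rw [Torus.mk_add, Torus.mk_add, Torus.mk_add, Torus.mk_intVec, zero_add] at h2
  linear_combination (norm := abel) - h2

/-- The isomorphism of the underlying torus bundles. -/
noncomputable def legMap (y : C.Total) : C'.Total :=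
  Q.legMapOn (Q.cover (C.totalProj y)).choose y

theorem legMap_eq {k : Q.κ} {y : C.Total} (hk : C.totalProj y ∈ Q.W k) :
    Q.legMap y = Q.legMapOn k y :=
  Q.legMapOn_eq (Q.cover (C.totalProj y)).choose_spec hk

theorem totalProj_legMap (y : C.Total) : C'.totalProj (Q.legMap y) = C.totalProj y :=
  TDCocycle.totalProj_point _ _ _

theorem legMap_vadd (b : Torus n) (y : C.Total) : Q.legMap (b +ᵥ y) = b +ᵥ Q.legMap y := by
  obtain ⟨k, hk⟩ := Q.cover (C.totalProj y)
  have hp : C.totalProj (b +ᵥ y) = C.totalProj y := C.bundle.proj_vadd b y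
  rw [Q.legMap_eq hk, Q.legMap_eq (hp ▸ hk : C.totalProj (b +ᵥ y) ∈ Q.W k), legMapOn, legMapOn,
    TDCocycle.vadd_point, hp, TDCocycle.coord_vadd (Q.index_le hk), add_assoc]

theorem legMap_point {i : C.ι} {i' : C'.ι} {k : Q.κ} {x : X} (hi : x ∈ C.U i) (hi' : x ∈ C'.U i')
    (hk : x ∈ Q.W k) (b : Torus n) :
    Q.legMap (C.point i x b) = C'.point i' x (b + Torus.mk (C.a i (Q.r k) x) + Torus.mk (Q.p k x)
      + Torus.mk (C'.a (Q.r' k) i' x)) := by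
  have hp : C.totalProj (C.point i x b) = x := TDCocycle.totalProj_point _ _ _
  rw [Q.legMap_eq (hp.symm ▸ hk : C.totalProj (C.point i x b) ∈ Q.W k), legMapOn, hp,
    TDCocycle.coord_point hi (Q.index_le hk), TDCocycle.point_eq (Q.index_le' hk) hi']

theorem legMap_smooth (i : C.ι) (i' : C'.ι) : ∃ h : X → Torus n,
    (∀ p, SmoothU1On (𝓡 d) (fun x => h x p) (C.U i ∩ C'.U i')) ∧
    ∀ x, x ∈ C.U i → x ∈ C'.U i' → Q.legMap (C.point i x 0) = C'.point i' x (h x) := by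
  refine ⟨fun x => C'.coord i' (Q.legMap (C.point i x 0)), fun p => SmoothU1On.of_local ?_,
    fun x hi hi' => ?_⟩
  · rintro x ⟨hi, hi'⟩
    obtain ⟨k, hk⟩ := Q.cover x
    refine ⟨fun x => toU ((C.a i (Q.r k) x + Q.p k x + C'.a (Q.r' k) i' x) p), Q.W k,
      (Q.W k).isOpen.mem_nhds hk, SmoothU1On.coe (smooth_coord (smooth_vadd (smooth_vadd ?_ ?_) ?_) p),
      fun y hy => ?_⟩
    · exact (C.a_smooth i (Q.r k)).mono fun y hy => ⟨hy.2.1, Q.index_le hy.1⟩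
    · exact (Q.p_smooth k).mono fun y hy => hy.1
    · exact (C'.a_smooth (Q.r' k) i').mono fun y hy => ⟨Q.index_le' hy.1, hy.2.2⟩
    · dsimp only
      rw [Q.legMap_point hy.2.1 hy.2.2 hy.1, TDCocycle.coord_point_self hy.2.2, zero_add,
        ← Torus.mk_add, ← Torus.mk_add]
      rfl
  · obtain ⟨k, hk⟩ := Q.cover x
    dsimp only
    rw [Q.legMap_point hi hi' hk, TDCocycle.coord_point_self hi']

/-- The part of `E|_{W k}` where the coordinates differ from those of `w` by less than `1/2`. -/
def legCover (s : Q.κ × (Fin n → ℝ)) : Set C.Total :=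
  {y | C.totalProj y ∈ Q.W s.1 ∧
    ∀ p, ((AddCircle.toCircle (C.coord (Q.r s.1) y p - toU (s.2 p)) : Circle) : ℂ) ∈
      Complex.slitPlane}

/-- Real-valued coordinates over `legCover`. -/
noncomputable def legCoord (s : Q.κ × (Fin n → ℝ)) (y : C.Total) : Fin n → ℝ :=
  fun p => s.2 p + argLift (C.coord (Q.r s.1) y p - toU (s.2 p))

theorem mk_legCoord (s : Q.κ × (Fin n → ℝ)) (y : C.Total) :
    Torus.mk (Q.legCoord s y) = C.coord (Q.r s.1) y := by
  funext p
  change toU (_ + _) = _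
  rw [toU_add, toU_argLift]
  abel

theorem mem_legCover_point {i : C.ι} {x : X} (hi : x ∈ C.U i) (b : Torus n)
    (s : Q.κ × (Fin n → ℝ)) : C.point i x b ∈ Q.legCover s ↔ x ∈ Q.W s.1 ∧
      ∀ p, ((AddCircle.toCircle (b p + toU (C.a i (Q.r s.1) x p) - toU (s.2 p)) : Circle) : ℂ) ∈
        Complex.slitPlane := by
  rw [legCover, Set.mem_ofPred_eq, TDCocycle.totalProj_point]
  refine and_congr_right fun hk => ?_
  rw [TDCocycle.coord_point hi (Q.index_le hk)]
  rfl

theorem isOpen_legCover (s : Q.κ × (Fin n → ℝ)) (i : C.ι) :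
    IsOpen {q : X × Torus n | q.1 ∈ C.U i ∧ C.point i q.1 q.2 ∈ Q.legCover s} := by
  set O : Set (X × Torus n) := {q | q.1 ∈ (C.U i : Set X) ∩ Q.W s.1} with hO
  have hOo : IsOpen O := ((C.U i).isOpen.inter (Q.W s.1).isOpen).preimage continuous_fst
  have hc : ∀ p, ContinuousOn (fun q : X × Torus n => ((AddCircle.toCircle
      (q.2 p + toU (C.a i (Q.r s.1) q.1 p) - toU (s.2 p)) : Circle) : ℂ)) O := fun p => by
    have h1 : ContinuousOn (fun q : X × Torus n => C.a i (Q.r s.1) q.1) O :=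
      (C.a_smooth i (Q.r s.1)).continuousOn.comp continuous_fst.continuousOn
        fun q hq => ⟨hq.1, Q.index_le hq.2⟩
    have h2 : ContinuousOn (fun q : X × Torus n => toU (C.a i (Q.r s.1) q.1 p)) O :=
      (AddCircle.continuous_mk' 1).comp_continuousOn ((continuous_apply p).comp_continuousOn h1)
    have h3 : ContinuousOn (fun q : X × Torus n => q.2 p) O :=
      ((continuous_apply p).comp continuous_snd).continuousOn
    exact (continuous_subtype_val.comp AddCircle.continuous_toCircle).comp_continuousOn
      ((h3.add h2).sub continuousOn_const)
  have h := isOpen_iInter_of_finite fun p =>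
    (hc p).isOpen_inter_preimage hOo Complex.isOpen_slitPlane
  convert hOo.inter h using 1
  ext q
  simp only [Set.mem_ofPred_eq, Set.mem_inter_iff, Set.mem_iInter, Set.mem_preimage]
  constructor
  · rintro ⟨hi, hq⟩
    obtain ⟨h1, h2⟩ := (Q.mem_legCover_point hi q.2 s).1 hq
    exact ⟨⟨hi, h1⟩, fun p => ⟨⟨hi, h1⟩, h2 p⟩⟩
  · rintro ⟨⟨hi, h1⟩, h2⟩
    exact ⟨hi, (Q.mem_legCover_point hi q.2 s).2 ⟨h1, fun p => (h2 p).2⟩⟩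

theorem exists_mem_legCover (y : C.Total) : ∃ s, y ∈ Q.legCover s := by
  obtain ⟨k, hk⟩ := Q.cover (C.totalProj y)
  choose w hw using fun p => toU_surjective (C.coord (Q.r k) y p)
  refine ⟨(k, w), hk, fun p => ?_⟩
  rw [hw p, sub_self, AddCircle.toCircle_zero]
  exact Complex.one_mem_slitPlane

theorem legCoord_smooth (s : Q.κ × (Fin n → ℝ)) (i : C.ι) :
    ContMDiffOn (prodModel d n) 𝓘(ℝ, Fin n → ℝ) ∞
      (fun q : X × (Fin n → ℝ) => Q.legCoord s (C.point i q.1 (Torus.mk q.2)))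
      {q | q.1 ∈ C.U i ∧ C.point i q.1 (Torus.mk q.2) ∈ Q.legCover s} := by
  refine contMDiffOn_pi_space.2 fun p => smooth_add contMDiffOn_const ?_
  refine SmoothU1On.argLift ?_ fun q hq => hq.2.2 p
  have h1 : ContMDiffOn (prodModel d n) 𝓘(ℝ, Fin n → ℝ) ∞
      (fun q : X × (Fin n → ℝ) => q.2 + C.a i (Q.r s.1) q.1)
      {q | q.1 ∈ C.U i ∧ C.point i q.1 (Torus.mk q.2) ∈ Q.legCover s} :=
    smooth_vadd contMDiff_fibre.contMDiffOn ((C.a_smooth i (Q.r s.1)).comp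
      contMDiff_base.contMDiffOn fun q hq =>
        ⟨hq.1, Q.index_le ((Q.mem_legCover_point hq.1 _ s).1 hq.2).1⟩)
  refine ((SmoothU1On.coe (smooth_coord h1 p)).sub (SmoothU1On.const (toU (s.2 p)) _)).congr
    fun q hq => ?_
  rw [TDCocycle.coord_point hq.1 (Q.index_le ((Q.mem_legCover_point hq.1 _ s).1 hq.2).1),
    ← Torus.mk_add]
  rfl

/-- The Čech cochain that compares the two bundle gerbes. -/
noncomputable def legCochain (s t : Q.κ × (Fin n → ℝ)) (y : C.Total) : UnitAddCircle :=
  let x := C.totalProj y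
  let a := C.a (Q.r s.1) (Q.r t.1) x
  let b := Q.legCoord s y
  let b' := Q.legCoord t y
  -- The products a·p̂ and p·â' are those of the converse direction. The terms in b need real
  -- coordinates; b' - b - a is integral, and the last term makes up for the independent choices of
  -- b and b'.
  toU (a ⬝ᵥ Q.phat t.1 x + -(Q.p s.1 x ⬝ᵥ C'.ahat (Q.r' s.1) (Q.r' t.1) x
      + intVec (Q.zhat s.1 t.1 x) ⬝ᵥ b + lowForm (Q.D s.1 x) b a
      + lowForm (Q.D s.1 x) (b' - b - a) b')) - Q.e s.1 t.1 x

theorem legCochain_smooth (s t : Q.κ × (Fin n → ℝ)) (i : C.ι) : SmoothU1On (prodModel d n)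
    (fun q : X × (Fin n → ℝ) => Q.legCochain s t (C.point i q.1 (Torus.mk q.2)))
    {q | q.1 ∈ C.U i ∧ C.point i q.1 (Torus.mk q.2) ∈ Q.legCover s ∩ Q.legCover t} := by
  set S : Set (X × (Fin n → ℝ)) :=
    {q | q.1 ∈ C.U i ∧ C.point i q.1 (Torus.mk q.2) ∈ Q.legCover s ∩ Q.legCover t}
  have hb : ContMDiffOn (prodModel d n) (𝓡 d) ∞ (fun q : X × (Fin n → ℝ) => q.1) S :=
    contMDiff_base.contMDiffOn
  have hs : ∀ q ∈ S, q.1 ∈ Q.W s.1 := fun q hq => ((Q.mem_legCover_point hq.1 _ s).1 hq.2.1).1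
  have ht : ∀ q ∈ S, q.1 ∈ Q.W t.1 := fun q hq => ((Q.mem_legCover_point hq.1 _ t).1 hq.2.2).1
  have s1 := (Q.legCoord_smooth s i).mono (t := S) fun q hq => ⟨hq.1, hq.2.1⟩
  have s2 := (Q.legCoord_smooth t i).mono (t := S) fun q hq => ⟨hq.1, hq.2.2⟩
  have s3 := (C.a_smooth (Q.r s.1) (Q.r t.1)).comp hb fun q hq =>
    ⟨Q.index_le (hs q hq), Q.index_le (ht q hq)⟩
  have s4 := (C'.ahat_smooth (Q.r' s.1) (Q.r' t.1)).comp hb fun q hq =>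
    ⟨Q.index_le' (hs q hq), Q.index_le' (ht q hq)⟩
  have s5 := (Q.p_smooth s.1).comp hb hs
  have s6 := (Q.phat_smooth t.1).comp hb ht
  have s7 := ((Q.zhat_const s.1 t.1).smooth_intVec (I := 𝓡 d)).comp hb
    fun q hq => ⟨hs q hq, ht q hq⟩
  have s8 : SmoothU1On (prodModel d n) (fun q : X × (Fin n → ℝ) => Q.e s.1 t.1 q.1) S :=
    (Q.e_smooth s.1 t.1).comp hb fun q hq => ⟨hs q hq, ht q hq⟩
  have s9 : ∀ p q, ContMDiffOn (prodModel d n) 𝓘(ℝ, ℝ) ∞ (fun y : X × (Fin n → ℝ) =>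
      (((Q.D s.1 y.1 : Matrix (Fin n) (Fin n) ℤ) p q : ℤ) : ℝ)) S := fun p q =>
    (((Q.D_const s.1).map fun B => (B : Matrix (Fin n) (Fin n) ℤ) p q).smooth (I := 𝓡 d)).comp
      hb hs
  have key := (SmoothU1On.coe (smooth_add (smooth_dotProduct s3 s6)
    (contDiff_neg.contMDiff.comp_contMDiffOn (smooth_add (smooth_add (smooth_add
      (smooth_dotProduct s5 s4) (smooth_dotProduct s7 s1)) (smooth_lowForm_mat s9 s1 s3))
      (smooth_lowForm_mat s9 (smooth_vsub (smooth_vsub s2 s1) s3) s2))))).sub s8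
  refine key.congr fun q hq => ?_
  simp only [legCochain, TDCocycle.totalProj_point, Function.comp_apply]

/-- In real coordinates both gerbe cocycles are explicit. At a fixed point the claim is a bilinear
identity between vectors, valid up to pairings of integral vectors. -/
theorem legCochain_eq (s t u : Q.κ × (Fin n → ℝ)) (y : C.Total) (hs : y ∈ Q.legCover s)
    (ht : y ∈ Q.legCover t) (hu : y ∈ Q.legCover u) :
    C'.legCocycle (Q.r' s.1) (Q.r' t.1) (Q.r' u.1) (Q.legMap y) + Q.legCochain s t y
        + Q.legCochain t u y
      = Q.legCochain s u y + C.legCocycle (Q.r s.1) (Q.r t.1) (Q.r u.1) y := by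
  set x := C.totalProj y with hx
  have hk := hs.1
  have hl := ht.1
  have hm := hu.1
  rw [← hx] at hk hl hm
  have uk := Q.index_le hk
  have ul := Q.index_le hl
  have um := Q.index_le hm
  have uk' := Q.index_le' hk
  have ul' := Q.index_le' hl
  have um' := Q.index_le' hm
  have ey : y = C.point (Q.r s.1) x (Torus.mk (Q.legCoord s y)) := by
    rw [mk_legCoord, hx, TDCocycle.point_coord uk]
  have ec := C.legCocycle_point uk (Q.r t.1) (Q.r u.1) (Q.legCoord s y)
  have ec' := C'.legCocycle_point uk' (Q.r' t.1) (Q.r' u.1) (Q.legCoord s y + Q.p s.1 x)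
  have ef : C'.point (Q.r' s.1) x (Torus.mk (Q.legCoord s y + Q.p s.1 x)) = Q.legMap y := by
    rw [Q.legMap_eq hk, legMapOn, Torus.mk_add, mk_legCoord]
  rw [← ey] at ec
  rw [ef] at ec'
  rw [ec, ec']
  -- The real coordinates transform by a only up to an integral vector, which records the choice of
  -- branches.
  have hmu : ∀ {s t : Q.κ × (Fin n → ℝ)}, x ∈ Q.W s.1 → x ∈ Q.W t.1 →
      ∃ μ : Fin n → ℤ, Q.legCoord t y = intVec μ + (Q.legCoord s y + C.a (Q.r s.1) (Q.r t.1) x) := by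
    intro s t hk hl
    apply Torus.mk_eq_iff.1
    rw [Torus.mk_add, mk_legCoord, mk_legCoord,
      C.coord_change _ _ y (Q.index_le hk) (Q.index_le hl)]
  obtain ⟨μ, hμ⟩ := hmu hk hl
  obtain ⟨ν, hν⟩ := hmu hl hm
  have ha := C.a_eq _ _ _ x uk ul um
  have hah := C.ahat_eq _ _ _ x uk ul um
  have hah' := C'.ahat_eq _ _ _ x uk' ul' um'
  have hz : intVec (Q.z s.1 t.1 x) + Q.p t.1 x + C.a (Q.r s.1) (Q.r t.1) x
    = C'.a (Q.r' s.1) (Q.r' t.1) x + Q.p s.1 x := Q.a_eq s.1 t.1 x hk hl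
  have hzh : ∀ {k l}, x ∈ Q.W k → x ∈ Q.W l → intVec (Q.zhat k l x) + Q.phat l x
        + matAct (Q.D s.1 x) (C.a (Q.r k) (Q.r l) x) + C.ahat (Q.r k) (Q.r l) x
      = C'.ahat (Q.r' k) (Q.r' l) x + Q.phat k x := fun {k l} hk' hl' => by
    rw [← Q.D_eq hk hl']
    exact Q.ahat_eq k l x hk' hl'
  have h1 := hzh hk hl
  have h2 := hzh hl hm
  have h3 := hzh hk hm
  have te := Q.t_eq s.1 t.1 u.1 x hk hl hm
  rw [Q.D_eq hk hm] at te
  simp only [legCochain, ← hx, Q.D_eq hk hl]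
  have hB := (Q.D s.1 x).2
  generalize (Q.D s.1 x : Matrix (Fin n) (Fin n) ℤ) = B at *
  generalize Q.legCoord s y = b at *
  generalize Q.legCoord t y = b₂ at *
  generalize Q.legCoord u y = b₃ at *
  generalize C.m (Q.r s.1) (Q.r t.1) (Q.r u.1) x = m at *
  generalize C.mhat (Q.r s.1) (Q.r t.1) (Q.r u.1) x = mh at *
  generalize C'.mhat (Q.r' s.1) (Q.r' t.1) (Q.r' u.1) x = mh' at *
  generalize C.a (Q.r s.1) (Q.r t.1) x = a₁ at *
  generalize C.a (Q.r t.1) (Q.r u.1) x = a₂ at *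
  generalize C.a (Q.r s.1) (Q.r u.1) x = a₃ at *
  generalize C.ahat (Q.r s.1) (Q.r t.1) x = h₁ at *
  generalize C.ahat (Q.r t.1) (Q.r u.1) x = h₂ at *
  generalize C.ahat (Q.r s.1) (Q.r u.1) x = h₃ at *
  generalize C'.ahat (Q.r' s.1) (Q.r' t.1) x = h₁' at *
  generalize C'.ahat (Q.r' t.1) (Q.r' u.1) x = h₂' at *
  generalize C'.ahat (Q.r' s.1) (Q.r' u.1) x = h₃' at *
  generalize C'.a (Q.r' s.1) (Q.r' t.1) x = a₁' at *
  generalize Q.zhat s.1 t.1 x = zh₁ at *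
  generalize Q.zhat t.1 u.1 x = zh₂ at *
  generalize Q.zhat s.1 u.1 x = zh₃ at *
  generalize Q.z s.1 t.1 x = z₁ at *
  generalize Q.p s.1 x = p₁ at *
  generalize Q.p t.1 x = p₂ at *
  generalize Q.phat s.1 x = ph₁ at *
  generalize Q.phat t.1 x = ph₂ at *
  generalize Q.phat u.1 x = ph₃ at *
  have hζ : intVec zh₃ - intVec zh₁ - intVec zh₂ = intVec mh' - intVec mh - matAct B (intVec m) := by
    rw [ha, hah, hah', matAct_add, matAct_add] at h3
    linear_combination (norm := abel) h3 - h1 - h2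
  -- The three integral pairings by which the real identity `key` differs from the desired one.
  have i1 := toU_lowForm_int B μ ν
  have i2 := toU_lowForm_int B m (μ + ν - m)
  have i3 := toU_eq_zero_iff.2 (dotProduct_int zh₂ μ)
  have e1 : b₂ - b - a₁ = intVec μ := by rw [hμ]; abel
  have e2 : b₃ - b₂ - a₂ = intVec ν := by rw [hν]; abel
  have e3 : b₃ - b - a₃ = intVec μ + intVec ν - intVec m := by rw [hν, hμ, ha]; abel
  have e4 : b₃ = intVec (μ + ν - m) + (b + a₃) := by
    have : intVec (μ + ν - m) = intVec μ + intVec ν - intVec m := by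
      ext p; simp [intVec]
    rw [this, ← e3]; abel
  have e5 : b₃ - b₂ = intVec ν + a₂ := by rw [← e2]; abel
  have m1 : lowForm B (intVec μ) b₃ - lowForm B (intVec μ) b₂
      = lowForm B (intVec μ) (intVec ν) + lowForm B (intVec μ) a₂ := by
    rw [← lowForm_sub_right, e5, lowForm_add_right]
  have m2 := congrArg (lowForm B (intVec m)) e4
  have m3 := congrArg (lowForm B b) ha
  have m4 := congrArg (lowForm B · a₂) hμ
  have m5 := congrArg (intVec zh₂ ⬝ᵥ ·) hμ
  have m6 := congrArg (· ⬝ᵥ b) hζ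
  have m7 := dotProduct_matAct hB b (intVec m)
  have m8 := congrArg (a₁ ⬝ᵥ ·) h2
  have m9 := congrArg (p₁ ⬝ᵥ ·) hah'
  have m10 := congrArg (· ⬝ᵥ ph₃) ha
  have m11 := congrArg (· ⬝ᵥ h₂') hz
  have m12 := dotProduct_matAct hB a₁ a₂
  have c1 := dotProduct_comm b (matAct B (intVec m))
  have c2 := dotProduct_comm ph₃ (intVec m)
  have c3 := dotProduct_comm h₂' (intVec z₁)
  have c4 := dotProduct_comm a₁ (intVec zh₂)
  have c5 := dotProduct_comm p₁ (intVec mh')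
  rw [e1, e2, e3]
  simp only [add_dotProduct, sub_dotProduct, dotProduct_add, lowForm_add_right, lowForm_add_left]
    at m1 m2 m3 m4 m5 m6 m8 m9 m10 m11
  have key : a₁ ⬝ᵥ ph₂ + -(p₁ ⬝ᵥ h₁' + intVec zh₁ ⬝ᵥ b + lowForm B b a₁ + lowForm B (intVec μ) b₂)
      + (a₂ ⬝ᵥ ph₃ + -(p₂ ⬝ᵥ h₂' + intVec zh₂ ⬝ᵥ b₂ + lowForm B b₂ a₂ + lowForm B (intVec ν) b₃))
      - (a₃ ⬝ᵥ ph₃ + -(p₁ ⬝ᵥ h₃' + intVec zh₃ ⬝ᵥ b + lowForm B b a₃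
          + lowForm B (intVec μ + intVec ν - intVec m) b₃))
      = intVec mh' ⬝ᵥ (b + p₁) - a₁' ⬝ᵥ h₂' - intVec mh ⬝ᵥ b + a₁ ⬝ᵥ h₂
        + h₂' ⬝ᵥ intVec z₁ - lowForm B (intVec m) a₃ - ph₃ ⬝ᵥ intVec m - lowForm B a₂ a₁
        + lowForm B (intVec μ) (intVec ν) - lowForm B (intVec m) (intVec (μ + ν - m))
        - intVec zh₂ ⬝ᵥ intVec μ := by
    rw [lowForm_sub_left, lowForm_add_left, dotProduct_add]
    linarith
  have key' := congrArg toU key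
  simp only [toU_add, toU_sub, toU_neg] at key' te i1 i2 i3 ⊢
  linear_combination (norm := abel) key' - te + i1 - i2 - i3

/-- The isomorphism of left legs. -/
noncomputable def legEquiv : LegEquiv C C' where
  f := Q.legMap
  f_proj := Q.totalProj_legMap
  f_vadd := Q.legMap_vadd
  f_smooth := Q.legMap_smooth
  σ := Q.κ × (Fin n → ℝ)
  W := Q.legCover
  W_open := Q.isOpen_legCover
  W_cover := Q.exists_mem_legCover
  r := fun s => Q.r s.1
  r' := fun s => Q.r' s.1
  le := fun _ _ h => Q.index_le h.1
  le' := fun _ _ h => Q.index_le' h.1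
  e := Q.legCochain
  e_smooth := Q.legCochain_smooth
  c_eq := Q.legCochain_eq

end TwistedEquiv

end HGToLeg

/-! ### Restriction to connected components -/

theorem LocConstOn.mono {Z α : Type*} [TopologicalSpace Z] {f : Z → α} {S T : Set Z}
    (hf : LocConstOn f S) (h : T ⊆ S) : LocConstOn f T := fun x hx =>
  (hf x (h hx)).filter_mono (nhdsWithin_mono x h)

/-- The family of cochains on a disjoint union of index sets that vanishes on pairs of indices from
different summands. -/
noncomputable def sigmaCochain {ι : Type*} {κ : ι → Type*} {α Z : Type*} [Zero α]
    (F : ∀ c, κ c → κ c → Z → α) (s t : Σ c, κ c) : Z → α :=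
  open Classical in if h : s.1 = t.1 then F t.1 (h ▸ s.2) t.2 else 0

theorem sigmaCochain_same {ι : Type*} {κ : ι → Type*} {α Z : Type*} [Zero α]
    (F : ∀ c, κ c → κ c → Z → α) (c : ι) (k l : κ c) : sigmaCochain F ⟨c, k⟩ ⟨c, l⟩ = F c k l := by
  simp [sigmaCochain]

section Components

variable {d n : ℕ} {X : Type u} [TopologicalSpace X] [ChartedSpace (EuclideanSpace ℝ (Fin d)) X]

theorem isOpen_component (d : ℕ) {X : Type u} [TopologicalSpace X]
    [ChartedSpace (EuclideanSpace ℝ (Fin d)) X] (x : X) : IsOpen (connectedComponent x) := by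
  have : LocallyConnectedSpace X := ChartedSpace.locallyConnectedSpace (EuclideanSpace ℝ (Fin d)) X
  exact isOpen_connectedComponent

/-- The two arguments differ by the integral m, and ⟨m|B|m⟩_low is an integer. This reconciles the
term in half-geometric isomorphisms with the one in the push-forward. -/
theorem TDCocycle.toU_lowForm_a (C : TDCocycle d n X) (B : Matrix (Fin n) (Fin n) ℤ) {i j k : C.ι}
    {x : X} (hi : x ∈ C.U i) (hj : x ∈ C.U j) (hk : x ∈ C.U k) :
    toU (lowForm B (intVec (C.m i j k x)) (C.a i k x))
      = toU (lowForm B (intVec (C.m i j k x)) (C.a j k x + C.a i j x)) := by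
  rw [C.a_eq i j k x hi hj hk, add_assoc, lowForm_add_right, toU_add, toU_lowForm_int, zero_add]

namespace TwistedEquiv

variable {C C' : TDCocycle d n X}

/-- The matrices agree on overlaps and so define one locally constant function on X. -/
theorem exists_constant_D (Q : TwistedEquiv C C') (x₀ : X) : ∃ B : soZ n,
    ∀ k, ∀ x ∈ Q.W k, x ∈ connectedComponent x₀ → Q.D k x = B := by
  choose k hk using Q.cover
  have hloc : IsLocallyConstant fun x => Q.D (k x) x := by
    refine (IsLocallyConstant.iff_eventually_eq _).2 fun x => ?_
    have h1 := Q.D_const (k x) x (hk x)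
    rw [(Q.W (k x)).isOpen.nhdsWithin_eq (hk x)] at h1
    filter_upwards [h1, (Q.W (k x)).isOpen.mem_nhds (hk x)] with y hy hy'
    rw [← hy, Q.D_eq hy' (hk y)]
  refine ⟨Q.D (k x₀) x₀, fun l x hl hx => ?_⟩
  rw [Q.D_eq (hk x) hl]
  exact hloc.apply_eq_of_isPreconnected isPreconnected_connectedComponent hx mem_connectedComponent

/-- For constant D = B, the terms with D are precisely the changes of â and t under the push-forward
along B; all other data are kept. -/
theorem exists_isoOn_component (Q : TwistedEquiv C C') (x₀ : X) :
    ∃ B : soZ n, (C.push B).IsoOn C' (connectedComponent x₀) := by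
  obtain ⟨B, hB⟩ := Q.exists_constant_D x₀
  refine ⟨B, ⟨⟨Q.κ, fun k => Q.W k ⊓ ⟨connectedComponent x₀, isOpen_component d x₀⟩, ?_, Q.r, Q.r',
    fun k x hx => Q.index_le hx.1, fun k x hx => Q.index_le' hx.1, Q.p, Q.phat, Q.z, Q.zhat, Q.e,
    fun k => (Q.p_smooth k).mono fun x hx => hx.1, fun k => (Q.phat_smooth k).mono fun x hx => hx.1,
    fun k l => ?_, fun k l => ?_, fun k l => (Q.e_smooth k l).mono fun x hx => ⟨hx.1.1, hx.2.1⟩,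
    fun k l x hk hl => (Q.a_eq k l x hk.1 hl.1).symm, fun k l x hk hl => ?_,
    fun i j k x hi hj hk => ?_⟩⟩⟩
  · ext x
    rw [Set.mem_iUnion]
    refine ⟨fun ⟨k, hk⟩ => hk.2, fun hx => ?_⟩
    obtain ⟨k, hk⟩ := Q.cover x
    exact ⟨k, hk, hx⟩
  · exact (Q.z_const k l).mono fun x hx => ⟨hx.1.1, hx.2.1⟩
  · exact (Q.zhat_const k l).mono fun x hx => ⟨hx.1.1, hx.2.1⟩
  · have h := Q.ahat_eq k l x hk.1 hl.1
    rw [hB l x hl.1 hl.2] at h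
    change _ = _ + (matAct B (C.a (Q.r k) (Q.r l) x) + C.ahat (Q.r k) (Q.r l) x)
    rw [← h]
    abel
  · have h := Q.t_eq i j k x hi.1 hj.1 hk.1
    rw [hB k x hk.1 hk.2, C.toU_lowForm_a B (Q.index_le hi.1) (Q.index_le hj.1)
      (Q.index_le hk.1)] at h
    refine h.trans ?_
    change _ = Q.e i k x + (C.t (Q.r i) (Q.r j) (Q.r k) x
      - toU (lowForm B (intVec (C.m (Q.r i) (Q.r j) (Q.r k) x))
        (C.a (Q.r j) (Q.r k) x + C.a (Q.r i) (Q.r j) x))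
      - toU (lowForm B (C.a (Q.r j) (Q.r k) x) (C.a (Q.r i) (Q.r j) x)))
      - toU (Q.phat k x ⬝ᵥ intVec (C.m (Q.r i) (Q.r j) (Q.r k) x))
    abel

end TwistedEquiv

/-- The covers of the components are united. Sets over different components are disjoint, so no
condition links the different matrices. -/
theorem TwistedEquiv.nonempty_of_components {C C' : TDCocycle d n X}
    (h : ∀ x : X, ∃ B : soZ n, (C.push B).IsoOn C' (connectedComponent x)) :
    Nonempty (TwistedEquiv C C') := by
  choose B hB using h
  -- One base point is chosen per component, so that each component gets a single matrix and a
  -- single isomorphism.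
  have Q : ∀ c : ConnectedComponents X, TDCocycle.Equiv (C.push (B c.out)) C'
    (connectedComponent c.out) := fun c => (hB c.out).some
  have hmem : ∀ {c k x}, x ∈ (Q c).W k → (x : ConnectedComponents X) = c := fun {c k x} hx => by
    have h1 : x ∈ connectedComponent c.out := (Q c).cover ▸ Set.mem_iUnion.2 ⟨k, hx⟩
    exact (ConnectedComponents.coe_eq_coe'.2 h1).trans
      (Quotient.out_eq' c)
  have hsame : ∀ {c k c' k' x}, x ∈ (Q c).W k → x ∈ (Q c').W k' → c = c' := fun h1 h2 =>
    (hmem h1).symm.trans (hmem h2)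
  refine ⟨⟨Σ c, (Q c).κ, fun s => (Q s.1).W s.2, fun x => ?_, fun s => (Q s.1).r s.2,
    fun s => (Q s.1).r' s.2, fun {s x} hx => (Q s.1).le s.2 hx, fun {s x} hx => (Q s.1).le' s.2 hx,
    fun s _ => B s.1.out, fun s => (Q s.1).p s.2, fun s => (Q s.1).phat s.2,
    sigmaCochain fun c => (Q c).z, sigmaCochain fun c => (Q c).zhat, sigmaCochain fun c => (Q c).e,
    fun s x _ => Filter.Eventually.of_forall fun _ => rfl, fun s => (Q s.1).p_smooth s.2,
    fun s => (Q s.1).phat_smooth s.2, ?_, ?_, ?_, ?_, ?_, ?_, ?_⟩⟩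
  · have h1 : x ∈ connectedComponent (x : ConnectedComponents X).out :=
      ConnectedComponents.coe_eq_coe'.1 (Quotient.out_eq' (x : ConnectedComponents X)).symm
    rw [← (Q x).cover] at h1
    obtain ⟨k, hk⟩ := Set.mem_iUnion.1 h1
    exact ⟨⟨x, k⟩, hk⟩
  · rintro ⟨c, k⟩ ⟨c', k'⟩ x ⟨hk, hk'⟩
    obtain rfl := hsame hk hk'
    rw [sigmaCochain_same]
    exact (Q c).z_const k k' x ⟨hk, hk'⟩
  · rintro ⟨c, k⟩ ⟨c', k'⟩ x ⟨hk, hk'⟩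
    obtain rfl := hsame hk hk'
    rw [sigmaCochain_same]
    exact (Q c).zhat_const k k' x ⟨hk, hk'⟩
  · rintro ⟨c, k⟩ ⟨c', k'⟩ x ⟨hk, hk'⟩
    obtain rfl := hsame hk hk'
    rw [sigmaCochain_same]
    exact (Q c).e_smooth k k' x ⟨hk, hk'⟩
  · rintro ⟨c, k⟩ ⟨c', k'⟩ x hk hk'
    obtain rfl := hsame hk hk'
    rfl
  · rintro ⟨c, k⟩ ⟨c', k'⟩ x hk hk'
    obtain rfl := hsame hk hk'
    rw [sigmaCochain_same]
    exact ((Q c).a_eq k k' x hk hk').symm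
  · rintro ⟨c, k⟩ ⟨c', k'⟩ x hk hk'
    obtain rfl := hsame hk hk'
    rw [sigmaCochain_same]
    have h : _ = _ + (matAct (B c.out) (C.a ((Q c).r k) ((Q c).r k') x)
      + C.ahat ((Q c).r k) ((Q c).r k') x) := (Q c).ahat_eq k k' x hk hk'
    rw [h]
    dsimp only
    abel
  · rintro ⟨c, i⟩ ⟨c', j⟩ ⟨c'', k⟩ x hi hj hk
    obtain rfl := hsame hi hj
    obtain rfl := hsame hi hk
    simp only [sigmaCochain_same]
    have h : _ = (Q c).e i k x + (C.t ((Q c).r i) ((Q c).r j) ((Q c).r k) x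
      - toU (lowForm (B c.out) (intVec (C.m ((Q c).r i) ((Q c).r j) ((Q c).r k) x))
        (C.a ((Q c).r j) ((Q c).r k) x + C.a ((Q c).r i) ((Q c).r j) x))
      - toU (lowForm (B c.out) (C.a ((Q c).r j) ((Q c).r k) x) (C.a ((Q c).r i) ((Q c).r j) x)))
      - toU ((Q c).phat k x ⬝ᵥ intVec (C.m ((Q c).r i) ((Q c).r j) ((Q c).r k) x)) :=
      (Q c).t_eq i j k x hi hj hk
    rw [h]
    have h2 := C.toU_lowForm_a (B c.out) (show x ∈ C.U ((Q c).r i) from (Q c).le i hi)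
      (show x ∈ C.U ((Q c).r j) from (Q c).le j hj) (show x ∈ C.U ((Q c).r k) from (Q c).le k hk)
    rw [← h2]
    abel

end Components
end TDuality

theorem mainTheorem9 {d n : ℕ} (hn : 0 < n) {X : Type u} [TopologicalSpace X]
    [ChartedSpace (EuclideanSpace ℝ (Fin d)) X] [IsManifold (𝓡 d) ∞ X] [T2Space X]
    [SecondCountableTopology X] (C₁ C₂ : TDuality.TDCocycle d n X) :
    [ C₁.toHG.Iso C₂.toHG,
      C₁.leftLeg.Iso C₂.leftLeg,
      ∀ x : X, ∃ B : TDuality.soZ n, (C₁.push B).IsoOn C₂ (connectedComponent x) ].TFAE := by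
  tfae_have 1 → 2 := fun h => by
    obtain ⟨Q⟩ := (TDuality.TwistedEquiv.nonempty_iff C₁ C₂).2 h
    exact (TDuality.LegEquiv.nonempty_iff C₁ C₂).1 ⟨Q.legEquiv⟩
  tfae_have 2 → 1 := fun h => by
    obtain ⟨L⟩ := (TDuality.LegEquiv.nonempty_iff C₁ C₂).2 h
    exact L.toHG_iso
  tfae_have 1 → 3 := fun h => by
    obtain ⟨Q⟩ := (TDuality.TwistedEquiv.nonempty_iff C₁ C₂).2 h
    exact Q.exists_isoOn_component
  tfae_have 3 → 1 := fun h =>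
    (TDuality.TwistedEquiv.nonempty_iff C₁ C₂).1 (TDuality.TwistedEquiv.nonempty_of_components h)
  tfae_finish
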